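/- Let $\Bbbk$ be a field, $n\ge 1$, $R=\Bbbk[x_{i,j}]_{1\le i,j\le n}$, and let $S=\Bbbk[X_{i,j}]_{1\le i,j\le n}$ (standard grading) act on $R$ by contraction: for exponent matrices $s,t\in\mathbb N^{n\times n}$, $X^s\star x^t=x^{t-s}$ if $s\le t$ entrywise and $X^s\star x^t=0$ otherwise, extended $\Bbbk$-bilinearly. For $f\in R$ let $f^\perp=\{g\in S: g\star f=0\}$ be its apolar ideal. Let $\det_n,\operatorname{perm}_n\in R$ be the determinant and the permanent of the matrix $(x_{i,j})$. For $f\in\{\det_n,\operatorname{perm}_n\}$ the module $S/f^\perp$ has a minimal graded free resolution $\cdots\to F_2\to F_1\to F_0\to S/f^\perp\to 0$, $F_i=\bigoplus_j S(-j)^{\beta_{i,j}}$ with $F_i$ of finite rank, and for every such resolution the following holds. The space of linear second syzygies, i.e. the degree-$4$ part of $\ker(F_2\to F_1)$, has dimension $\beta_{3,4}$ over $\Bbbk$, and: (a) if $f=\det_n$ and $\operatorname{char}\Bbbk\ne 2$, then $$\beta_{3,4}=\tfrac{1}{192}(n-1)n^2(n+1)^2(n+2)(5n^2+5n-18)=6\binom{n+1}{4}\binom{n+3}{4}+9\binom{n+2}{4}^2;$$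 (b) if $f=\operatorname{perm}_n$ (and $\operatorname{char}\Bbbk$ is arbitrary), then $$\beta_{3,4}=\tfrac{1}{192}(n-1)n^2(5n^5+25n^4+35n^3-85n^2+8n-84)=6\binom{n+1}{4}\binom{n+3}{4}+9\binom{n+2}{4}^2+2\binom n2\binom n4.$$ -/

import Mathlib

open MvPolynomial

noncomputable section

/-- The contraction action `g ⋆ f` of `g ∈ S` on `f ∈ R` ("differentiation without coefficients"),
as a `k`-linear map in `g`. Both `S` and `R` are polynomial rings in variables indexed by `ι`; the
variable `X i` of `S` stands for `xᵢ⁻¹`. A monomial of `S` with exponent `s` sends a monomial `x ^ t`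
of `R` to `x ^ (t - s)` if `s ≤ t`, and to `0` otherwise; this is Mathlib's `divMonomial`. -/
def contractionLinear {ι k : Type*} [Field k] (f : MvPolynomial ι k) :
    MvPolynomial ι k →ₗ[k] MvPolynomial ι k :=
  (basisMonomials ι k).constr k fun s => f.divMonomial s

/-- The contraction `g ⋆ f`. -/
def contraction {ι k : Type*} [Field k] (g f : MvPolynomial ι k) : MvPolynomial ι k :=
  contractionLinear f g

theorem contraction_monomial {ι k : Type*} [Field k] (s : ι →₀ ℕ) (c : k)
    (f : MvPolynomial ι k) : contraction (monomial s c) f = c • f.divMonomial s := by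
  have h : (monomial s c : MvPolynomial ι k) = c • basisMonomials ι k s := by
    rw [coe_basisMonomials, smul_monomial, smul_eq_mul, mul_one]
  rw [contraction, h, map_smul, contractionLinear, Module.Basis.constr_basis]

theorem contraction_mul {ι k : Type*} [Field k] (g h f : MvPolynomial ι k) :
    contraction (g * h) f = contraction g (contraction h f) := by
  have smul_div : ∀ (s : ι →₀ ℕ) (c : k) (p : MvPolynomial ι k),
      (c • p).divMonomial s = c • p.divMonomial s := by
    intro s c p
    ext t
    simp [coeff_divMonomial]
  have add_left : ∀ p q r : MvPolynomial ι k,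
      contraction (p + q) r = contraction p r + contraction q r :=
    fun p q r => map_add (contractionLinear r) p q
  induction h using MvPolynomial.induction_on' generalizing g with
  | monomial t b =>
    induction g using MvPolynomial.induction_on' with
    | monomial s a =>
      rw [monomial_mul, contraction_monomial, contraction_monomial, contraction_monomial,
        smul_div, smul_smul, add_comm s t, divMonomial_add]
    | add p q hp hq => rw [add_mul, add_left, add_left, hp, hq]
  | add p q hp hq =>
    have add_right : ∀ u v w : MvPolynomial ι k,
        contraction u (v + w) = contraction u v + contraction u w := by
      intro u v w
      induction u using MvPolynomial.induction_on' with
      | monomial s a =>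
        rw [contraction_monomial, contraction_monomial, contraction_monomial,
          add_divMonomial, smul_add]
      | add u₁ u₂ h₁ h₂ => rw [add_left, add_left, add_left, h₁, h₂]; abel
    rw [mul_add, add_left, add_left, add_right, hp, hq]

/-- The apolar ideal `f^⊥ = {g ∈ S | g ⋆ f = 0}`. -/
def apolarIdeal {ι k : Type*} [Field k] (f : MvPolynomial ι k) : Ideal (MvPolynomial ι k) where
  carrier := {g | contraction g f = 0}
  add_mem' {a b} ha hb := by
    have h : contraction (a + b) f = contraction a f + contraction b f :=
      map_add (contractionLinear f) a b
    simp only [Set.mem_ofPred_eq] at ha hb ⊢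
    rw [h, ha, hb, add_zero]
  zero_mem' := map_zero (contractionLinear f)
  smul_mem' c x hx := by
    simp only [Set.mem_ofPred_eq, smul_eq_mul] at hx ⊢
    rw [contraction_mul, hx]
    clear hx
    induction c using MvPolynomial.induction_on' with
    | monomial s a => rw [contraction_monomial, zero_divMonomial, smul_zero]
    | add p q hp hq =>
      have h : contraction (p + q) (0 : MvPolynomial ι k) = contraction p 0 + contraction q 0 :=
        map_add (contractionLinear 0) p q
      rw [h, hp, hq, add_zero]

/-- The determinant `det_n` of the generic `n × n` matrix `(x_{i,j})`. -/
def detPoly (k : Type*) [Field k] (n : ℕ) : MvPolynomial (Fin n × Fin n) k :=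
  (Matrix.mvPolynomialX (Fin n) (Fin n) k).det

/-- The permanent `perm_n` of the generic `n × n` matrix `(x_{i,j})`. -/
def permPoly (k : Type*) [Field k] (n : ℕ) : MvPolynomial (Fin n × Fin n) k :=
  (Matrix.mvPolynomialX (Fin n) (Fin n) k).permanent

/-- The homogeneous part of degree `m` of the graded free module `⨁_a S(-deg a)`, for
`S` the polynomial ring with its standard grading: the `a`-th coordinate is homogeneous
of degree `m - deg a` (and vanishes if `m < deg a`). -/
def freeGradedPiece {ι k : Type*} [Field k] {r : ℕ} (deg : Fin r → ℕ) (m : ℕ) :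
    Submodule k (Fin r → MvPolynomial ι k) where
  carrier := {v | ∀ (a : Fin r) (s : ι →₀ ℕ), coeff s (v a) ≠ 0 → s.degree + deg a = m}
  add_mem' {v w} hv hw a s h := by
    by_cases h1 : coeff s (v a) = 0
    · refine hw a s fun h2 => h ?_
      rw [Pi.add_apply, coeff_add, h1, h2, add_zero]
    · exact hv a s h1
  zero_mem' a s h := absurd (coeff_zero s) h
  smul_mem' c v hv a s h := by
    refine hv a s fun h1 => h ?_
    rw [Pi.smul_apply, coeff_smul, h1, smul_zero]

/-- A minimal graded free resolution
`⋯ → F₂ → F₁ → F₀ → S ⧸ I → 0` of `S ⧸ I`, where `S = k[x_i : i ∈ ι]` has the standard grading.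
Here `F i = ⨁_a S(-deg i a)` is free with basis indexed by `Fin (rank i)`, the basis vector with
index `a` being homogeneous of degree `deg i a`, and `d i : F (i + 1) → F i`. -/
structure MinimalGradedFreeResolution {ι k : Type*} [Field k] (I : Ideal (MvPolynomial ι k)) where
  /-- the rank of `F i` -/
  rank : ℕ → ℕ
  /-- the degrees of the basis vectors of `F i` -/
  deg : ∀ i, Fin (rank i) → ℕ
  /-- the differential `F (i + 1) → F i` -/
  d : ∀ i, (Fin (rank (i + 1)) → MvPolynomial ι k) →ₗ[MvPolynomial ι k]
    (Fin (rank i) → MvPolynomial ι k)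
  /-- the augmentation `F 0 → S ⧸ I` -/
  aug : (Fin (rank 0) → MvPolynomial ι k) →ₗ[MvPolynomial ι k] (MvPolynomial ι k ⧸ I)
  /-- the differentials preserve degrees -/
  d_graded : ∀ i m, ∀ v ∈ freeGradedPiece (deg (i + 1)) m, d i v ∈ freeGradedPiece (deg i) m
  /-- the augmentation preserves degrees -/
  aug_graded : ∀ m, ∀ v ∈ freeGradedPiece (deg 0) m,
    ∃ p : MvPolynomial ι k, p.IsHomogeneous m ∧ aug v = Ideal.Quotient.mk I p
  /-- exactness at `F (i + 1)` -/
  exact_d : ∀ i, Function.Exact (d (i + 1)) (d i)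
  /-- exactness at `F 0` -/
  exact_aug : Function.Exact (d 0) aug
  /-- exactness at `S ⧸ I` -/
  aug_surjective : Function.Surjective aug
  /-- minimality: the image of each differential lies in `𝔪 F i`, where `𝔪` is the ideal of
  polynomials without constant term -/
  minimal : ∀ i v a, constantCoeff (d i v a) = 0

namespace MinimalGradedFreeResolution

/-- The graded Betti number `β_{i,j}`: the number of summands `S(-j)` of `F i`. -/
def betti {ι k : Type*} [Field k] {I : Ideal (MvPolynomial ι k)}
    (F : MinimalGradedFreeResolution I) (i j : ℕ) : ℕ :=
  Fintype.card {a : Fin (F.rank i) // F.deg i a = j}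

/-- The space of linear second syzygies: the elements of degree `4` of the kernel of `F 2 → F 1`.
(When the ideal is generated by quadrics, linear relations among them have degree `3`, and linear
relations among those have degree `4`.) -/
def linearSecondSyzygies {ι k : Type*} [Field k] {I : Ideal (MvPolynomial ι k)}
    (F : MinimalGradedFreeResolution I) :
    Submodule k (Fin (F.rank 2) → MvPolynomial ι k) :=
  (LinearMap.ker (F.d 1)).restrictScalars k ⊓ freeGradedPiece (F.deg 2) 4

end MinimalGradedFreeResolution

end

/-! Write V for the span of the variables, N = n², and I for the apolar ideal. Since I is zero in
degrees 0 and 1, minimality makes F₁, F₂, F₃ start in degrees at least 2, 3, 4. Hence the degree-4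
part of ker(F₂ → F₁) is the degree-4 part of F₃, a space of dimension β₃₄, and taking linear parts
twice identifies it with the kernel of ∧²V ⊗ I₂ → V ⊗ I₃. Counting ranks in ∧²V ⊗ I₂ → V ⊗ I₃ → I₄ →
0 gives β₃₄ = C(N,2) dim I₂ − N dim I₃ + dim I₄ + τ, where τ is the dimension of the homology at V ⊗
I₃, that is, of `cubicSyzygies` modulo `koszulRelations` (`betti_eq`).

The dimensions of I_d. For any two positions I contains a quadric (`rule`): the product of two
entries on a line, or otherwise a 2 × 2 permanent (for det, ε = −1) or minor (for perm, ε = 1).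
Rewriting an antidiagonal product as the diagonal one raises the weight Σ i·j, so the rewriting
terminates, and products of entries along north-west to south-east chains span S/I. Such a standard
monomial is determined by its row and column degrees and divides a permutation monomial, so
contraction detects it: the standard monomials are a basis of S/I, with C(n,d)² of them in degree d.

The number τ. A Buchberger-type argument along the weight (`mem_of_syzygy`) shows that, modulo
Koszul relations, every syzygy in V ⊗ I₃ is a combination of Koszul syzygies between two rules. The
2 × 2 relations, and the braid relation among minors on three rows and columns, kill all of these
(`syzygy_eq_zero`) except those pairing two entries of one row with two entries of another in four
distinct columns, and their transposes. Exchanging a column between the two rows multiplies such a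
syzygy T by ε (`syzygy_rows_exchange`). Three exchanges lead back to T, so T = ε³T = εT; if ε ≠ 1,
as for det outside characteristic 2, T vanishes and τ = 0.

If ε = 1, T is symmetric in the four columns, which leaves at most one class for each choice of two
rows and four columns, or the transpose. Functionals that sum coefficients in a fixed row and column
multidegree vanish on Koszul relations and form a dual family to these classes, so τ = 2 C(n,2)
C(n,4). -/

noncomputable section

/-! ### Graded submodules of free modules and their minimal covers -/

section GradedPieces

variable {ι k : Type*} [Field k] {r r' : ℕ}

/-- The projection of the graded free module `⨁_a S(-deg a)` onto its part of degree `m`. -/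
def freeComponent (deg : Fin r → ℕ) (m : ℕ) :
    (Fin r → MvPolynomial ι k) →ₗ[k] (Fin r → MvPolynomial ι k) :=
  LinearMap.pi fun a =>
    (if deg a ≤ m then homogeneousComponent (m - deg a) else 0) ∘ₗ LinearMap.proj a

theorem coeff_freeComponent (deg : Fin r → ℕ) (m : ℕ) (v : Fin r → MvPolynomial ι k)
    (a : Fin r) (s : ι →₀ ℕ) :
    coeff s (freeComponent deg m v a) = if s.degree + deg a = m then coeff s (v a) else 0 := by
  unfold freeComponent
  simp only [LinearMap.pi_apply, LinearMap.comp_apply, LinearMap.proj_apply]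
  split_ifs with h1 h2 h2
  · rw [coeff_homogeneousComponent, if_pos (by omega)]
  · rw [coeff_homogeneousComponent, if_neg (by omega)]
  · omega
  · simp

theorem freeComponent_mem (deg : Fin r → ℕ) (m : ℕ) (v : Fin r → MvPolynomial ι k) :
    freeComponent deg m v ∈ freeGradedPiece deg m := by
  intro a s h
  rw [coeff_freeComponent] at h
  by_contra h'
  simp [h'] at h

theorem freeComponent_of_mem {deg : Fin r → ℕ} {m : ℕ} {v : Fin r → MvPolynomial ι k}
    (hv : v ∈ freeGradedPiece deg m) (m' : ℕ) :
    freeComponent deg m' v = if m' = m then v else 0 := by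
  ext a s
  rw [coeff_freeComponent]
  by_cases hc : coeff s (v a) = 0
  · split_ifs <;> simp [hc]
  · have := hv a s hc
    split_ifs <;> simp_all

theorem exists_sum_freeComponent (deg : Fin r → ℕ) (v : Fin r → MvPolynomial ι k) :
    ∃ M : ℕ, v = ∑ m ∈ Finset.range M, freeComponent deg m v := by
  refine ⟨∑ a, ((v a).totalDegree + deg a) + 1, ?_⟩
  ext a s
  rw [Finset.sum_apply, coeff_sum]
  simp only [coeff_freeComponent, Finset.sum_ite_eq, Finset.mem_range]
  split_ifs with h
  · rfl
  · by_contra hc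
    apply h
    have h1 : s.degree ≤ (v a).totalDegree := by
      have := le_totalDegree (p := v a) (mem_support_iff.mpr hc)
      rwa [Finsupp.degree_apply]
    have h2 : (v a).totalDegree + deg a ≤ ∑ a, ((v a).totalDegree + deg a) :=
      Finset.single_le_sum (f := fun a => (v a).totalDegree + deg a) (fun _ _ => Nat.zero_le _)
        (Finset.mem_univ a)
    omega

theorem map_freeComponent {deg : Fin r → ℕ} {deg' : Fin r' → ℕ}
    {d : (Fin r → MvPolynomial ι k) →ₗ[MvPolynomial ι k] (Fin r' → MvPolynomial ι k)}
    (hd : ∀ m, ∀ v ∈ freeGradedPiece deg m, d v ∈ freeGradedPiece deg' m) (m : ℕ)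
    (v : Fin r → MvPolynomial ι k) :
    d (freeComponent deg m v) = freeComponent deg' m (d v) := by
  obtain ⟨M, hM⟩ := exists_sum_freeComponent deg v
  have h1 : ∀ m', freeComponent deg' m (d (freeComponent deg m' v)) =
      if m = m' then d (freeComponent deg m' v) else 0 := fun m' =>
    freeComponent_of_mem (hd m' _ (freeComponent_mem deg m' v)) m
  have h2 : freeComponent deg m v = ∑ m' ∈ Finset.range M,
      if m = m' then freeComponent deg m' v else 0 := by
    conv_lhs => rw [hM]
    rw [map_sum]
    exact Finset.sum_congr rfl fun m' _ => freeComponent_of_mem (freeComponent_mem deg m' v) m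
  conv_rhs => rw [hM]
  rw [map_sum, map_sum, h2, map_sum]
  refine Finset.sum_congr rfl fun m' _ => ?_
  rw [h1]
  split_ifs <;> simp

/-- A submodule of a graded free module is graded if it contains the homogeneous parts of its
elements. -/
def IsGradedSubmodule (deg : Fin r → ℕ)
    (M : Submodule (MvPolynomial ι k) (Fin r → MvPolynomial ι k)) : Prop :=
  ∀ v ∈ M, ∀ m, freeComponent deg m v ∈ M

theorem isGradedSubmodule_ker {deg : Fin r → ℕ} {deg' : Fin r' → ℕ}
    {d : (Fin r → MvPolynomial ι k) →ₗ[MvPolynomial ι k] (Fin r' → MvPolynomial ι k)}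
    (hd : ∀ m, ∀ v ∈ freeGradedPiece deg m, d v ∈ freeGradedPiece deg' m) :
    IsGradedSubmodule deg (LinearMap.ker d) := by
  intro v hv m
  rw [LinearMap.mem_ker] at hv ⊢
  rw [map_freeComponent hd, hv, map_zero]

theorem mul_mem_freeGradedPiece {deg : Fin r → ℕ} {m j : ℕ} {v : Fin r → MvPolynomial ι k}
    (hv : v ∈ freeGradedPiece deg m) {p : MvPolynomial ι k} (hp : p.IsHomogeneous j) :
    p • v ∈ freeGradedPiece deg (j + m) := by
  classical
  intro a s hs
  rw [Pi.smul_apply, smul_eq_mul, coeff_mul] at hs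
  obtain ⟨x, hx, hne⟩ := Finset.exists_ne_zero_of_sum_ne_zero hs
  have h1 := hv a x.2 (right_ne_zero_of_mul hne)
  have h2 : x.1.degree = j := by
    by_contra h
    exact left_ne_zero_of_mul hne (hp.coeff_eq_zero h)
  have h3 := Finset.HasAntidiagonal.mem_antidiagonal.mp hx
  rw [← h3, map_add]
  omega

theorem single_mem_freeGradedPiece {deg : Fin r → ℕ} {m j : ℕ} {a : Fin r}
    {p : MvPolynomial ι k} (hp : p.IsHomogeneous j) (h : j + deg a = m) :
    Pi.single a p ∈ freeGradedPiece deg m := by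
  intro b s hs
  by_cases hb : b = a
  · subst hb
    rw [Pi.single_eq_same] at hs
    have : s.degree = j := by
      by_contra h
      exact hs (hp.coeff_eq_zero h)
    omega
  · rw [Pi.single_eq_of_ne hb] at hs
    simp at hs

theorem isHomogeneous_of_mem {deg : Fin r → ℕ} {m : ℕ} {v : Fin r → MvPolynomial ι k}
    (hv : v ∈ freeGradedPiece deg m) {a : Fin r} {j : ℕ} (h : j + deg a = m) :
    (v a).IsHomogeneous j := by
  intro s hs
  have := hv a s hs
  have h2 := DFunLike.congr_fun (Finsupp.degree_eq_weight_one (σ := ι) (R := ℕ)) s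
  exact h2.symm.trans (by omega)

/-- A graded submodule is generated by finitely many homogeneous elements. -/
theorem IsGradedSubmodule.exists_generators [Finite ι] {deg : Fin r → ℕ}
    {M : Submodule (MvPolynomial ι k) (Fin r → MvPolynomial ι k)}
    (hM : IsGradedSubmodule deg M) :
    ∃ (q : ℕ) (deg' : Fin q → ℕ) (g : Fin q → Fin r → MvPolynomial ι k),
      (∀ a, g a ∈ freeGradedPiece deg (deg' a)) ∧
      Submodule.span (MvPolynomial ι k) (Set.range g) = M := by
  let H : Set (Fin r → MvPolynomial ι k) := {v | v ∈ M ∧ ∃ m, v ∈ freeGradedPiece deg m}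
  have hH : Submodule.span (MvPolynomial ι k) H = M := by
    apply le_antisymm
    · exact Submodule.span_le.mpr fun v hv => hv.1
    · intro v hv
      obtain ⟨N, hN⟩ := exists_sum_freeComponent deg v
      rw [hN]
      exact Submodule.sum_mem _ fun m _ =>
        Submodule.subset_span ⟨hM v hv m, m, freeComponent_mem deg m v⟩
  have hfg : (Submodule.span (MvPolynomial ι k) H).FG := IsNoetherian.noetherian _
  obtain ⟨t, ht, hspan⟩ := (Submodule.fg_span_iff_fg_span_finset_subset H).mp hfg
  have hmem : ∀ x : t, ∃ m, (x : Fin r → MvPolynomial ι k) ∈ freeGradedPiece deg m :=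
    fun x => (ht x.2).2
  choose m hm using hmem
  refine ⟨t.card, fun a => m (t.equivFin.symm a), fun a => t.equivFin.symm a,
    fun a => hm _, ?_⟩
  rw [← hH, hspan]
  congr 1
  ext v
  constructor
  · rintro ⟨a, rfl⟩
    exact (t.equivFin.symm a).2
  · intro hv
    exact ⟨t.equivFin ⟨v, hv⟩, by simp⟩

/-- The linear map `⨁_a S(-deg' a) → F` given by homogeneous elements `g a` preserves degrees. -/
theorem linearCombination_mem_freeGradedPiece {deg : Fin r → ℕ} {deg' : Fin r' → ℕ}
    {g : Fin r' → Fin r → MvPolynomial ι k}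
    (hg : ∀ a, g a ∈ freeGradedPiece deg (deg' a)) (m : ℕ) (v : Fin r' → MvPolynomial ι k)
    (hv : v ∈ freeGradedPiece deg' m) :
    Fintype.linearCombination (MvPolynomial ι k) g v ∈ freeGradedPiece deg m := by
  rw [Fintype.linearCombination_apply]
  refine Submodule.sum_mem _ fun a _ => ?_
  by_cases h : deg' a ≤ m
  · have := mul_mem_freeGradedPiece (hg a) (isHomogeneous_of_mem hv (Nat.sub_add_cancel h))
    rwa [Nat.sub_add_cancel h] at this
  · have h0 : v a = 0 := by
      ext s
      rw [coeff_zero]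
      by_contra hc
      have := hv a s hc
      omega
    rw [h0, zero_smul]
    exact Submodule.zero_mem _

/-- A graded submodule is the image of a degree-preserving map from a graded free module whose
kernel consists of vectors with coordinates without constant term. -/
theorem IsGradedSubmodule.exists_minimal_cover [Finite ι] {deg : Fin r → ℕ}
    {M : Submodule (MvPolynomial ι k) (Fin r → MvPolynomial ι k)}
    (hM : IsGradedSubmodule deg M) :
    ∃ (q : ℕ) (deg' : Fin q → ℕ)
      (d : (Fin q → MvPolynomial ι k) →ₗ[MvPolynomial ι k] (Fin r → MvPolynomial ι k)),
      (∀ m, ∀ v ∈ freeGradedPiece deg' m, d v ∈ freeGradedPiece deg m) ∧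
      LinearMap.range d = M ∧ ∀ v, d v = 0 → ∀ a, constantCoeff (v a) = 0 := by
  classical
  -- The cover uses a homogeneous generating family with the fewest members.
  have hex := hM.exists_generators
  obtain ⟨deg', g, hg, hspan⟩ := Nat.find_spec hex
  refine ⟨Nat.find hex, deg', Fintype.linearCombination (MvPolynomial ι k) g,
    linearCombination_mem_freeGradedPiece hg, ?_, ?_⟩
  · rw [Fintype.range_linearCombination, hspan]
  intro v hv b
  by_contra hb
  -- Taking the component of degree `deg' b` turns the coordinate at `b` into a nonzero constant.
  -- The resulting relation expresses the generator `g b` through the others, so one generator fewer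
  -- would suffice.
  set w := freeComponent deg' (deg' b) v with hw
  have hdw : Fintype.linearCombination (MvPolynomial ι k) g w = 0 := by
    rw [hw, map_freeComponent (linearCombination_mem_freeGradedPiece hg), hv, map_zero]
  have hwb : w b = C (constantCoeff (v b)) := by
    ext s
    rw [hw, coeff_freeComponent, coeff_C]
    by_cases hs : s = 0
    · subst hs; simp [constantCoeff_eq]
    · rw [if_neg, if_neg (Ne.symm hs)]
      intro h
      exact hs ((Finsupp.degree_eq_zero_iff s).mp (by omega))
  obtain ⟨q, hq⟩ : ∃ q, Nat.find hex = q + 1 := ⟨Nat.find hex - 1, by have := b.2; omega⟩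
  refine Nat.find_min hex (m := q) (by omega) ?_
  let e : Fin (q + 1) ≃ Fin (Nat.find hex) := finCongr hq.symm
  let c := e.symm b
  refine ⟨fun a => deg' (e (c.succAbove a)), fun a => g (e (c.succAbove a)), fun a => hg _, ?_⟩
  refine Eq.trans ?_ hspan
  apply le_antisymm
  · refine Submodule.span_mono ?_
    rintro _ ⟨a, rfl⟩
    exact ⟨_, rfl⟩
  · rw [Submodule.span_le]
    set P := Submodule.span (MvPolynomial ι k) (Set.range fun a => g (e (c.succAbove a))) with hP
    have hne : ∀ a, a ≠ b → g a ∈ P := by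
      intro a ha
      have : e.symm a ≠ c := fun h => ha (e.symm.injective h)
      obtain ⟨x, hx⟩ := Fin.exists_succAbove_eq this
      exact Submodule.subset_span ⟨x, by simp [hx]⟩
    rintro _ ⟨a, rfl⟩
    by_cases ha : a = b
    · subst ha
      rw [Fintype.linearCombination_apply, ← Finset.add_sum_erase _ _ (Finset.mem_univ a),
        hwb] at hdw
      have h1 : (C (constantCoeff (v a)) : MvPolynomial ι k) • g a ∈ P := by
        rw [eq_neg_of_add_eq_zero_left hdw]
        exact P.neg_mem (Submodule.sum_mem _ fun x hx =>
          P.smul_mem _ (hne x (Finset.ne_of_mem_erase hx)))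
      have h2 := P.smul_mem (C (constantCoeff (v a))⁻¹) h1
      rwa [smul_smul, ← C_mul, inv_mul_cancel₀ hb, C_1, one_smul] at h2
    · exact hne a ha

end GradedPieces

/-! ### Existence of minimal graded free resolutions -/

section Existence

variable {ι k : Type*} [Field k] [Finite ι]

/-- A graded submodule of `𝔪 F`, for `F` a graded free module. -/
structure GradedSubmoduleData (ι k : Type*) [Field k] where
  /-- the rank of the ambient free module -/
  rank : ℕ
  /-- the degrees of the basis vectors of the ambient free module -/
  deg : Fin rank → ℕ
  /-- the submodule -/
  sub : Submodule (MvPolynomial ι k) (Fin rank → MvPolynomial ι k)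
  graded : IsGradedSubmodule deg sub
  minimal : ∀ v ∈ sub, ∀ a, constantCoeff (v a) = 0

namespace GradedSubmoduleData

/-- The degree-preserving cover of a graded submodule by a free module. -/
theorem exists_cover (A : GradedSubmoduleData ι k) : ∃ (B : GradedSubmoduleData ι k)
    (d : (Fin B.rank → MvPolynomial ι k) →ₗ[MvPolynomial ι k] (Fin A.rank → MvPolynomial ι k)),
    (∀ m, ∀ v ∈ freeGradedPiece B.deg m, d v ∈ freeGradedPiece A.deg m) ∧
    LinearMap.range d = A.sub ∧ LinearMap.ker d = B.sub := by
  obtain ⟨q, deg', d, h1, h2, h3⟩ := A.graded.exists_minimal_cover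
  exact ⟨⟨q, deg', LinearMap.ker d, isGradedSubmodule_ker h1, fun v hv => h3 v hv⟩, d, h1, h2, rfl⟩

/-- The kernel of the cover. -/
def next (A : GradedSubmoduleData ι k) : GradedSubmoduleData ι k := A.exists_cover.choose

/-- The covering map. -/
def cover (A : GradedSubmoduleData ι k) :
    (Fin A.next.rank → MvPolynomial ι k) →ₗ[MvPolynomial ι k] (Fin A.rank → MvPolynomial ι k) :=
  A.exists_cover.choose_spec.choose

theorem cover_spec (A : GradedSubmoduleData ι k) :
    (∀ m, ∀ v ∈ freeGradedPiece A.next.deg m, A.cover v ∈ freeGradedPiece A.deg m) ∧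
    LinearMap.range A.cover = A.sub ∧ LinearMap.ker A.cover = A.next.sub :=
  A.exists_cover.choose_spec.choose_spec

theorem exact_cover (A : GradedSubmoduleData ι k) : Function.Exact A.next.cover A.cover :=
  LinearMap.exact_iff.mpr (A.cover_spec.2.2.trans A.next.cover_spec.2.1.symm)

/-- Iterated kernels. -/
def iter (A : GradedSubmoduleData ι k) : ℕ → GradedSubmoduleData ι k
  | 0 => A
  | i + 1 => (A.iter i).next

end GradedSubmoduleData

/-- Start from I inside S, a free module of rank one in degree 0, and cover successive kernels. Each
kernel again lies in 𝔪 times its free module, so the construction iterates; properness of I supplies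
this at the first step. -/
theorem exists_minimalGradedFreeResolution (I : Ideal (MvPolynomial ι k))
    (hI : ∀ p ∈ I, ∀ m, homogeneousComponent m p ∈ I) (hproper : ∀ p ∈ I, constantCoeff p = 0) :
    Nonempty (MinimalGradedFreeResolution I) := by
  let A : GradedSubmoduleData ι k :=
    { rank := 1
      deg := fun _ => 0
      sub := Submodule.comap (LinearMap.proj (φ := fun _ : Fin 1 => MvPolynomial ι k) 0) I
      graded := by
        intro v hv m
        have : freeComponent (fun _ => 0) m v 0 = homogeneousComponent m (v 0) := by
          simp [freeComponent]
        rw [Submodule.mem_comap, LinearMap.proj_apply, this]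
        exact hI _ hv m
      minimal := by
        intro v hv a
        rw [Subsingleton.elim a 0]
        exact hproper _ hv }
  refine ⟨
    { rank := fun i => (A.iter i).rank
      deg := fun i => (A.iter i).deg
      d := fun i => (A.iter i).cover
      aug := (Submodule.mkQ I) ∘ₗ LinearMap.proj (φ := fun _ : Fin 1 => MvPolynomial ι k) 0
      d_graded := fun i => (A.iter i).cover_spec.1
      aug_graded := fun m v hv => ⟨v (0 : Fin 1), isHomogeneous_of_mem hv (by rfl), rfl⟩
      exact_d := fun i => (A.iter i).exact_cover
      exact_aug := ?_
      aug_surjective := ?_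
      minimal := fun i v a => ?_ }⟩
  · intro y
    exact (Submodule.Quotient.mk_eq_zero I).trans
      (SetLike.ext_iff.mp A.cover_spec.2.1 y).symm
  · intro y
    obtain ⟨p, rfl⟩ := Submodule.mkQ_surjective I y
    exact ⟨fun _ => p, rfl⟩
  · refine (A.iter i).minimal _ ?_ a
    rw [← (A.iter i).cover_spec.2.1]
    exact LinearMap.mem_range_self _ v

end Existence

/-! ### Linear parts of vectors of polynomials -/

/-- The homogeneous part of degree `m` of an ideal. -/
def idealPart {ι k : Type*} [Field k] (I : Ideal (MvPolynomial ι k)) (m : ℕ) :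
    Submodule k (MvPolynomial ι k) :=
  I.restrictScalars k ⊓ homogeneousSubmodule ι k m

section LinearPart

variable {ι k : Type*} [Field k] {r : ℕ}

theorem eq_C_constantCoeff_of_mem {deg : Fin r → ℕ} {m : ℕ} {v : Fin r → MvPolynomial ι k}
    (hv : v ∈ freeGradedPiece deg m) {a : Fin r} (ha : m ≤ deg a) :
    v a = C (constantCoeff (v a)) := by
  classical
  ext s
  rw [coeff_C]
  split_ifs with h
  · rw [← h, constantCoeff_eq]
  · by_contra hc
    have := hv a s hc
    exact h ((Finsupp.degree_eq_zero_iff s).mp (by omega)).symm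

theorem eq_zero_of_mem_of_constantCoeff {deg : Fin r → ℕ} {m : ℕ} {v : Fin r → MvPolynomial ι k}
    (hv : v ∈ freeGradedPiece deg m) (hdeg : ∀ a, m ≤ deg a)
    (h0 : ∀ a, constantCoeff (v a) = 0) : v = 0 := by
  ext1 a
  rw [eq_C_constantCoeff_of_mem hv (hdeg a), h0, C_0, Pi.zero_apply]

/-- The coefficient of the variable `a` in the coordinates of a vector of polynomials. -/
def linPart (a : ι) : (Fin r → MvPolynomial ι k) →ₗ[k] (Fin r → MvPolynomial ι k) :=
  LinearMap.pi fun p => Algebra.linearMap k (MvPolynomial ι k) ∘ₗ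
    lcoeff k (Finsupp.single a 1) ∘ₗ LinearMap.proj p

theorem linPart_apply (a : ι) (v : Fin r → MvPolynomial ι k) (p : Fin r) :
    linPart a v p = C (coeff (Finsupp.single a 1) (v p)) := rfl

theorem linPart_mem {deg : Fin r → ℕ} {m : ℕ} {v : Fin r → MvPolynomial ι k}
    (hv : v ∈ freeGradedPiece deg (m + 1)) (a : ι) : linPart a v ∈ freeGradedPiece deg m := by
  classical
  intro p s hs
  rw [linPart_apply, coeff_C] at hs
  split_ifs at hs with h
  · subst h
    have := hv p _ hs
    rw [Finsupp.degree_single] at this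
    rw [map_zero]
    omega
  · exact absurd rfl hs

theorem linPart_sum [Fintype ι] {u : ι → Fin r → MvPolynomial ι k}
    (hu : ∀ a p, u a p = C (constantCoeff (u a p))) (b : ι) :
    linPart b (∑ a, (X a : MvPolynomial ι k) • u a) = u b := by
  classical
  ext1 p
  rw [linPart_apply, Finset.sum_apply, coeff_sum, hu b p]
  congr 1
  rw [Finset.sum_eq_single b]
  · rw [Pi.smul_apply, smul_eq_mul, hu b p, mul_comm, coeff_C_mul, coeff_X, if_pos rfl, mul_one,
      constantCoeff_C]
  · intro c _ hc
    rw [Pi.smul_apply, smul_eq_mul, hu c p, mul_comm, coeff_C_mul, coeff_X, if_neg, mul_zero]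
    intro h
    exact hc (Finsupp.single_left_injective one_ne_zero h)
  · simp

theorem eq_sum_linPart [Fintype ι] {deg : Fin r → ℕ} {m : ℕ} {v : Fin r → MvPolynomial ι k}
    (hv : v ∈ freeGradedPiece deg (m + 1)) (hdeg : ∀ a, m ≤ deg a)
    (h0 : ∀ a, constantCoeff (v a) = 0) : v = ∑ a, (X a : MvPolynomial ι k) • linPart a v := by
  classical
  ext p s
  rw [Finset.sum_apply, coeff_sum]
  simp only [Pi.smul_apply, smul_eq_mul, linPart_apply, mul_comm (X _), coeff_C_mul, coeff_X]
  by_cases hs : coeff s (v p) = 0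
  · rw [hs]
    symm
    refine Finset.sum_eq_zero fun a _ => ?_
    split_ifs with h
    · rw [h, hs, zero_mul]
    · rw [mul_zero]
  · have h1 := hv p s hs
    have h2 := hdeg p
    have h3 : s.degree = 1 := by
      have : s.degree ≠ 0 := by
        intro h
        rw [Finsupp.degree_eq_zero_iff] at h
        subst h
        exact hs (h0 p)
      omega
    obtain ⟨a, rfl⟩ : ∃ a, s = Finsupp.single a 1 := by
      have h4 : s ∈ Set.range fun a : ι => Finsupp.single a 1 := by
        rw [Finsupp.range_single_one]
        exact h3
      obtain ⟨a, ha⟩ := h4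
      exact ⟨a, ha.symm⟩
    rw [Finset.sum_eq_single a]
    · simp
    · intro b _ hb
      rw [if_neg, mul_zero]
      intro h
      exact hb (Finsupp.single_left_injective one_ne_zero h)
    · simp

/-- The coefficient of X_c² is the constant `u c c` itself, with no factor 2, and that of X_c X_d is
`u c d + u d c`. The conclusion is therefore valid in characteristic 2, where antisymmetry alone
would not kill the diagonal. -/
theorem alternating_of_sum_eq_zero [Fintype ι] {u : ι → ι → MvPolynomial ι k}
    (hu : ∀ a b, u a b = C (constantCoeff (u a b)))
    (h : ∑ a, ∑ b, X a * (X b * u a b) = 0) :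
    (∀ a, u a a = 0) ∧ ∀ a b, u a b = -u b a := by
  classical
  have hmon : ∀ a b, X a * (X b * u a b) =
      monomial (Finsupp.single a 1 + Finsupp.single b 1) (constantCoeff (u a b)) := by
    intro a b
    conv_lhs => rw [hu a b]
    rw [X, X, mul_comm (monomial _ _) (C _), C_mul_monomial, monomial_mul, one_mul, mul_one]
  have key : ∀ c d, ∑ a, ∑ b, (if (a = c ∧ b = d) ∨ (a = d ∧ b = c) then
      constantCoeff (u a b) else 0) = 0 := by
    intro c d
    have := congrArg (coeff (Finsupp.single c 1 + Finsupp.single d 1)) h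
    simp only [coeff_sum, hmon, coeff_monomial, coeff_zero] at this
    refine Eq.trans ?_ this
    refine Finset.sum_congr rfl fun a _ => Finset.sum_congr rfl fun b _ => ?_
    refine if_congr ?_ rfl rfl
    rw [Finsupp.single_add_single_eq_single_add_single one_ne_zero one_ne_zero]
    simp
  constructor
  · intro c
    have := key c c
    simp only [or_self, ite_and] at this
    simp at this
    rw [hu c c, this, C_0]
  · intro c d
    by_cases hcd : c = d
    · subst hcd
      have := key c c
      simp only [or_self, ite_and] at this
      simp at this
      rw [hu c c, this, C_0, neg_zero]
    have := key c d
    have h2 : ∀ a b, (if (a = c ∧ b = d) ∨ (a = d ∧ b = c) then constantCoeff (u a b) else 0) =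
        (if a = c then if b = d then constantCoeff (u a b) else 0 else 0) +
        (if a = d then if b = c then constantCoeff (u a b) else 0 else 0) := by
      intro a b
      by_cases h1 : a = c
      · have h3 : a ≠ d := fun h => hcd (h1.symm.trans h)
        simp [h1, hcd]
      · simp [h1, ite_and]
    simp only [h2, Finset.sum_add_distrib] at this
    simp at this
    rw [hu c d, hu d c, ← C_neg]
    congr 1
    exact eq_neg_of_add_eq_zero_left this

end LinearPart

/-! ### The beginning of a minimal resolution, and linear second syzygies as a Koszul kernel -/

/-- The kernel of `∧² V ⊗ I₂ → V ⊗ I₃`: alternating families of elements of `I₂` whose contraction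
with the variables vanishes. -/
def alternatingSyzygies {ι k : Type*} [Field k] [Fintype ι] (I : Ideal (MvPolynomial ι k)) :
    Submodule k (ι → ι → MvPolynomial ι k) where
  carrier := {h | (∀ a b, h a b ∈ idealPart I 2) ∧ (∀ a, h a a = 0) ∧ (∀ a b, h a b = -h b a) ∧
    ∀ a, ∑ b, X b * h a b = 0}
  add_mem' := by
    rintro g h ⟨g1, g2, g3, g4⟩ ⟨h1, h2, h3, h4⟩
    refine ⟨fun a b => add_mem (g1 a b) (h1 a b), fun a => ?_, fun a b => ?_, fun a => ?_⟩
    · simp [g2, h2]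
    · simp only [Pi.add_apply]
      rw [g3, h3]
      ring
    · simp [mul_add, Finset.sum_add_distrib, g4, h4]
  zero_mem' := by simp
  smul_mem' := by
    rintro c h ⟨h1, h2, h3, h4⟩
    refine ⟨fun a b => Submodule.smul_mem _ c (h1 a b), fun a => ?_, fun a b => ?_, fun a => ?_⟩
    · simp [h2]
    · simp only [Pi.smul_apply]
      rw [h3, smul_neg]
    · simp [← Finset.smul_sum, h4]

namespace MinimalGradedFreeResolution

variable {ι k : Type*} [Field k] {I : Ideal (MvPolynomial ι k)}

theorem d_eq_zero_iff (F : MinimalGradedFreeResolution I) (i : ℕ)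
    (v : Fin (F.rank (i + 1)) → MvPolynomial ι k) :
    F.d i v = 0 ↔ ∃ w, F.d (i + 1) w = v := F.exact_d i v

theorem constantCoeff_of_d_eq_zero (F : MinimalGradedFreeResolution I) {i : ℕ}
    {v : Fin (F.rank (i + 1)) → MvPolynomial ι k} (hv : F.d i v = 0) (a : Fin (F.rank (i + 1))) :
    constantCoeff (v a) = 0 := by
  obtain ⟨w, rfl⟩ := (F.d_eq_zero_iff i v).mp hv
  exact F.minimal _ _ _

theorem d_single_ne_zero (F : MinimalGradedFreeResolution I) (i : ℕ) (a : Fin (F.rank (i + 1))) :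
    F.d i (Pi.single a 1) ≠ 0 := by
  intro h
  have := F.constantCoeff_of_d_eq_zero h a
  simp at this

/-- A basis vector of F (i + 1) has a nonzero image with coordinates in 𝔪, so its degree must exceed
the least generator degree of F i. -/
theorem lt_deg_succ (F : MinimalGradedFreeResolution I) {i m : ℕ} (h : ∀ a, m ≤ F.deg i a)
    (a : Fin (F.rank (i + 1))) : m < F.deg (i + 1) a := by
  by_contra hlt
  push Not at hlt
  refine F.d_single_ne_zero i a ?_
  refine eq_zero_of_mem_of_constantCoeff (deg := F.deg i) (m := F.deg (i + 1) a)
    (F.d_graded i _ _ ?_) (fun b => hlt.trans (h b)) (F.minimal _ _)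
  exact single_mem_freeGradedPiece (isHomogeneous_one _ _) (zero_add _)

/-- `F 0` is `S`, embedded in degree `0`. -/
theorem exists_basis_zero (F : MinimalGradedFreeResolution I)
    (hproper : ∀ p ∈ I, constantCoeff p = 0) :
    ∃ a : Fin (F.rank 0), (∀ b, b = a) ∧ F.deg 0 a = 0 ∧ ∀ v, F.aug v = 0 ↔ v a ∈ I := by
  classical
  have hp : ∀ a, ∃ p : MvPolynomial ι k, p.IsHomogeneous (F.deg 0 a) ∧
      F.aug (Pi.single a 1) = Ideal.Quotient.mk I p := fun a =>
    F.aug_graded _ _ (single_mem_freeGradedPiece (isHomogeneous_one _ _) (zero_add _))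
  choose p hph hpa using hp
  have haug : ∀ v, F.aug v = Ideal.Quotient.mk I (∑ a, v a * p a) := by
    intro v
    conv_lhs => rw [← Finset.univ_sum_single v]
    rw [map_sum, map_sum]
    refine Finset.sum_congr rfl fun a _ => ?_
    have : (Pi.single a (v a) : Fin (F.rank 0) → MvPolynomial ι k) = v a • Pi.single a 1 := by
      rw [← Pi.single_smul, smul_eq_mul, mul_one]
    rw [this, map_smul, hpa, map_mul]
    rfl
  obtain ⟨v, hv⟩ := F.aug_surjective (Ideal.Quotient.mk I 1)
  rw [haug, Ideal.Quotient.eq] at hv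
  have h1 := hproper _ hv
  rw [map_sub, map_one, map_sum, sub_eq_zero] at h1
  obtain ⟨a, -, ha⟩ := Finset.exists_ne_zero_of_sum_ne_zero (h1.trans_ne one_ne_zero)
  rw [map_mul] at ha
  have hc : constantCoeff (p a) ≠ 0 := right_ne_zero_of_mul ha
  have hdeg : F.deg 0 a = 0 := by
    by_contra h
    refine hc ((hph a).coeff_eq_zero (d := 0) ?_)
    rw [map_zero]
    exact fun h' => h h'.symm
  have hpC : p a = C (constantCoeff (p a)) := by
    ext s
    rw [coeff_C]
    split_ifs with h
    · rw [← h, constantCoeff_eq]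
    · refine (hph a).coeff_eq_zero ?_
      rw [hdeg]
      exact fun h' => h ((Finsupp.degree_eq_zero_iff s).mp h').symm
  -- A second basis vector e_b could be corrected by a multiple of e_a to lie in the kernel of the
  -- augmentation, hence in the image of `d 0`; its coordinate 1 at b contradicts minimality.
  have huniq : ∀ b, b = a := by
    intro b
    by_contra hb
    have h2 : F.aug (Pi.single b 1 - Pi.single a (C (constantCoeff (p a))⁻¹ * p b)) = 0 := by
      rw [haug]
      simp only [Pi.sub_apply, sub_mul, Finset.sum_sub_distrib]
      rw [Finset.sum_eq_single b, Finset.sum_eq_single a]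
      · rw [Pi.single_eq_same, Pi.single_eq_same]
        have h3 : C (constantCoeff (p a))⁻¹ * p b * p a = 1 * p b := by
          conv_lhs => rw [hpC, constantCoeff_C]
          rw [mul_right_comm, ← C_mul, inv_mul_cancel₀ hc, C_1]
        rw [h3, sub_self, map_zero]
      · intro c _ hc'
        rw [Pi.single_eq_of_ne hc', zero_mul]
      · simp
      · intro c _ hc'
        rw [Pi.single_eq_of_ne hc', zero_mul]
      · simp
    obtain ⟨w, hw⟩ := (F.exact_aug _).mp h2
    have h3 := F.minimal 0 w b
    rw [hw, Pi.sub_apply, Pi.single_eq_same, Pi.single_eq_of_ne hb] at h3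
    simp at h3
  refine ⟨a, huniq, hdeg, fun v => ?_⟩
  rw [haug, Ideal.Quotient.eq_zero_iff_mem]
  have : Finset.univ = {a} := by
    ext b; simp [huniq b]
  rw [this, Finset.sum_singleton, hpC]
  constructor
  · intro h
    have := I.mul_mem_right (C (constantCoeff (p a))⁻¹) h
    rwa [mul_assoc, ← C_mul, mul_inv_cancel₀ hc, C_1, mul_one] at this
  · exact fun h => I.mul_mem_right _ h

/-- The generators of `I` given by a minimal resolution. -/
theorem exists_generators (F : MinimalGradedFreeResolution I)
    (hproper : ∀ p ∈ I, constantCoeff p = 0) :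
    ∃ γ : (Fin (F.rank 1) → MvPolynomial ι k) →ₗ[MvPolynomial ι k] MvPolynomial ι k,
      (∀ v, γ v = 0 ↔ F.d 0 v = 0) ∧ (∀ p, p ∈ I ↔ ∃ v, γ v = p) ∧
      (∀ m, ∀ v ∈ freeGradedPiece (F.deg 1) m, (γ v).IsHomogeneous m) ∧
      ∀ a, F.deg 0 a = 0 := by
  obtain ⟨a, huniq, hdeg, haug⟩ := F.exists_basis_zero hproper
  refine ⟨LinearMap.proj a ∘ₗ F.d 0, fun v => ?_, fun p => ?_, fun m v hv => ?_, fun b => ?_⟩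
  · rw [LinearMap.comp_apply, LinearMap.proj_apply]
    refine ⟨fun h => ?_, fun h => by rw [h, Pi.zero_apply]⟩
    ext1 b
    rw [huniq b, h, Pi.zero_apply]
  · constructor
    · intro hp
      obtain ⟨v, hv⟩ := (F.exact_aug (fun _ => p)).mp ((haug _).mpr hp)
      exact ⟨v, by rw [LinearMap.comp_apply, hv, LinearMap.proj_apply]⟩
    · rintro ⟨v, rfl⟩
      exact (haug _).mp ((F.exact_aug _).mpr ⟨v, rfl⟩)
  · exact isHomogeneous_of_mem (F.d_graded 0 m v hv) (by rw [hdeg, add_zero])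
  · rw [huniq b, hdeg]

/-- All generators of F₃ have degree at least 4, so its degree-4 part consists of constant
combinations of the generators of degree exactly 4. On it `d 2` is injective, because the kernel
lies in 𝔪F₃, and by exactness it fills the linear second syzygies. -/
theorem finrank_linearSecondSyzygies_eq_betti (F : MinimalGradedFreeResolution I)
    (h2 : ∀ a, 3 ≤ F.deg 2 a) :
    Module.finrank k F.linearSecondSyzygies = F.betti 3 4 := by
  classical
  have h3 : ∀ a, 4 ≤ F.deg 3 a := fun a => F.lt_deg_succ h2 a
  have h4 : ∀ a, 5 ≤ F.deg 4 a := fun a => F.lt_deg_succ h3 a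
  let T := {a : Fin (F.rank 3) // F.deg 3 a = 4}
  let emb : (T → k) →ₗ[k] (Fin (F.rank 3) → MvPolynomial ι k) :=
    ∑ a : T, (LinearMap.single k (fun _ => MvPolynomial ι k) a.1) ∘ₗ
      Algebra.linearMap k (MvPolynomial ι k) ∘ₗ LinearMap.proj a
  have emb_apply : ∀ (c : T → k) (b : Fin (F.rank 3)),
      emb c b = if h : F.deg 3 b = 4 then C (c ⟨b, h⟩) else 0 := by
    intro c b
    simp only [emb, LinearMap.sum_apply, LinearMap.comp_apply, LinearMap.proj_apply,
      Finset.sum_apply, LinearMap.coe_single, Algebra.linearMap_apply, algebraMap_eq]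
    split_ifs with h
    · rw [Finset.sum_eq_single ⟨b, h⟩, Pi.single_eq_same]
      · intro a _ ha
        exact Pi.single_eq_of_ne (fun h' => ha (Subtype.ext h'.symm)) _
      · simp
    · refine Finset.sum_eq_zero fun a _ => Pi.single_eq_of_ne (fun h' => ?_) _
      exact h (h' ▸ a.2)
  have emb_mem : ∀ c, emb c ∈ freeGradedPiece (F.deg 3) 4 := by
    intro c b s hs
    rw [emb_apply] at hs
    split_ifs at hs with h
    · rw [coeff_C] at hs
      split_ifs at hs with h0
      · rw [← h0, map_zero, zero_add, h]
      · exact absurd rfl hs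
    · simp at hs
  have range_mem : ∀ c, F.d 2 (emb c) ∈ F.linearSecondSyzygies := fun c =>
    ⟨(F.d_eq_zero_iff 1 _).mpr ⟨_, rfl⟩, F.d_graded 2 4 _ (emb_mem c)⟩
  let φ : (T → k) →ₗ[k] F.linearSecondSyzygies :=
    LinearMap.codRestrict _ ((F.d 2).restrictScalars k ∘ₗ emb) range_mem
  have hφ : Function.Bijective φ := by
    constructor
    · rw [← LinearMap.ker_eq_bot, LinearMap.ker_eq_bot']
      intro c hc
      have hc' : F.d 2 (emb c) = 0 := congrArg Subtype.val hc
      have h0 := F.constantCoeff_of_d_eq_zero hc'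
      ext a
      have := h0 a.1
      rw [emb_apply, dif_pos a.2, constantCoeff_C] at this
      exact this
    · rintro ⟨v, hv, hv4⟩
      obtain ⟨w, hw⟩ := (F.d_eq_zero_iff 1 v).mp hv
      let w' := freeComponent (F.deg 3) 4 w
      have hw' : F.d 2 w' = v := by
        rw [map_freeComponent (F.d_graded 2), hw, freeComponent_of_mem hv4, if_pos rfl]
      have hw'mem : w' ∈ freeGradedPiece (F.deg 3) 4 := freeComponent_mem _ _ _
      refine ⟨fun a => constantCoeff (w' a.1), Subtype.ext ?_⟩
      show F.d 2 (emb _) = v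
      rw [← hw']
      congr 1
      ext1 b
      rw [emb_apply]
      split_ifs with h
      · exact (eq_C_constantCoeff_of_mem hw'mem h.ge).symm
      · ext s
        by_contra hc
        have := hw'mem b s (Ne.symm hc)
        have := h3 b
        omega
  rw [← (LinearEquiv.ofBijective φ hφ).finrank_eq, Module.finrank_fintype_fun_eq_card]
  rfl

/-- A generator of F₁ in degree 1 would map to a nonzero linear form in I; the bound for F₂ then
follows from the strict growth of degrees. -/
theorem three_le_deg_two (F : MinimalGradedFreeResolution I)
    (hproper : ∀ p ∈ I, constantCoeff p = 0) (h1 : ∀ p ∈ idealPart I 1, p = 0) :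
    (∀ a, 2 ≤ F.deg 1 a) ∧ ∀ a, 3 ≤ F.deg 2 a := by
  classical
  obtain ⟨γ, hker, hrange, hhom, hdeg0⟩ := F.exists_generators hproper
  have hd1 : ∀ a, 2 ≤ F.deg 1 a := by
    intro a
    have hpos : 0 < F.deg 1 a := F.lt_deg_succ (m := 0) (fun _ => Nat.zero_le _) a
    by_contra hlt
    have hone : F.deg 1 a = 1 := by omega
    refine F.d_single_ne_zero 0 a ((hker _).mp (h1 _ ?_))
    refine ⟨(hrange _).mpr ⟨_, rfl⟩, hhom 1 _ ?_⟩
    exact single_mem_freeGradedPiece (isHomogeneous_one _ _) (by omega)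
  exact ⟨hd1, fun a => F.lt_deg_succ hd1 a⟩

/-- Linear second syzygies are alternating families of elements of `I₂`. -/
theorem finrank_linearSecondSyzygies [Fintype ι] (F : MinimalGradedFreeResolution I)
    (hI : ∀ p ∈ I, constantCoeff p = 0) (h1 : ∀ p ∈ idealPart I 1, p = 0) :
    Module.finrank k F.linearSecondSyzygies = Module.finrank k (alternatingSyzygies I) := by
  classical
  obtain ⟨γ, hker, hrange, hhom, hdeg0⟩ := F.exists_generators hI
  obtain ⟨hd1, hd2⟩ := F.three_le_deg_two hI h1
  have const2 : ∀ u ∈ freeGradedPiece (ι := ι) (k := k) (F.deg 1) 2, ∀ p,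
      u p = C (constantCoeff (u p)) :=
    fun u hu p => eq_C_constantCoeff_of_mem hu (hd1 p)
  have const3 : ∀ u ∈ freeGradedPiece (ι := ι) (k := k) (F.deg 2) 3, ∀ p, u p = C (constantCoeff (u p)) :=
    fun u hu p => eq_C_constantCoeff_of_mem hu (hd2 p)
  have γ_inj : ∀ u ∈ freeGradedPiece (ι := ι) (k := k) (F.deg 1) 2, γ u = 0 → u = 0 := fun u hu h =>
    eq_zero_of_mem_of_constantCoeff hu hd1 (F.constantCoeff_of_d_eq_zero ((hker u).mp h))
  have d_inj : ∀ u ∈ freeGradedPiece (ι := ι) (k := k) (F.deg 2) 3, F.d 1 u = 0 → u = 0 := fun u hu h =>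
    eq_zero_of_mem_of_constantCoeff hu hd2 (F.constantCoeff_of_d_eq_zero h)
  -- A linear second syzygy is v = ∑ X_a v_a with v_a constant, and `d 1` of v_a is ∑ X_b u_ab with
  -- u_ab constant; Φ records the quadrics γ(u_ab). The equation `F.d 1 v = 0` makes u alternating,
  -- and the vanishing of `d 0 ∘ d 1` gives the contraction condition.
  let Φ : (Fin (F.rank 2) → MvPolynomial ι k) →ₗ[k] (ι → ι → MvPolynomial ι k) :=
    LinearMap.pi fun a => LinearMap.pi fun b =>
      γ.restrictScalars k ∘ₗ linPart b ∘ₗ (F.d 1).restrictScalars k ∘ₗ linPart a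
  have Φ_apply : ∀ v a b, Φ v a b = γ (linPart b (F.d 1 (linPart a v))) := fun _ _ _ => rfl
  have d_sum : ∀ w ∈ freeGradedPiece (ι := ι) (k := k) (F.deg 2) 3,
      F.d 1 w = ∑ b, (X b : MvPolynomial ι k) • linPart b (F.d 1 w) := fun w hw =>
    eq_sum_linPart (F.d_graded 1 3 w hw) hd1 (F.minimal 1 w)
  have v_sum : ∀ v ∈ F.linearSecondSyzygies,
      v = ∑ a, (X a : MvPolynomial ι k) • linPart a v := fun v hv =>
    eq_sum_linPart hv.2 hd2 (F.constantCoeff_of_d_eq_zero hv.1)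
  have lin_mem : ∀ v ∈ F.linearSecondSyzygies, ∀ a b,
      linPart b (F.d 1 (linPart a v)) ∈ freeGradedPiece (F.deg 1) 2 := fun v hv a b =>
    linPart_mem (F.d_graded 1 3 _ (linPart_mem hv.2 a)) b
  have lin_alt : ∀ v ∈ F.linearSecondSyzygies,
      (∀ a, linPart a (F.d 1 (linPart a v)) = 0) ∧
      ∀ a b, linPart b (F.d 1 (linPart a v)) = -linPart a (F.d 1 (linPart b v)) := by
    intro v hv
    have hsum : ∑ a, ∑ b, (X a : MvPolynomial ι k) • (X b : MvPolynomial ι k) •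
        linPart b (F.d 1 (linPart a v)) = 0 := by
      have h0 : F.d 1 v = 0 := hv.1
      rw [v_sum v hv, map_sum] at h0
      rw [← h0]
      refine Finset.sum_congr rfl fun a _ => ?_
      rw [map_smul, ← Finset.smul_sum, ← d_sum _ (linPart_mem hv.2 a)]
    have hcoord : ∀ p, (∀ a, linPart a (F.d 1 (linPart a v)) p = 0) ∧
        ∀ a b, linPart b (F.d 1 (linPart a v)) p = -linPart a (F.d 1 (linPart b v)) p := by
      intro p
      refine alternating_of_sum_eq_zero
        (u := fun a b => linPart b (F.d 1 (linPart a v)) p)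
        (fun a b => const2 _ (lin_mem v hv a b) p) ?_
      have := congrFun hsum p
      simpa only [Finset.sum_apply, Pi.smul_apply, smul_eq_mul, Pi.zero_apply] using this
    exact ⟨fun a => funext fun p => (hcoord p).1 a, fun a b => funext fun p => (hcoord p).2 a b⟩
  have Φ_mem : ∀ v ∈ F.linearSecondSyzygies, Φ v ∈ alternatingSyzygies I := by
    intro v hv
    refine ⟨fun a b => ⟨(hrange _).mpr ⟨_, rfl⟩, hhom 2 _ (lin_mem v hv a b)⟩, fun a => ?_,
      fun a b => ?_, fun a => ?_⟩
    · rw [Φ_apply, (lin_alt v hv).1, map_zero]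
    · rw [Φ_apply, Φ_apply, (lin_alt v hv).2, map_neg]
    · have : γ (F.d 1 (linPart a v)) = 0 := by
        rw [hker]
        exact (F.d_eq_zero_iff 0 _).mpr ⟨_, rfl⟩
      rw [← this]
      conv_rhs => rw [d_sum _ (linPart_mem hv.2 a), map_sum]
      exact Finset.sum_congr rfl fun b _ => by rw [map_smul, smul_eq_mul, Φ_apply]
  let φ : F.linearSecondSyzygies →ₗ[k] alternatingSyzygies I :=
    LinearMap.restrict Φ Φ_mem
  have hφ : Function.Bijective φ := by
    constructor
    · rw [← LinearMap.ker_eq_bot, LinearMap.ker_eq_bot']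
      rintro ⟨v, hv⟩ hc
      have hc' : Φ v = 0 := congrArg Subtype.val hc
      have hlin : ∀ a, linPart a v = 0 := by
        intro a
        refine d_inj _ (linPart_mem hv.2 a) ?_
        rw [d_sum _ (linPart_mem hv.2 a)]
        refine Finset.sum_eq_zero fun b _ => ?_
        rw [γ_inj _ (lin_mem v hv a b), smul_zero]
        rw [← Φ_apply, hc']
        rfl
      refine Subtype.ext ?_
      show v = 0
      rw [v_sum v hv]
      exact Finset.sum_eq_zero fun a _ => by rw [hlin, smul_zero]
    · rintro ⟨h, hmem, hdiag, halt, hsum⟩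
      have hu : ∀ a b, ∃ u ∈ freeGradedPiece (F.deg 1) 2, γ u = h a b := by
        intro a b
        obtain ⟨v, hv⟩ := (hrange _).mp (hmem a b).1
        obtain ⟨M, hM⟩ := exists_sum_freeComponent (F.deg 1) v
        refine ⟨freeComponent (F.deg 1) 2 v, freeComponent_mem _ _ _, ?_⟩
        have hc : ∀ m, homogeneousComponent 2 (γ (freeComponent (F.deg 1) m v)) =
            if 2 = m then γ (freeComponent (F.deg 1) m v) else 0 := fun m => by
          have h3 : γ (freeComponent (F.deg 1) m v) ∈ homogeneousSubmodule ι k m :=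
            hhom m _ (freeComponent_mem (F.deg 1) m v)
          rw [homogeneousComponent_of_mem h3]
        have h2 : homogeneousComponent 2 (γ v) = h a b := by
          rw [hv, homogeneousComponent_eq_self (hmem a b).2]
        by_cases hlt : 2 < M
        · conv_lhs at h2 => rw [hM]
          rw [map_sum, map_sum] at h2
          simp only [hc] at h2
          simpa [hlt] using h2
        · have hz : freeComponent (F.deg 1) 2 v = 0 := by
            conv_lhs => rw [hM]
            rw [map_sum]
            refine Finset.sum_eq_zero fun m hm => ?_
            rw [freeComponent_of_mem (freeComponent_mem _ _ _), if_neg]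
            rw [Finset.mem_range] at hm
            omega
          conv_lhs at h2 => rw [hM]
          rw [map_sum, map_sum] at h2
          simp only [hc] at h2
          rw [hz, map_zero, ← h2]
          simp [hlt]
      choose u hu2 huγ using hu
      have hu_alt : (∀ a, u a a = 0) ∧ ∀ a b, u a b = -u b a := by
        constructor
        · intro a
          exact γ_inj _ (hu2 a a) (by rw [huγ, hdiag])
        · intro a b
          rw [← sub_eq_zero]
          refine γ_inj _ (Submodule.sub_mem _ (hu2 a b) (Submodule.neg_mem _ (hu2 b a))) ?_
          rw [map_sub, map_neg, huγ, huγ, halt a b, sub_self]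
      have hw : ∀ a, ∃ w ∈ freeGradedPiece (F.deg 2) 3,
          F.d 1 w = ∑ b, (X b : MvPolynomial ι k) • u a b := by
        intro a
        have hmem3 : ∑ b, (X b : MvPolynomial ι k) • u a b ∈ freeGradedPiece (F.deg 1) 3 :=
          Submodule.sum_mem _ fun b _ => mul_mem_freeGradedPiece (hu2 a b) (isHomogeneous_X _ b)
        have h0 : F.d 0 (∑ b, (X b : MvPolynomial ι k) • u a b) = 0 := by
          rw [← hker, map_sum, ← hsum a]
          exact Finset.sum_congr rfl fun b _ => by rw [map_smul, huγ, smul_eq_mul]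
        obtain ⟨w, hw⟩ := (F.d_eq_zero_iff 0 _).mp h0
        refine ⟨freeComponent (F.deg 2) 3 w, freeComponent_mem _ _ _, ?_⟩
        rw [map_freeComponent (F.d_graded 1), hw, freeComponent_of_mem hmem3, if_pos rfl]
      choose w hw3 hwd using hw
      -- The preimage is assembled in the reverse order: quadrics lift to constant vectors u_ab of
      -- F₁, the linear relations among them lift to w_a in F₂, and alternation makes ∑ X_a w_a a
      -- cycle.
      let v := ∑ a, (X a : MvPolynomial ι k) • w a
      have hv4 : v ∈ freeGradedPiece (F.deg 2) 4 :=
        Submodule.sum_mem _ fun a _ => mul_mem_freeGradedPiece (hw3 a) (isHomogeneous_X _ a)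
      have hv0 : F.d 1 v = 0 := by
        ext1 p
        simp only [v, map_sum, map_smul, hwd, Finset.smul_sum, Finset.sum_apply, Pi.smul_apply,
          smul_eq_mul, Pi.zero_apply]
        rw [← Finset.sum_product']
        refine Finset.sum_involution (fun x _ => (x.2, x.1)) ?_ ?_ (by simp) (by simp)
        · rintro ⟨a, b⟩ -
          have := congrFun (hu_alt.2 a b) p
          simp only [Pi.neg_apply] at this
          simp only [this]
          ring
        · rintro ⟨a, b⟩ - hne heq
          apply hne
          simp only [Prod.mk.injEq] at heq
          rw [heq.1, hu_alt.1]
          simp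
      refine ⟨⟨v, hv0, hv4⟩, Subtype.ext ?_⟩
      show Φ v = h
      ext1 a
      ext1 b
      rw [Φ_apply, linPart_sum (fun a => const3 _ (hw3 a)), hwd,
        linPart_sum (fun b => const2 _ (hu2 a b)), huγ]
  exact (LinearEquiv.ofBijective φ hφ).finrank_eq

end MinimalGradedFreeResolution

/-! ### Standard monomials -/

section Standard

variable {n : ℕ}

/-- Two positions of a matrix are aligned if one is strictly to the north-west of the other. -/
def Aligned (a b : Fin n × Fin n) : Prop :=
  (a.1 < b.1 ∧ a.2 < b.2) ∨ (b.1 < a.1 ∧ b.2 < a.2)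

theorem Aligned.symm {a b : Fin n × Fin n} (h : Aligned a b) : Aligned b a := Or.symm h

/-- Two positions of a matrix which share a row or a column. -/
def SameLine (a b : Fin n × Fin n) : Prop := a.1 = b.1 ∨ a.2 = b.2

/-- A monomial in the entries of the generic matrix is standard if it is a product of entries any
two of which are aligned. -/
def IsStandard (D : Fin n × Fin n →₀ ℕ) : Prop :=
  ∀ a b, Finsupp.single a 1 + Finsupp.single b 1 ≤ D → Aligned a b

theorem not_aligned_self (a : Fin n × Fin n) : ¬Aligned a a := by
  rintro (h | h) <;> exact lt_irrefl _ h.1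

theorem IsStandard.apply_le_one {D : Fin n × Fin n →₀ ℕ} (hD : IsStandard D)
    (a : Fin n × Fin n) : D a ≤ 1 := by
  by_contra h
  refine not_aligned_self a (hD a a ?_)
  rw [← Finsupp.single_add, Finsupp.single_le_iff]
  omega

theorem IsStandard.aligned {D : Fin n × Fin n →₀ ℕ} (hD : IsStandard D) {a b : Fin n × Fin n}
    (ha : D a ≠ 0) (hb : D b ≠ 0) (hab : a ≠ b) : Aligned a b := by
  refine hD a b fun c => ?_
  rw [Finsupp.add_apply, Finsupp.single_apply, Finsupp.single_apply]
  split_ifs with h1 h2 h2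
  · exact absurd (h1.trans h2.symm) hab
  · subst h1; omega
  · subst h2; omega
  · omega

/-- Standard monomials are determined by their row and column degrees. -/
theorem IsStandard.apply_ne_zero_of_sums {D D' : Fin n × Fin n →₀ ℕ} (hD : IsStandard D)
    (hD' : IsStandard D') (hrow : ∀ i, ∑ j, D (i, j) = ∑ j, D' (i, j))
    (hcol : ∀ j, ∑ i, D (i, j) = ∑ i, D' (i, j)) {i j : Fin n} (h : D (i, j) ≠ 0) :
    D' (i, j) ≠ 0 := by
  -- At an occupied position of a chain, the entries in earlier rows are exactly those in earlier
  -- columns. The row sums thus determine how many entries precede the column of the entry in row i.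
  have cum : ∀ E : Fin n × Fin n →₀ ℕ, IsStandard E → ∀ i j, E (i, j) ≠ 0 →
      ∑ i' with i' < i, ∑ j', E (i', j') = ∑ j' with j' < j, ∑ i', E (i', j') := by
    intro E hE i j hij
    rw [Finset.sum_filter, Finset.sum_filter]
    have h1 : ∀ i', (if i' < i then ∑ j', E (i', j') else 0) =
        ∑ j', if i' < i then E (i', j') else 0 := fun i' => by
      split_ifs <;> simp
    have h2 : ∀ j', (if j' < j then ∑ i', E (i', j') else 0) =
        ∑ i', if j' < j then E (i', j') else 0 := fun j' => by
      split_ifs <;> simp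
    simp only [h1, h2]
    rw [Finset.sum_comm]
    refine Finset.sum_congr rfl fun j' _ => Finset.sum_congr rfl fun i' _ => ?_
    by_cases hz : E (i', j') = 0
    · simp [hz]
    · refine if_congr ?_ rfl rfl
      by_cases heq : (i', j') = (i, j)
      · simp only [Prod.mk.injEq] at heq
        simp [heq.1, heq.2]
      · rcases hE.aligned hz hij heq with ⟨h1, h2⟩ | ⟨h1, h2⟩
        · exact iff_of_true h1 h2
        · exact iff_of_false (not_lt.mpr h1.le) (not_lt.mpr h2.le)
  obtain ⟨j', hj'⟩ : ∃ j', D' (i, j') ≠ 0 := by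
    by_contra hcon
    push Not at hcon
    have h0 : ∑ j', D' (i, j') = 0 := Finset.sum_eq_zero fun j' _ => hcon j'
    rw [← hrow, Finset.sum_eq_zero_iff] at h0
    exact h (h0 j (Finset.mem_univ j))
  have e1 := cum D hD i j h
  have e2 := cum D' hD' i j' hj'
  simp only [← hrow, ← hcol] at e2
  have e3 := e1.symm.trans e2
  have pos1 : 0 < ∑ i', D (i', j) :=
    lt_of_lt_of_le (Nat.pos_of_ne_zero h)
      (Finset.single_le_sum (f := fun i' => D (i', j)) (fun _ _ => Nat.zero_le _)
        (Finset.mem_univ i))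
  have pos2 : 0 < ∑ i', D (i', j') := by
    rw [hcol]
    exact lt_of_lt_of_le (Nat.pos_of_ne_zero hj')
      (Finset.single_le_sum (f := fun i' => D' (i', j')) (fun _ _ => Nat.zero_le _)
        (Finset.mem_univ i))
  -- The partial column sums jump after every occupied column, so two occupied columns with equal
  -- partial sums coincide.
  have mono : ∀ x y : Fin n, x < y → 0 < ∑ i', D (i', x) →
      ∑ j' with j' < x, ∑ i', D (i', j') < ∑ j' with j' < y, ∑ i', D (i', j') := by
    intro x y hxy hpos
    refine Finset.sum_lt_sum_of_subset (i := x) (fun z hz => ?_) ?_ ?_ hpos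
      (fun _ _ _ => Nat.zero_le _)
    · simp only [Finset.mem_filter, Finset.mem_univ, true_and] at hz ⊢
      exact hz.trans hxy
    · simpa using hxy
    · simp
  rcases lt_trichotomy j j' with hlt | rfl | hlt
  · exact absurd e3 (mono _ _ hlt pos1).ne
  · exact hj'
  · exact absurd e3 (mono _ _ hlt pos2).ne'

theorem IsStandard.eq_of_sums {D D' : Fin n × Fin n →₀ ℕ} (hD : IsStandard D)
    (hD' : IsStandard D') (hrow : ∀ i, ∑ j, D (i, j) = ∑ j, D' (i, j))
    (hcol : ∀ j, ∑ i, D (i, j) = ∑ i, D' (i, j)) : D = D' := by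
  ext ⟨i, j⟩
  have h1 := hD.apply_le_one (i, j)
  have h2 := hD'.apply_le_one (i, j)
  have h3 := hD.apply_ne_zero_of_sums hD' hrow hcol (i := i) (j := j)
  have h4 := hD'.apply_ne_zero_of_sums hD (fun i => (hrow i).symm) (fun j => (hcol j).symm)
    (i := i) (j := j)
  omega

/-- The exponent of the monomial `∏ x_{σ i, i}`. -/
def permExponent (σ : Equiv.Perm (Fin n)) : Fin n × Fin n →₀ ℕ :=
  ∑ i, Finsupp.single (σ i, i) 1

theorem permExponent_apply (σ : Equiv.Perm (Fin n)) (i j : Fin n) :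
    permExponent σ (i, j) = if σ j = i then 1 else 0 := by
  rw [permExponent, Finsupp.finsetSum_apply, Finset.sum_eq_single j]
  · simp [Finsupp.single_apply]
  · intro b _ hb
    simp [hb]
  · simp

theorem permExponent_injective : Function.Injective (permExponent (n := n)) := by
  intro σ τ h
  ext1 j
  have := DFunLike.congr_fun h (τ j, j)
  rw [permExponent_apply, permExponent_apply, if_pos rfl] at this
  by_contra hc
  rw [if_neg hc] at this
  omega

theorem permExponent_row (σ : Equiv.Perm (Fin n)) (i : Fin n) :
    ∑ j, permExponent σ (i, j) = 1 := by
  simp only [permExponent_apply]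
  rw [Finset.sum_eq_single (σ.symm i)]
  · simp
  · intro j _ hj
    rw [if_neg]
    rintro rfl
    simp at hj
  · simp

theorem permExponent_col (σ : Equiv.Perm (Fin n)) (j : Fin n) :
    ∑ i, permExponent σ (i, j) = 1 := by
  simp [permExponent_apply]

theorem degree_permExponent (σ : Equiv.Perm (Fin n)) : (permExponent σ).degree = n := by
  simp [permExponent, Finsupp.degree_single]

/-- Standard monomials are partial permutation matrices. -/
theorem IsStandard.exists_perm {D : Fin n × Fin n →₀ ℕ} (hD : IsStandard D) :
    ∃ σ : Equiv.Perm (Fin n), D ≤ permExponent σ := by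
  classical
  let p : Fin n → Prop := fun j => ∃ i, D (i, j) ≠ 0
  let q : Fin n → Prop := fun i => ∃ j, D (i, j) ≠ 0
  have hrow : ∀ {i j j'}, D (i, j) ≠ 0 → D (i, j') ≠ 0 → j = j' := by
    intro i j j' h h'
    by_contra hne
    rcases hD.aligned h h' (fun heq => hne (Prod.mk.inj heq).2) with h | h <;>
      exact lt_irrefl _ h.1
  have hcol : ∀ {i i' j}, D (i, j) ≠ 0 → D (i', j) ≠ 0 → i = i' := by
    intro i i' j h h'
    by_contra hne
    rcases hD.aligned h h' (fun heq => hne (Prod.mk.inj heq).1) with h | h <;>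
      exact lt_irrefl _ h.2
  -- The occupied columns and rows are matched bijectively; any extension of this matching to a
  -- permutation of all indices works.
  let e : {j // p j} ≃ {i // q i} :=
    { toFun := fun j => ⟨j.2.choose, j, j.2.choose_spec⟩
      invFun := fun i => ⟨i.2.choose, i, i.2.choose_spec⟩
      left_inv := by
        rintro ⟨j, hj⟩
        refine Subtype.ext (hrow (Exists.choose_spec (p := fun j' => D (hj.choose, j') ≠ 0) _)
          hj.choose_spec)
      right_inv := by
        rintro ⟨i, hi⟩
        refine Subtype.ext (hcol (Exists.choose_spec (p := fun i' => D (i', hi.choose) ≠ 0) _)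
          hi.choose_spec) }
  refine ⟨e.extendSubtype, ?_⟩
  rintro ⟨i, j⟩
  by_cases h : D (i, j) = 0
  · rw [h]; exact Nat.zero_le _
  · have hj : p j := ⟨i, h⟩
    have : e.extendSubtype j = i := by
      rw [Equiv.extendSubtype_apply_of_mem e j hj]
      exact hcol hj.choose_spec h
    rw [permExponent_apply, if_pos this]
    exact hD.apply_le_one _

end Standard

/-! ### The apolar ideal in coordinates -/

section Apolar

variable {ι k : Type*} [Field k]

theorem coeff_contraction (p f : MvPolynomial ι k) (t : ι →₀ ℕ) :
    coeff t (contraction p f) = ∑ s ∈ p.support, coeff s p * coeff (s + t) f := by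
  conv_lhs => rw [← support_sum_monomial_coeff p]
  have : contraction (∑ v ∈ p.support, monomial v (coeff v p)) f =
      ∑ v ∈ p.support, contraction (monomial v (coeff v p)) f :=
    map_sum (contractionLinear f) _ _
  rw [this, coeff_sum]
  refine Finset.sum_congr rfl fun s _ => ?_
  rw [contraction_monomial, coeff_smul, coeff_divMonomial, smul_eq_mul]

theorem mem_apolarIdeal {p f : MvPolynomial ι k} :
    p ∈ apolarIdeal f ↔ ∀ t, ∑ s ∈ p.support, coeff s p * coeff (s + t) f = 0 := by
  simp only [← coeff_contraction]
  constructor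
  · intro h t
    have h' : contraction p f = 0 := h
    rw [h', coeff_zero]
  · intro h
    show contraction p f = 0
    ext t
    rw [h, coeff_zero]

/-- As f is homogeneous of degree N, the coefficient at t of a contraction involves only the
component of p of degree N − |t|. -/
theorem homogeneousComponent_mem_apolarIdeal {f : MvPolynomial ι k} {N : ℕ}
    (hf : f.IsHomogeneous N) {p : MvPolynomial ι k} (hp : p ∈ apolarIdeal f) (m : ℕ) :
    homogeneousComponent m p ∈ apolarIdeal f := by
  classical
  rw [mem_apolarIdeal] at hp ⊢
  intro t
  by_cases h : m + t.degree = N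
  · rw [← hp t, support_homogeneousComponent, Finset.sum_filter]
    refine Finset.sum_congr rfl fun s _ => ?_
    split_ifs with hs
    · rw [coeff_homogeneousComponent, if_pos hs]
    · rw [hf.coeff_eq_zero, mul_zero]
      rw [map_add]
      omega
  · refine Finset.sum_eq_zero fun s hs => ?_
    rw [support_homogeneousComponent, Finset.mem_filter] at hs
    rw [hf.coeff_eq_zero, mul_zero]
    rw [map_add, hs.2]
    exact h

end Apolar

/-! ### Quadrics in the apolar ideals of determinants and permanents -/

section Rules

variable {k : Type*} [Field k] {n : ℕ}

open Classical in
/-- The coefficient of the second term of the quadric attached to two positions. -/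
def ruleCoeff (ε : k) (a b : Fin n × Fin n) : k := if SameLine a b then 0 else ε

/-- The quadric attached to two positions: `x_a x_b` if they share a row or a column, and a
`2 × 2` permanent (for `ε = -1`) or determinant (for `ε = 1`) otherwise. -/
def rule (ε : k) (a b : Fin n × Fin n) : MvPolynomial (Fin n × Fin n) k :=
  X a * X b - C (ruleCoeff ε a b) * (X (a.1, b.2) * X (b.1, a.2))

/-- The properties of the apolar ideal of a determinant (`ε = -1`) or a permanent (`ε = 1`)
needed to compute its linear syzygies. -/
structure HasStandardRules (ε : k) (I : Ideal (MvPolynomial (Fin n × Fin n) k)) : Prop where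
  sq_eq_one : ε * ε = 1
  rule_mem : ∀ a b, rule ε a b ∈ I
  eq_zero : ∀ p ∈ I, (∀ s ∈ p.support, IsStandard s) → p = 0
  graded : ∀ p ∈ I, ∀ m, homogeneousComponent m p ∈ I

/-- The generalized matrix function `∑ s(σ) ∏ x_{σ i, i}`. -/
def signedPermanent (s : Equiv.Perm (Fin n) → k) : MvPolynomial (Fin n × Fin n) k :=
  ∑ σ, monomial (permExponent σ) (s σ)

theorem coeff_permExponent_signedPermanent (s : Equiv.Perm (Fin n) → k)
    (σ : Equiv.Perm (Fin n)) : coeff (permExponent σ) (signedPermanent s) = s σ := by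
  rw [signedPermanent, coeff_sum, Finset.sum_eq_single σ]
  · rw [coeff_monomial, if_pos rfl]
  · intro τ _ hτ
    rw [coeff_monomial, if_neg (fun h => hτ (permExponent_injective h))]
  · simp

theorem exists_of_coeff_signedPermanent_ne_zero {s : Equiv.Perm (Fin n) → k}
    {u : Fin n × Fin n →₀ ℕ} (h : coeff u (signedPermanent s) ≠ 0) :
    ∃ σ, u = permExponent σ := by
  rw [signedPermanent, coeff_sum] at h
  obtain ⟨σ, -, hσ⟩ := Finset.exists_ne_zero_of_sum_ne_zero h
  rw [coeff_monomial] at hσ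
  exact ⟨σ, by by_contra hc; exact hσ (if_neg (Ne.symm hc))⟩

theorem isHomogeneous_signedPermanent (s : Equiv.Perm (Fin n) → k) :
    (signedPermanent s).IsHomogeneous n :=
  IsHomogeneous.sum _ _ _ fun σ _ => isHomogeneous_monomial _ (degree_permExponent σ)

/-- If one of the two monomials comes from σ, the other comes from `Equiv.swap i i' * σ`. As ε² = 1
the relation is symmetric, so it suffices to treat a nonzero left-hand coefficient. -/
theorem signedPermanent_coeff_swap {s : Equiv.Perm (Fin n) → k} {ε : k} (hε : ε * ε = 1)
    (hs : ∀ i j σ, i ≠ j → s (Equiv.swap i j * σ) = ε * s σ) {i i' j j' : Fin n} (hi : i ≠ i')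
    (hj : j ≠ j') (t : Fin n × Fin n →₀ ℕ) :
    coeff (Finsupp.single (i, j) 1 + Finsupp.single (i', j') 1 + t) (signedPermanent s) =
      ε * coeff (Finsupp.single (i, j') 1 + Finsupp.single (i', j) 1 + t) (signedPermanent s) := by
  have key : ∀ {i i' j j' : Fin n}, i ≠ i' → j ≠ j' →
      coeff (Finsupp.single (i, j) 1 + Finsupp.single (i', j') 1 + t) (signedPermanent s) ≠ 0 →
      coeff (Finsupp.single (i, j) 1 + Finsupp.single (i', j') 1 + t) (signedPermanent s) =
      ε * coeff (Finsupp.single (i, j') 1 + Finsupp.single (i', j) 1 + t)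
        (signedPermanent s) := by
    intro i i' j j' hi hj hne
    obtain ⟨σ, hσ⟩ := exists_of_coeff_signedPermanent_ne_zero hne
    have h1 : σ j = i := by
      have := DFunLike.congr_fun hσ (i, j)
      rw [permExponent_apply] at this
      by_contra hc
      simp [hc] at this
    have h2 : σ j' = i' := by
      have := DFunLike.congr_fun hσ (i', j')
      rw [permExponent_apply] at this
      by_contra hc
      simp [hc] at this
    have hperm : Finsupp.single (i, j') 1 + Finsupp.single (i', j) 1 + t =
        permExponent (Equiv.swap i i' * σ) := by
      ext ⟨x, y⟩
      have h3 := DFunLike.congr_fun hσ (x, y)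
      simp only [Finsupp.add_apply, permExponent_apply, Finsupp.single_apply,
        Prod.mk.injEq] at h3 ⊢
      by_cases hyj : y = j
      · subst hyj
        have hv : (Equiv.swap i i' * σ) y = i' := by
          rw [Equiv.Perm.mul_apply, h1, Equiv.swap_apply_left]
        have : ¬ j' = y := fun h => hj h.symm
        simp only [h1, hv, this, and_false, and_true, if_false, add_zero, zero_add] at h3 ⊢
        omega
      · by_cases hyj' : y = j'
        · subst hyj'
          have hv : (Equiv.swap i i' * σ) y = i := by
            rw [Equiv.Perm.mul_apply, h2, Equiv.swap_apply_right]
          simp only [h2, hv, hj, and_false, and_true, if_false, add_zero, zero_add] at h3 ⊢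
          omega
        · have e1 : ¬ j = y := fun h => hyj h.symm
          have e2 : ¬ j' = y := fun h => hyj' h.symm
          have e3 : σ y ≠ i := fun h => hyj (σ.injective (h.trans h1.symm))
          have e4 : σ y ≠ i' := fun h => hyj' (σ.injective (h.trans h2.symm))
          have hv : (Equiv.swap i i' * σ) y = σ y := by
            rw [Equiv.Perm.mul_apply, Equiv.swap_apply_of_ne_of_ne e3 e4]
          simpa [e1, e2, hv] using h3
    rw [hσ, hperm, coeff_permExponent_signedPermanent, coeff_permExponent_signedPermanent,
      hs _ _ _ hi, ← mul_assoc, hε, one_mul]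
  by_cases h : coeff (Finsupp.single (i, j) 1 + Finsupp.single (i', j') 1 + t)
      (signedPermanent s) = 0
  · by_contra hc
    rw [h] at hc
    have hne : coeff (Finsupp.single (i, j') 1 + Finsupp.single (i', j) 1 + t)
        (signedPermanent s) ≠ 0 := by
      intro h0
      rw [h0, mul_zero] at hc
      exact hc rfl
    have h2 := key hi hj.symm hne
    rw [h, mul_zero] at h2
    exact hne h2
  · exact key hi hj h

theorem hasStandardRules_signedPermanent {s : Equiv.Perm (Fin n) → k} {ε : k} (hε : ε * ε = 1)
    (hs0 : ∀ σ, s σ ≠ 0) (hs : ∀ i j σ, i ≠ j → s (Equiv.swap i j * σ) = ε * s σ) :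
    HasStandardRules ε (apolarIdeal (signedPermanent s)) where
  sq_eq_one := hε
  graded := fun _ hp m =>
    homogeneousComponent_mem_apolarIdeal (isHomogeneous_signedPermanent s) hp m
  rule_mem := by
    intro a b
    obtain ⟨i, j⟩ := a
    obtain ⟨i', j'⟩ := b
    show contraction _ _ = 0
    have hX : ∀ c d : Fin n × Fin n, (X c * X d : MvPolynomial (Fin n × Fin n) k) =
        monomial (Finsupp.single c 1 + Finsupp.single d 1) 1 := by
      intro c d
      rw [X, X, monomial_mul, one_mul]
    ext t
    rw [rule, hX, hX, C_mul_monomial]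
    have hsub : contraction (monomial (Finsupp.single (i, j) 1 + Finsupp.single (i', j') 1) 1 -
        monomial (Finsupp.single (i, j') 1 + Finsupp.single (i', j) 1)
          (ruleCoeff ε (i, j) (i', j') * 1)) (signedPermanent s) =
        contraction (monomial (Finsupp.single (i, j) 1 + Finsupp.single (i', j') 1) 1)
          (signedPermanent s) -
        contraction (monomial (Finsupp.single (i, j') 1 + Finsupp.single (i', j) 1)
          (ruleCoeff ε (i, j) (i', j') * 1)) (signedPermanent s) :=
      map_sub (contractionLinear _) _ _
    rw [hsub, contraction_monomial, contraction_monomial, one_smul, mul_one, coeff_sub, coeff_smul,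
      coeff_divMonomial, coeff_divMonomial, coeff_zero, smul_eq_mul, ruleCoeff]
    split_ifs with h
    · rw [zero_mul, sub_zero]
      by_contra hc
      obtain ⟨σ, hσ⟩ := exists_of_coeff_signedPermanent_ne_zero hc
      rcases h with h | h
      · simp only at h
        subst h
        have h1 := permExponent_row σ i
        rw [← hσ] at h1
        simp only [Finsupp.add_apply, Finset.sum_add_distrib, Finsupp.single_apply,
          Prod.mk.injEq, true_and] at h1
        simp at h1
        omega
      · simp only at h
        subst h
        have h1 := permExponent_col σ j
        rw [← hσ] at h1
        simp only [Finsupp.add_apply, Finset.sum_add_distrib, Finsupp.single_apply,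
          Prod.mk.injEq, and_true] at h1
        simp at h1
        omega
    · simp only [SameLine, not_or] at h
      rw [signedPermanent_coeff_swap hε hs h.1 h.2, sub_self]
  eq_zero := by
    intro p hp hstd
    rw [mem_apolarIdeal] at hp
    by_contra hne
    obtain ⟨D, hD⟩ := support_nonempty.mpr hne
    obtain ⟨σ, hσ⟩ := (hstd D hD).exists_perm
    -- Complementing D inside a permutation matrix isolates its coefficient: another D' completed by
    -- the same complement to a permutation matrix has the row and column sums of D, hence equals D.
    have h := hp (permExponent σ - D)
    have hadd : D + (permExponent σ - D) = permExponent σ := add_tsub_cancel_of_le hσ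
    rw [Finset.sum_eq_single D] at h
    · rw [hadd, coeff_permExponent_signedPermanent] at h
      exact mul_ne_zero (mem_support_iff.mp hD) (hs0 σ) h
    · intro D' hD' hDD'
      by_contra hc
      obtain ⟨τ, hτ⟩ := exists_of_coeff_signedPermanent_ne_zero (right_ne_zero_of_mul hc)
      apply hDD'
      refine (hstd D' hD').eq_of_sums (hstd D hD) (fun i => ?_) (fun j => ?_)
      · have h1 := permExponent_row σ i
        have h2 := permExponent_row τ i
        rw [← hadd] at h1
        rw [← hτ] at h2
        simp only [Finsupp.add_apply, Finset.sum_add_distrib] at h1 h2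
        omega
      · have h1 := permExponent_col σ j
        have h2 := permExponent_col τ j
        rw [← hadd] at h1
        rw [← hτ] at h2
        simp only [Finsupp.add_apply, Finset.sum_add_distrib] at h1 h2
        omega
    · exact fun h => absurd hD h

theorem hasStandardRules_permPoly (k : Type*) [Field k] (n : ℕ) :
    HasStandardRules (1 : k) (apolarIdeal (permPoly k n)) := by
  have h : permPoly k n = signedPermanent fun _ => (1 : k) := by
    rw [permPoly, Matrix.permanent, signedPermanent]
    refine Finset.sum_congr rfl fun σ _ => ?_
    simp only [Matrix.mvPolynomialX_apply, X, permExponent, monomial_sum_one]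
  rw [h]
  exact hasStandardRules_signedPermanent (one_mul 1) (fun _ => one_ne_zero)
    (fun _ _ _ _ => (one_mul 1).symm)

theorem hasStandardRules_detPoly (k : Type*) [Field k] (n : ℕ) :
    HasStandardRules (-1 : k) (apolarIdeal (detPoly k n)) := by
  have h : detPoly k n =
      signedPermanent fun σ => ((Equiv.Perm.sign σ : ℤ) : k) := by
    rw [detPoly, Matrix.det_apply', signedPermanent]
    refine Finset.sum_congr rfl fun σ _ => ?_
    simp only [Matrix.mvPolynomialX_apply, X, permExponent, ← monomial_sum_one]
    rw [← map_intCast (C : k →+* MvPolynomial (Fin n × Fin n) k), C_mul_monomial, mul_one]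
  rw [h]
  refine hasStandardRules_signedPermanent (by ring) (fun σ => ?_) (fun i j σ hij => ?_)
  · rcases Int.units_eq_one_or (Equiv.Perm.sign σ) with h | h <;> simp [h]
  · simp [Equiv.Perm.sign_swap hij]

end Rules

/-! ### Rewriting to standard monomials -/

section Reduction

variable {k : Type*} [Field k] {n : ℕ}

/-- The weight of a monomial, for which the entry `x_{i,j}` has weight `i j`. -/
def posWeight : (Fin n × Fin n →₀ ℕ) →+ ℕ :=
  Finsupp.weight (R := ℕ) fun a : Fin n × Fin n => (a.1 : ℕ) * (a.2 : ℕ)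

theorem posWeight_single (a : Fin n × Fin n) :
    posWeight (Finsupp.single a 1) = (a.1 : ℕ) * (a.2 : ℕ) := by
  rw [posWeight, Finsupp.weight_single, one_smul]

theorem posWeight_le (s : Fin n × Fin n →₀ ℕ) : posWeight s ≤ s.degree * (n * n) := by
  rw [posWeight, Finsupp.weight_apply, Finsupp.sum, Finsupp.degree_apply, Finset.sum_mul]
  refine Finset.sum_le_sum fun a _ => ?_
  rw [smul_eq_mul]
  gcongr
  · exact a.1.2.le
  · exact a.2.2.le

/-- The rearrangement inequality: passing from the antidiagonal to the diagonal of a 2 × 2 block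
adds the product of the row and column distances. -/
theorem posWeight_lt {a b : Fin n × Fin n} (hal : ¬Aligned a b) (hline : ¬SameLine a b) :
    posWeight (Finsupp.single a 1 + Finsupp.single b 1) <
      posWeight (Finsupp.single (a.1, b.2) 1 + Finsupp.single (b.1, a.2) 1) := by
  simp only [map_add, posWeight_single]
  obtain ⟨i, j⟩ := a
  obtain ⟨i', j'⟩ := b
  simp only [Aligned, SameLine, not_or, not_and, not_lt, Fin.lt_def, Fin.ext_iff]
    at hal hline ⊢
  obtain ⟨h1, h2⟩ := hal
  obtain ⟨h3, h4⟩ := hline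
  rcases lt_or_gt_of_ne h3 with h | h
  · have h5 := lt_of_le_of_ne (h1 h) (Ne.symm h4)
    obtain ⟨x, hx⟩ := Nat.exists_eq_add_of_lt h
    obtain ⟨y, hy⟩ := Nat.exists_eq_add_of_lt h5
    rw [hx, hy]
    nlinarith
  · have h5 := lt_of_le_of_ne (h2 h) h4
    obtain ⟨x, hx⟩ := Nat.exists_eq_add_of_lt h
    obtain ⟨y, hy⟩ := Nat.exists_eq_add_of_lt h5
    rw [hx, hy]
    nlinarith

theorem rule_eq_monomial (ε : k) (a b : Fin n × Fin n) :
    rule ε a b = monomial (Finsupp.single a 1 + Finsupp.single b 1) 1 -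
      ruleCoeff ε a b • monomial (Finsupp.single (a.1, b.2) 1 + Finsupp.single (b.1, a.2) 1) 1 := by
  simp only [rule, X, monomial_mul, one_mul, C_mul_monomial, smul_monomial, smul_eq_mul]

theorem monomial_mul_rule (ε : k) (a b : Fin n × Fin n) (m : Fin n × Fin n →₀ ℕ) :
    monomial m 1 * rule ε a b = monomial (m + (Finsupp.single a 1 + Finsupp.single b 1)) 1 -
      ruleCoeff ε a b •
        monomial (m + (Finsupp.single (a.1, b.2) 1 + Finsupp.single (b.1, a.2) 1)) 1 := by
  rw [rule_eq_monomial, mul_sub, mul_smul_comm, monomial_mul, monomial_mul, one_mul]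

theorem exists_of_not_isStandard {T : Fin n × Fin n →₀ ℕ} (h : ¬IsStandard T) :
    ∃ a b m, ¬Aligned a b ∧ T = m + (Finsupp.single a 1 + Finsupp.single b 1) := by
  simp only [IsStandard, not_forall] at h
  obtain ⟨a, b, hle, hab⟩ := h
  exact ⟨a, b, T - (Finsupp.single a 1 + Finsupp.single b 1), hab, (tsub_add_cancel_of_le hle).symm⟩

/-- A rule kills a monomial or replaces it by a heavier one, and weights in degree d are at most
d·n², so rewriting ends. The lower bound w is preserved throughout; the later induction on weight
needs reductions that use heavy multiples of rules only. -/
theorem monomial_mem_sup_standard {ε : k} {U : Submodule k (MvPolynomial (Fin n × Fin n) k)}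
    {d w : ℕ} (hrule : ∀ a b m, ¬Aligned a b → m.degree + 2 = d →
      w ≤ posWeight (m + (Finsupp.single a 1 + Finsupp.single b 1)) →
      monomial m 1 * rule ε a b ∈ U)
    (T : Fin n × Fin n →₀ ℕ) (hd : T.degree = d) (hw : w ≤ posWeight T) :
    monomial T 1 ∈ U ⊔ restrictSupport k {s | s.degree = d ∧ IsStandard s} := by
  induction hN : d * (n * n) - posWeight T using Nat.strong_induction_on generalizing T with
  | _ N ih =>
    by_cases hT : IsStandard T
    · exact Submodule.mem_sup_right ((monomial_mem_restrictSupport _).mpr (Or.inl ⟨hd, hT⟩))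
    · obtain ⟨a, b, m, hab, rfl⟩ := exists_of_not_isStandard hT
      have hm : m.degree + 2 = d := by
        rw [← hd]
        simp [Finsupp.degree_single]
      have h1 := hrule a b m hab hm hw
      rw [monomial_mul_rule] at h1
      rw [← sub_add_cancel (monomial (m + (Finsupp.single a 1 + Finsupp.single b 1)) (1 : k))
        (ruleCoeff ε a b •
          monomial (m + (Finsupp.single (a.1, b.2) 1 + Finsupp.single (b.1, a.2) 1)) 1)]
      refine Submodule.add_mem _ (Submodule.mem_sup_left h1) ?_
      by_cases hline : SameLine a b
      · rw [ruleCoeff, if_pos hline, zero_smul]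
        exact Submodule.zero_mem _
      · refine Submodule.smul_mem _ _ ?_
        have hlt := posWeight_lt hab hline
        have hd' : (m + (Finsupp.single (a.1, b.2) 1 + Finsupp.single (b.1, a.2) 1)).degree = d := by
          rw [← hm]
          simp [Finsupp.degree_single]
        have hle := posWeight_le (m + (Finsupp.single (a.1, b.2) 1 + Finsupp.single (b.1, a.2) 1))
        rw [hd'] at hle
        rw [map_add] at hw hN hle
        refine ih _ ?_ _ hd' ?_ rfl
        · rw [map_add]; omega
        · rw [map_add]; omega

theorem mem_sup_standard {ε : k} {U : Submodule k (MvPolynomial (Fin n × Fin n) k)}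
    {d w : ℕ} (hrule : ∀ a b m, ¬Aligned a b → m.degree + 2 = d →
      w ≤ posWeight (m + (Finsupp.single a 1 + Finsupp.single b 1)) →
      monomial m 1 * rule ε a b ∈ U)
    {p : MvPolynomial (Fin n × Fin n) k} (hp : ∀ s ∈ p.support, s.degree = d ∧ w ≤ posWeight s) :
    p ∈ U ⊔ restrictSupport k {s | s.degree = d ∧ IsStandard s} := by
  rw [← support_sum_monomial_coeff p]
  refine Submodule.sum_mem _ fun s hs => ?_
  have := Submodule.smul_mem _ (coeff s p)
    (monomial_mem_sup_standard hrule s (hp s hs).1 (hp s hs).2)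
  rwa [smul_monomial, smul_eq_mul, mul_one] at this

variable {ε : k} {I : Ideal (MvPolynomial (Fin n × Fin n) k)}

/-- Elements of the ideal reduce to `0` modulo the rules. -/
theorem HasStandardRules.mem_of_rules (h : HasStandardRules ε I)
    {U : Submodule k (MvPolynomial (Fin n × Fin n) k)} (hU : U ≤ I.restrictScalars k)
    {d w : ℕ} (hrule : ∀ a b m, ¬Aligned a b → m.degree + 2 = d →
      w ≤ posWeight (m + (Finsupp.single a 1 + Finsupp.single b 1)) →
      monomial m 1 * rule ε a b ∈ U)
    {p : MvPolynomial (Fin n × Fin n) k} (hpI : p ∈ I)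
    (hp : ∀ s ∈ p.support, s.degree = d ∧ w ≤ posWeight s) : p ∈ U := by
  obtain ⟨u, hu, q, hq, rfl⟩ := Submodule.mem_sup.mp (mem_sup_standard hrule hp)
  have hqI : q ∈ I := (Submodule.add_mem_iff_right I (hU hu)).mp hpI
  have : q = 0 := h.eq_zero q hqI fun s hs => ((mem_restrictSupport_iff k).mp hq hs).2
  rwa [this, add_zero]

theorem isHomogeneous_rule (ε : k) (a b : Fin n × Fin n) : (rule ε a b).IsHomogeneous 2 := by
  have h : ∀ c d : Fin n × Fin n, (X c * X d : MvPolynomial _ k).IsHomogeneous 2 := fun c d =>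
    (isHomogeneous_X k c).mul (isHomogeneous_X k d)
  exact (h _ _).sub ((h _ _).C_mul _)

theorem degree_of_mem_support {ι : Type*} {p : MvPolynomial ι k} {d : ℕ} (hp : p.IsHomogeneous d)
    {s : ι →₀ ℕ} (hs : s ∈ p.support) : s.degree = d := by
  by_contra hc
  exact mem_support_iff.mp hs (hp.coeff_eq_zero hc)

theorem HasStandardRules.idealPart_le (h : HasStandardRules ε I) {d : ℕ}
    {U : Submodule k (MvPolynomial (Fin n × Fin n) k)} (hU : U ≤ I.restrictScalars k)
    (hrule : ∀ a b m, ¬Aligned a b → m.degree + 2 = d → monomial m 1 * rule ε a b ∈ U) :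
    idealPart I d ≤ U := fun _ hp =>
  h.mem_of_rules (w := 0) hU (fun a b m hab hm _ => hrule a b m hab hm) hp.1
    fun _ hs => ⟨degree_of_mem_support hp.2 hs, Nat.zero_le _⟩

theorem HasStandardRules.rule_mem_idealPart (h : HasStandardRules ε I) (a b : Fin n × Fin n) :
    rule ε a b ∈ idealPart I 2 := ⟨h.rule_mem a b, isHomogeneous_rule ε a b⟩

/-- The quadrics of the ideal are spanned by the rules. -/
theorem HasStandardRules.idealPart_two_eq_span (h : HasStandardRules ε I) :
    idealPart I 2 = Submodule.span k (Set.range fun x : (Fin n × Fin n) × (Fin n × Fin n) =>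
      rule ε x.1 x.2) := by
  have hle : Submodule.span k (Set.range fun x : (Fin n × Fin n) × (Fin n × Fin n) =>
      rule ε x.1 x.2) ≤ idealPart I 2 := by
    rw [Submodule.span_le]
    rintro _ ⟨x, rfl⟩
    exact h.rule_mem_idealPart _ _
  refine le_antisymm (h.idealPart_le (fun p hp => (hle hp).1) fun a b m _ hm => ?_) hle
  have : m = 0 := (Finsupp.degree_eq_zero_iff m).mp (by omega)
  subst this
  rw [monomial_zero', C_1, one_mul]
  exact Submodule.subset_span ⟨(a, b), rfl⟩

theorem X_mul_mem_idealPart {ι : Type*} {I : Ideal (MvPolynomial ι k)} (a : ι) {d : ℕ}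
    {q : MvPolynomial ι k} (hq : q ∈ idealPart I d) : X a * q ∈ idealPart I (d + 1) := by
  refine ⟨I.mul_mem_left _ hq.1, ?_⟩
  have h := (isHomogeneous_X k a).mul hq.2
  rwa [add_comm 1 d] at h

/-- I₄ is spanned by multiples of rules by quadratic monomials, and one variable can be split off
each multiplier. This gives the surjectivity of V ⊗ I₃ → I₄ used in the dimension count. -/
theorem HasStandardRules.idealPart_four_le (h : HasStandardRules ε I) :
    idealPart I 4 ≤ Submodule.span k {p | ∃ a, ∃ q ∈ idealPart I 3, p = X a * q} := by
  refine h.idealPart_le (Submodule.span_le.mpr ?_) fun a b m _ hm => ?_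
  · rintro _ ⟨a, q, hq, rfl⟩
    exact I.mul_mem_left _ hq.1
  · have hm0 : m ≠ 0 := by
      rintro rfl
      simp at hm
    obtain ⟨c, hc⟩ := Finsupp.ne_iff.mp hm0
    rw [Finsupp.zero_apply] at hc
    have hle : Finsupp.single c 1 ≤ m := by
      rw [Finsupp.single_le_iff]
      omega
    refine Submodule.subset_span ⟨c, monomial (m - Finsupp.single c 1) 1 * rule ε a b, ?_, ?_⟩
    · refine ⟨I.mul_mem_left _ (h.rule_mem a b), ?_⟩
      have h1 : (m - Finsupp.single c 1).degree = 1 := by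
        have : (m - Finsupp.single c 1 + Finsupp.single c 1).degree = m.degree := by
          rw [tsub_add_cancel_of_le hle]
        rw [map_add, Finsupp.degree_single] at this
        omega
      exact (isHomogeneous_monomial _ h1).mul (isHomogeneous_rule ε a b)
    · rw [← mul_assoc, X, monomial_mul, one_mul, add_tsub_cancel_of_le hle]

end Reduction

/-! ### The Hilbert function of the apolar ideal -/

section Dimension

variable {k : Type*} [Field k] {n : ℕ}

theorem finrank_restrictSupport {ι : Type*} (s : Set (ι →₀ ℕ)) :
    Module.finrank k (restrictSupport k s) = Nat.card s :=
  Module.finrank_eq_nat_card_basis (basisRestrictSupport k s)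

theorem homogeneousSubmodule_eq_restrictSupport {ι : Type*} (d : ℕ) :
    homogeneousSubmodule ι k d = restrictSupport k {s | s.degree = d} := by
  ext p
  rw [mem_restrictSupport_iff]
  constructor
  · intro hp s hs
    exact degree_of_mem_support hp hs
  · intro hp s hs
    have h2 := DFunLike.congr_fun (Finsupp.degree_eq_weight_one (σ := ι) (R := ℕ)) s
    exact h2.symm.trans (hp (mem_support_iff.mpr hs))

theorem finite_degree_eq {ι : Type*} [Finite ι] (d : ℕ) : {s : ι →₀ ℕ | s.degree = d}.Finite :=
  (Finsupp.finite_of_degree_le d).subset fun _ hs => le_of_eq hs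

instance {ι : Type*} [Finite ι] (d : ℕ) : Module.Finite k (homogeneousSubmodule ι k d) := by
  rw [homogeneousSubmodule_eq_restrictSupport]
  have : Finite {s : ι →₀ ℕ | s.degree = d} := finite_degree_eq d
  exact Module.Finite.of_basis (basisRestrictSupport k _)

instance {ι : Type*} [Finite ι] (I : Ideal (MvPolynomial ι k)) (d : ℕ) :
    Module.Finite k (idealPart I d) :=
  Submodule.finiteDimensional_of_le (S₂ := homogeneousSubmodule ι k d) inf_le_right

theorem finrank_homogeneousSubmodule {ι : Type*} [Fintype ι] (d : ℕ) :
    Module.finrank k (homogeneousSubmodule ι k d) = (Fintype.card ι + d - 1).choose d := by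
  classical
  rw [homogeneousSubmodule_eq_restrictSupport, finrank_restrictSupport,
    ← Finset.card_univ, ← Finset.card_finsuppAntidiag_nat_eq_choose]
  have : {s : ι →₀ ℕ | s.degree = d} =
      ((Finset.univ : Finset ι).finsuppAntidiag d : Set (ι →₀ ℕ)) := by
    ext s
    simp [Finset.mem_finsuppAntidiag, Finsupp.degree_eq_sum]
  rw [this, Nat.card_eq_card_toFinset, Finset.toFinset_coe]

theorem IsStandard.row_le_one {D : Fin n × Fin n →₀ ℕ} (hD : IsStandard D) (i : Fin n) :
    ∑ j, D (i, j) ≤ 1 := by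
  obtain ⟨σ, hσ⟩ := hD.exists_perm
  rw [← permExponent_row σ i]
  exact Finset.sum_le_sum fun j _ => hσ (i, j)

theorem IsStandard.col_le_one {D : Fin n × Fin n →₀ ℕ} (hD : IsStandard D) (j : Fin n) :
    ∑ i, D (i, j) ≤ 1 := by
  obtain ⟨σ, hσ⟩ := hD.exists_perm
  rw [← permExponent_col σ j]
  exact Finset.sum_le_sum fun i _ => hσ (i, j)

/-- The standard monomial with given rows and columns. -/
def diagonalMonomial {d : ℕ} (R C : Fin d ↪o Fin n) : Fin n × Fin n →₀ ℕ :=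
  ∑ x, Finsupp.single (R x, C x) 1

theorem diagonalMonomial_apply {d : ℕ} (R C : Fin d ↪o Fin n) (i j : Fin n) :
    diagonalMonomial R C (i, j) = ∑ x, if R x = i ∧ C x = j then 1 else 0 := by
  rw [diagonalMonomial, Finsupp.finsetSum_apply]
  refine Finset.sum_congr rfl fun x _ => ?_
  rw [Finsupp.single_apply]
  exact if_congr Prod.mk_inj rfl rfl

theorem isStandard_diagonalMonomial {d : ℕ} (R C : Fin d ↪o Fin n) :
    IsStandard (diagonalMonomial R C) := by
  have hle : ∀ a, diagonalMonomial R C a ≤ 1 := by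
    rintro ⟨i, j⟩
    rw [diagonalMonomial_apply, Finset.sum_boole, Nat.cast_id, Finset.card_le_one]
    intro x hx y hy
    simp only [Finset.mem_filter, Finset.mem_univ, true_and] at hx hy
    exact R.injective (hx.1.trans hy.1.symm)
  have hne : ∀ a, diagonalMonomial R C a ≠ 0 → ∃ x, R x = a.1 ∧ C x = a.2 := by
    rintro ⟨i, j⟩ h
    rw [diagonalMonomial_apply] at h
    obtain ⟨x, -, hx⟩ := Finset.exists_ne_zero_of_sum_ne_zero h
    exact ⟨x, by simpa using hx⟩
  intro a b hab
  have h1 := hab a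
  have h2 := hab b
  have h3 := hle a
  simp only [Finsupp.add_apply, Finsupp.single_apply, if_true] at h1 h2
  obtain ⟨x, hx1, hx2⟩ := hne a (by omega)
  obtain ⟨y, hy1, hy2⟩ := hne b (by omega)
  have hne' : a ≠ b := by
    rintro rfl
    simp at h1
    omega
  rw [Aligned, ← hx1, ← hx2, ← hy1, ← hy2, R.lt_iff_lt, C.lt_iff_lt, R.lt_iff_lt, C.lt_iff_lt]
  rcases lt_trichotomy x y with h | rfl | h
  · exact Or.inl ⟨h, h⟩
  · exact absurd (Prod.ext (hx1.symm.trans hy1) (hx2.symm.trans hy2)) hne'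
  · exact Or.inr ⟨h, h⟩

theorem degree_diagonalMonomial {d : ℕ} (R C : Fin d ↪o Fin n) :
    (diagonalMonomial R C).degree = d := by
  simp [diagonalMonomial, Finsupp.degree_single]

theorem diagonalMonomial_row {d : ℕ} (R C : Fin d ↪o Fin n) (i : Fin n) :
    ∑ j, diagonalMonomial R C (i, j) ≠ 0 ↔ i ∈ Set.range R := by
  simp only [diagonalMonomial_apply]
  rw [Finset.sum_comm]
  simp [ite_and]

theorem diagonalMonomial_col {d : ℕ} (R C : Fin d ↪o Fin n) (j : Fin n) :
    ∑ i, diagonalMonomial R C (i, j) ≠ 0 ↔ j ∈ Set.range C := by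
  simp only [diagonalMonomial_apply]
  rw [Finset.sum_comm]
  simp [ite_and]

/-- A chain is determined by its set of rows and its set of columns, and any two d-subsets occur:
match them increasingly. -/
theorem card_standard (d : ℕ) :
    Nat.card {s : Fin n × Fin n →₀ ℕ | s.degree = d ∧ IsStandard s} = n.choose d ^ 2 := by
  classical
  let P := (Finset.univ : Finset (Fin n)).powersetCard d
  have hcard : Fintype.card (P × P) = n.choose d ^ 2 := by
    simp [P, sq]
  rw [← hcard, ← Nat.card_eq_fintype_card]
  have hdeg : ∀ D : Fin n × Fin n →₀ ℕ, D.degree = ∑ i, ∑ j, D (i, j) := fun D => by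
    rw [Finsupp.degree_eq_sum, Fintype.sum_prod_type]
  have hsum : ∀ f : Fin n → ℕ, (∀ i, f i ≤ 1) → ∀ i, f i = if f i ≠ 0 then 1 else 0 := by
    intro f hf i
    have := hf i
    split_ifs <;> omega
  have hrows : ∀ D : {s : Fin n × Fin n →₀ ℕ | s.degree = d ∧ IsStandard s},
      Finset.univ.filter (fun i => ∑ j, D.1 (i, j) ≠ 0) ∈ P := by
    rintro ⟨D, hD, hstd⟩
    rw [Finset.mem_powersetCard]
    refine ⟨Finset.subset_univ _, ?_⟩
    rw [hdeg] at hD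
    rw [Finset.card_filter]
    refine Eq.trans ?_ hD
    exact Finset.sum_congr rfl fun i _ => (hsum _ hstd.row_le_one i).symm
  have hcols : ∀ D : {s : Fin n × Fin n →₀ ℕ | s.degree = d ∧ IsStandard s},
      Finset.univ.filter (fun j => ∑ i, D.1 (i, j) ≠ 0) ∈ P := by
    rintro ⟨D, hD, hstd⟩
    rw [Finset.mem_powersetCard]
    refine ⟨Finset.subset_univ _, ?_⟩
    rw [hdeg, Finset.sum_comm] at hD
    rw [Finset.card_filter]
    refine Eq.trans ?_ hD
    exact Finset.sum_congr rfl fun i _ => (hsum _ hstd.col_le_one i).symm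
  refine Nat.card_eq_of_bijective (fun D => (⟨_, hrows D⟩, ⟨_, hcols D⟩)) ⟨?_, ?_⟩
  · rintro ⟨D, hD, hstd⟩ ⟨D', hD', hstd'⟩ heq
    simp only [Prod.mk.injEq, Subtype.mk.injEq] at heq
    refine Subtype.ext (hstd.eq_of_sums hstd' (fun i => ?_) (fun j => ?_))
    · rw [hsum _ hstd.row_le_one, hsum _ hstd'.row_le_one]
      have := Finset.ext_iff.mp heq.1 i
      simp only [Finset.mem_filter, Finset.mem_univ, true_and] at this
      exact if_congr this rfl rfl
    · rw [hsum _ hstd.col_le_one, hsum _ hstd'.col_le_one]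
      have := Finset.ext_iff.mp heq.2 j
      simp only [Finset.mem_filter, Finset.mem_univ, true_and] at this
      exact if_congr this rfl rfl
  · rintro ⟨⟨R, hR⟩, ⟨C, hC⟩⟩
    rw [Finset.mem_powersetCard] at hR hC
    refine ⟨⟨diagonalMonomial (R.orderEmbOfFin hR.2) (C.orderEmbOfFin hC.2),
      degree_diagonalMonomial _ _, isStandard_diagonalMonomial _ _⟩, ?_⟩
    simp only [Prod.mk.injEq, Subtype.mk.injEq]
    constructor
    · ext i
      rw [Finset.mem_filter, diagonalMonomial_row, Finset.range_orderEmbOfFin]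
      simp
    · ext j
      rw [Finset.mem_filter, diagonalMonomial_col, Finset.range_orderEmbOfFin]
      simp

/-- The span of the standard monomials is a complement of I_d in S_d: rewriting shows that the two
span, `eq_zero` that they meet trivially. -/
theorem HasStandardRules.finrank_idealPart {ε : k} {I : Ideal (MvPolynomial (Fin n × Fin n) k)}
    (h : HasStandardRules ε I) (d : ℕ) :
    Module.finrank k (idealPart I d) + n.choose d ^ 2 = (n * n + d - 1).choose d := by
  let Std := restrictSupport k {s : Fin n × Fin n →₀ ℕ | s.degree = d ∧ IsStandard s}
  have hStd : Std ≤ homogeneousSubmodule (Fin n × Fin n) k d := by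
    rw [homogeneousSubmodule_eq_restrictSupport]
    exact restrictSupport_mono k fun s hs => hs.1
  have hsup : idealPart I d ⊔ Std = homogeneousSubmodule (Fin n × Fin n) k d := by
    refine le_antisymm (sup_le inf_le_right hStd) fun p hp => ?_
    refine mem_sup_standard (ε := ε) (w := 0) (fun a b m _ hm _ => ?_) fun s hs =>
      ⟨degree_of_mem_support hp hs, Nat.zero_le _⟩
    refine ⟨I.mul_mem_left _ (h.rule_mem a b), ?_⟩
    have := (isHomogeneous_monomial (1 : k) (rfl : m.degree = m.degree)).mul
      (isHomogeneous_rule ε a b)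
    rwa [hm] at this
  have hinf : idealPart I d ⊓ Std = ⊥ := by
    rw [eq_bot_iff]
    rintro p ⟨hpI, hp⟩
    exact h.eq_zero p hpI.1 fun s hs => (hp hs).2
  have : FiniteDimensional k Std :=
    Submodule.finiteDimensional_of_le hStd
  have hrank := Submodule.finrank_sup_add_finrank_inf_eq (idealPart I d) Std
  rw [hsup, hinf, finrank_bot, finrank_homogeneousSubmodule, finrank_restrictSupport,
    card_standard] at hrank
  rw [← hrank]
  simp

end Dimension

/-! ### Tools for quartic monomials: recursion along the weight, and equal sums of exponents -/

section Recursion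

/-- A function defined by affine recursion along a decreasing measure. -/
theorem exists_affine_recursion {α k Q : Type*} [Field k] [AddCommGroup Q] [Module k Q]
    (μ : α → ℕ) (e : α → Q) (c : α → k) (next : α → α)
    (h : ∀ x, c x ≠ 0 → μ (next x) < μ x) : ∃ r : α → Q, ∀ x, r x = e x + c x • r (next x) := by
  let r : α → Q := (measure μ).wf.fix fun x rec =>
    e x + if hx : μ (next x) < μ x then c x • rec (next x) hx else 0
  refine ⟨r, fun x => ?_⟩
  have := (measure μ).wf.fix_eq (C := fun _ => Q) (fun x rec =>
    e x + if hx : μ (next x) < μ x then c x • rec (next x) hx else 0) x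
  refine this.trans ?_
  congr 1
  split_ifs with hx
  · rfl
  · have : c x = 0 := by
      by_contra hc
      exact hx (h x hc)
    rw [this, zero_smul]

end Recursion

section FinsuppSums

variable {ι : Type*}

theorem single_two_eq {x y x' y' : ι}
    (h : Finsupp.single x 1 + Finsupp.single y 1 =
      (Finsupp.single x' 1 + Finsupp.single y' 1 : ι →₀ ℕ)) :
    (x' = x ∧ y' = y) ∨ (x' = y ∧ y' = x) := by
  rw [Finsupp.single_add_single_eq_single_add_single one_ne_zero one_ne_zero] at h
  rcases h with ⟨rfl, rfl⟩ | ⟨-, rfl, rfl⟩ | ⟨h, -⟩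
  · exact Or.inl ⟨rfl, rfl⟩
  · exact Or.inr ⟨rfl, rfl⟩
  · omega

theorem single_three_eq {x y z x' : ι} {s : ι →₀ ℕ}
    (h : Finsupp.single x 1 + Finsupp.single y 1 + Finsupp.single z 1 =
      (Finsupp.single x' 1 + s : ι →₀ ℕ)) :
    (x' = x ∧ Finsupp.single y 1 + Finsupp.single z 1 = s) ∨
    (x' = y ∧ Finsupp.single x 1 + Finsupp.single z 1 = s) ∨
    (x' = z ∧ Finsupp.single x 1 + Finsupp.single y 1 = s) := by
  classical
  by_cases h1 : x' = x
  · subst h1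
    refine Or.inl ⟨rfl, add_left_cancel (a := Finsupp.single x' 1) ?_⟩
    rw [← h, add_assoc]
  by_cases h2 : x' = y
  · subst h2
    refine Or.inr (Or.inl ⟨rfl, add_left_cancel (a := Finsupp.single x' 1) ?_⟩)
    rw [← h]; abel
  by_cases h3 : x' = z
  · subst h3
    refine Or.inr (Or.inr ⟨rfl, add_left_cancel (a := Finsupp.single x' 1) ?_⟩)
    rw [← h]; abel
  have := DFunLike.congr_fun h x'
  simp [Ne.symm h1, Ne.symm h2, Ne.symm h3] at this
  omega

theorem single_four_eq {x y z w x' : ι} {s : ι →₀ ℕ}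
    (h : Finsupp.single x 1 + Finsupp.single y 1 + Finsupp.single z 1 + Finsupp.single w 1 =
      (Finsupp.single x' 1 + s : ι →₀ ℕ)) :
    (x' = x ∧ Finsupp.single y 1 + Finsupp.single z 1 + Finsupp.single w 1 = s) ∨
    (x' = y ∧ Finsupp.single x 1 + Finsupp.single z 1 + Finsupp.single w 1 = s) ∨
    (x' = z ∧ Finsupp.single x 1 + Finsupp.single y 1 + Finsupp.single w 1 = s) ∨
    (x' = w ∧ Finsupp.single x 1 + Finsupp.single y 1 + Finsupp.single z 1 = s) := by
  classical
  by_cases h1 : x' = x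
  · subst h1
    refine Or.inl ⟨rfl, add_left_cancel (a := Finsupp.single x' 1) ?_⟩
    rw [← h]; abel
  by_cases h2 : x' = y
  · subst h2
    refine Or.inr (Or.inl ⟨rfl, add_left_cancel (a := Finsupp.single x' 1) ?_⟩)
    rw [← h]; abel
  by_cases h3 : x' = z
  · subst h3
    refine Or.inr (Or.inr (Or.inl ⟨rfl, add_left_cancel (a := Finsupp.single x' 1) ?_⟩))
    rw [← h]; abel
  by_cases h4 : x' = w
  · subst h4
    refine Or.inr (Or.inr (Or.inr ⟨rfl, add_left_cancel (a := Finsupp.single x' 1) ?_⟩))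
    rw [← h]; abel
  have := DFunLike.congr_fun h x'
  simp [Ne.symm h1, Ne.symm h2, Ne.symm h3, Ne.symm h4] at this
  omega

theorem exists_eq_two_of_degree {s : ι →₀ ℕ} (h : s.degree = 2) :
    ∃ x y, s = Finsupp.single x 1 + Finsupp.single y 1 := by
  classical
  have hs : s ≠ 0 := by
    rintro rfl
    simp at h
  obtain ⟨x, hx⟩ := Finsupp.ne_iff.mp hs
  rw [Finsupp.zero_apply] at hx
  have hle : Finsupp.single x 1 ≤ s := by
    rw [Finsupp.single_le_iff]
    omega
  have h1 : (s - Finsupp.single x 1).degree = 1 := by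
    have : (s - Finsupp.single x 1 + Finsupp.single x 1).degree = s.degree := by
      rw [tsub_add_cancel_of_le hle]
    rw [map_add, Finsupp.degree_single] at this
    omega
  have h4 : s - Finsupp.single x 1 ∈ Set.range fun a : ι => Finsupp.single a 1 := by
    rw [Finsupp.range_single_one]
    exact h1
  obtain ⟨y, hy⟩ := h4
  refine ⟨x, y, ?_⟩
  have hy' : Finsupp.single y 1 = s - Finsupp.single x 1 := hy
  rw [hy', add_tsub_cancel_of_le hle]

end FinsuppSums

/-! ### Reduction of syzygies to Koszul syzygies between rules -/

section LinearSyzygies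

variable {k : Type*} [Field k] {n : ℕ} {ε : k}

theorem sameLine_comm {a b : Fin n × Fin n} : SameLine a b ↔ SameLine b a := by
  simp only [SameLine, eq_comm]

theorem ruleCoeff_comm (ε : k) (a b : Fin n × Fin n) : ruleCoeff ε a b = ruleCoeff ε b a := by
  classical
  exact if_congr sameLine_comm rfl rfl

theorem rule_comm (ε : k) (a b : Fin n × Fin n) : rule ε a b = rule ε b a := by
  rw [rule, rule, ruleCoeff_comm]
  ring

/-- The embedding of `S` into `V ⊗ S` as `x_a ⊗ S`. -/
abbrev tensorX {ι k : Type*} [Field k] [DecidableEq ι] (a : ι) :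
    MvPolynomial ι k →ₗ[k] (ι → MvPolynomial ι k) :=
  LinearMap.single k (fun _ => MvPolynomial ι k) a

/-- The Koszul relations with coefficients in the quadrics of `I`. -/
def IsKoszulClosed {ι k : Type*} [Field k] [DecidableEq ι] (I : Ideal (MvPolynomial ι k))
    (B : Submodule k (ι → MvPolynomial ι k)) : Prop :=
  ∀ x y, ∀ q ∈ idealPart I 2, tensorX x (X y * q) - tensorX y (X x * q) ∈ B

/-- The Koszul syzygy between two rules. -/
def ruleSyzygy (ε : k) (a b c d : Fin n × Fin n) :
    Fin n × Fin n → MvPolynomial (Fin n × Fin n) k :=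
  (tensorX c (X d * rule ε a b) -
    ruleCoeff ε c d • tensorX (c.1, d.2) (X (d.1, c.2) * rule ε a b)) -
  (tensorX a (X b * rule ε c d) -
    ruleCoeff ε a b • tensorX (a.1, b.2) (X (b.1, a.2) * rule ε c d))

variable {I : Ideal (MvPolynomial (Fin n × Fin n) k)}

/-- Every syzygy of degree four is a combination of Koszul relations and Koszul syzygies between
rules. -/
theorem HasStandardRules.mem_of_syzygy (h : HasStandardRules ε I)
    {B : Submodule k (Fin n × Fin n → MvPolynomial (Fin n × Fin n) k)}
    (hB : IsKoszulClosed I B)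
    (hK : ∀ a b c d, ¬Aligned a b → ¬Aligned c d → ruleSyzygy ε a b c d ∈ B)
    {g : Fin n × Fin n → MvPolynomial (Fin n × Fin n) k} (hg : ∀ a, g a ∈ idealPart I 3)
    (hsum : ∑ a, X a * g a = 0) : g ∈ B := by
  classical
  -- The empty matrix is set aside because `choose!` below needs a default position.
  rcases isEmpty_or_nonempty (Fin n × Fin n) with hemp | hemp
  · rw [show g = 0 from funext fun a => isEmptyElim a]
    exact B.zero_mem
  let mon4 : Fin n × Fin n → Fin n × Fin n → Fin n × Fin n → Fin n × Fin n →
      (Fin n × Fin n →₀ ℕ) := fun a b c d =>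
    Finsupp.single a 1 + Finsupp.single b 1 + Finsupp.single c 1 + Finsupp.single d 1
  have hdeg4 : ∀ a b c d, (mon4 a b c d).degree = 4 := by
    intro a b c d
    simp [mon4, Finsupp.degree_single]
  have hdec : ∀ T : Fin n × Fin n →₀ ℕ, T.degree = 4 ∧ ¬IsStandard T →
      ∃ x : ((Fin n × Fin n) × (Fin n × Fin n)) × ((Fin n × Fin n) × (Fin n × Fin n)),
        ¬Aligned x.1.1 x.1.2 ∧ T = mon4 x.1.1 x.1.2 x.2.1 x.2.2 := by
    rintro T ⟨hT, hstd⟩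
    obtain ⟨a, b, m, hab, rfl⟩ := exists_of_not_isStandard hstd
    obtain ⟨c, d, rfl⟩ := exists_eq_two_of_degree (s := m) (by
      have : (m + (Finsupp.single a 1 + Finsupp.single b 1)).degree = m.degree + 2 := by
        simp [Finsupp.degree_single]
      omega)
    exact ⟨((a, b), (c, d)), hab, by simp only [mon4]; abel⟩
  have hpoly : ∀ a b c d, (monomial (mon4 a b c d) (1 : k)) = X a * X b * X c * X d := by
    intro a b c d
    simp only [mon4, X, monomial_mul, one_mul]
  -- the section on monomials
  obtain ⟨r, hr⟩ : ∃ r : (Fin n × Fin n →₀ ℕ) →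
      ((Fin n × Fin n → MvPolynomial (Fin n × Fin n) k) ⧸ B), ∀ T, T.degree = 4 → ¬IsStandard T →
      ∃ a b c d, ¬Aligned a b ∧ T = mon4 a b c d ∧
        r T = B.mkQ (tensorX c (X d * rule ε a b)) +
          ruleCoeff ε a b • r (mon4 (a.1, b.2) (b.1, a.2) c d) := by
    choose! x hx1 hx2 using hdec
    obtain ⟨r, hr⟩ := exists_affine_recursion (k := k)
      (fun T : Fin n × Fin n →₀ ℕ => 4 * (n * n) - posWeight T)
      (fun T => B.mkQ (tensorX (x T).2.1 (X (x T).2.2 * rule ε (x T).1.1 (x T).1.2)))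
      (fun T => if T.degree = 4 ∧ ¬IsStandard T then ruleCoeff ε (x T).1.1 (x T).1.2 else 0)
      (fun T => mon4 ((x T).1.1.1, (x T).1.2.2) ((x T).1.2.1, (x T).1.1.2) (x T).2.1 (x T).2.2) (by
        intro T hT
        split_ifs at hT with hc
        · have hline : ¬SameLine (x T).1.1 (x T).1.2 := fun hl => hT (if_pos hl)
          have hlt := posWeight_lt (hx1 T hc) hline
          have hle := posWeight_le
            (mon4 ((x T).1.1.1, (x T).1.2.2) ((x T).1.2.1, (x T).1.1.2) (x T).2.1 (x T).2.2)
          rw [hdeg4] at hle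
          have e := congrArg posWeight (hx2 T hc)
          simp only [mon4, map_add] at e hlt hle ⊢
          omega
        · exact absurd rfl hT)
    refine ⟨r, fun T h1 h2 => ⟨_, _, _, _, hx1 T ⟨h1, h2⟩, hx2 T ⟨h1, h2⟩, ?_⟩⟩
    have := hr T
    rwa [if_pos ⟨h1, h2⟩] at this
  -- `rl` is meant to invert multiplication V ⊗ I₃ → I₄ modulo B. Once `rl (X d * p)` is the class
  -- of x_d ⊗ p for every cubic p in I, a syzygy g has class `rl (∑ X a * g a) = rl 0 = 0`.
  let rl : MvPolynomial (Fin n × Fin n) k →ₗ[k]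
      ((Fin n × Fin n → MvPolynomial (Fin n × Fin n) k) ⧸ B) := (basisMonomials _ k).constr k r
  have hrl : ∀ T, rl (monomial T 1) = r T := fun T => by
    have := (basisMonomials (Fin n × Fin n) k).constr_basis k r T
    rwa [coe_basisMonomials] at this
  -- `A a b c d` says that `rl` has the desired value on a quartic multiple of a rule. By
  -- construction of `r` it holds for one chosen factorization of each nonstandard quartic monomial;
  -- the task is to reach all the others.
  let A : Fin n × Fin n → Fin n × Fin n → Fin n × Fin n → Fin n × Fin n → Prop :=
    fun a b c d => rl (X c * (X d * rule ε a b)) = B.mkQ (tensorX c (X d * rule ε a b))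
  have hBq : ∀ x y, ∀ q ∈ idealPart I 2,
      B.mkQ (tensorX x (X y * q)) = B.mkQ (tensorX y (X x * q)) := fun x y q hq =>
    (Submodule.Quotient.eq B).mpr (hB x y q hq)
  have hR := h.rule_mem_idealPart
  have A_left : ∀ {a b c d}, A a b c d → A b a c d := by
    intro a b c d hA
    simp only [A] at hA ⊢
    rwa [rule_comm ε b a]
  have A_right : ∀ {a b c d}, A a b c d → A a b d c := by
    intro a b c d hA
    simp only [A] at hA ⊢
    rwa [hBq d c _ (hR a b), mul_left_comm]
  have hA0 : ∀ T, T.degree = 4 → ¬IsStandard T → ∃ a b c d, ¬Aligned a b ∧ T = mon4 a b c d ∧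
      A a b c d := by
    intro T h1 h2
    obtain ⟨a, b, c, d, hab, hT, hrT⟩ := hr T h1 h2
    refine ⟨a, b, c, d, hab, hT, ?_⟩
    have e : X c * (X d * rule ε a b) = monomial (mon4 a b c d) (1 : k) -
        ruleCoeff ε a b • monomial (mon4 (a.1, b.2) (b.1, a.2) c d) 1 := by
      rw [hpoly, hpoly, rule, smul_eq_C_mul]
      ring
    simp only [A]
    rw [e, map_sub, map_smul, hrl, hrl, ← hT, hrT, add_sub_cancel_right]
  -- extension to cubics of large weight
  have cubic : ∀ (d : Fin n × Fin n) (w : ℕ),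
      (∀ a b c, ¬Aligned a b → w ≤ posWeight (Finsupp.single c 1 +
        (Finsupp.single a 1 + Finsupp.single b 1)) → A a b d c) →
      ∀ p ∈ I, (∀ s ∈ p.support, s.degree = 3 ∧ w ≤ posWeight s) →
        rl (X d * p) = B.mkQ (tensorX d p) := by
    intro d w hw p hpI hp
    let U : Submodule k (MvPolynomial (Fin n × Fin n) k) :=
      I.restrictScalars k ⊓ LinearMap.eqLocus (rl ∘ₗ LinearMap.mulLeft k (X d))
        (B.mkQ ∘ₗ tensorX d)
    have : p ∈ U := by
      refine h.mem_of_rules inf_le_left (d := 3) (w := w) (fun a b m hab hm hwm => ?_) hpI hp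
      have hm1 : m ∈ Set.range fun a : Fin n × Fin n => Finsupp.single a 1 := by
        rw [Finsupp.range_single_one]
        show m.degree = 1
        omega
      obtain ⟨c, rfl⟩ := hm1
      exact ⟨I.mul_mem_left _ (h.rule_mem a b), hw a b c hab hwm⟩
    exact this.2
  -- Induction from the heaviest monomials downwards: second terms of rules are heavier than first
  -- terms, so they are covered by the induction hypothesis.
  have main : ∀ (N : ℕ) (a b c d : Fin n × Fin n), ¬Aligned a b →
      4 * (n * n) - posWeight (mon4 a b c d) = N → A a b c d := by
    intro N
    induction N using Nat.strong_induction_on with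
    | _ N ih =>
    intro a b c d hab hN
    have hle : ∀ a b c d, posWeight (mon4 a b c d) ≤ 4 * (n * n) := fun a b c d => by
      have := posWeight_le (mon4 a b c d)
      rwa [hdeg4] at this
    have ih' : ∀ a' b' c' d', ¬Aligned a' b' →
        posWeight (mon4 a b c d) < posWeight (mon4 a' b' c' d') → A a' b' c' d' := by
      intro a' b' c' d' hab' hlt
      have := hle a' b' c' d'
      exact ih _ (by omega) a' b' c' d' hab' rfl
    -- Two rules sharing a position: the leading terms of the two multiples cancel, and the
    -- difference is a cubic of I supported in larger weights, to which `cubic` applies.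
    have step2 : ∀ a' b' c' d', posWeight (mon4 a' b' c' d') = posWeight (mon4 a b c d) →
        ¬Aligned a' b' → ¬Aligned a' c' → A a' c' b' d' → A a' b' c' d' := by
      intro a' b' c' d' hwt h1 h2 hA
      have hcub := cubic d' (posWeight (Finsupp.single a' 1 + Finsupp.single b' 1 +
          Finsupp.single c' 1) + 1) (by
        intro x y z hxy hw
        refine ih' x y d' z hxy ?_
        rw [← hwt]
        simp only [mon4, map_add] at hw ⊢
        omega) (X c' * rule ε a' b' - X b' * rule ε a' c')
        (I.sub_mem (I.mul_mem_left _ (h.rule_mem _ _)) (I.mul_mem_left _ (h.rule_mem _ _))) (by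
        have e : X c' * rule ε a' b' - X b' * rule ε a' c' =
            monomial (Finsupp.single b' 1 + (Finsupp.single (a'.1, c'.2) 1 +
              Finsupp.single (c'.1, a'.2) 1)) (ruleCoeff ε a' c') -
            monomial (Finsupp.single c' 1 + (Finsupp.single (a'.1, b'.2) 1 +
              Finsupp.single (b'.1, a'.2) 1)) (ruleCoeff ε a' b') := by
          have e1 : ∀ (x y z : Fin n × Fin n) (t : k), monomial (Finsupp.single x 1 +
              (Finsupp.single y 1 + Finsupp.single z 1)) t = C t * (X x * (X y * X z)) := by
            intro x y z t
            simp only [X, monomial_mul, C_mul_monomial, mul_one]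
          rw [e1, e1, rule, rule]
          ring
        rw [e]
        have e2 : ∀ x y z : Fin n × Fin n, ¬Aligned x y →
            ∀ s ∈ (monomial (Finsupp.single z 1 + (Finsupp.single (x.1, y.2) 1 +
              Finsupp.single (y.1, x.2) 1)) (ruleCoeff ε x y)).support, s.degree = 3 ∧
            posWeight (Finsupp.single z 1 + (Finsupp.single x 1 + Finsupp.single y 1)) + 1 ≤
              posWeight s := by
          intro x y z hxy s hs
          rw [support_monomial] at hs
          split_ifs at hs with h0
          · simp at hs
          · rw [Finset.mem_singleton] at hs
            subst hs
            refine ⟨by simp [Finsupp.degree_single], ?_⟩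
            have := posWeight_lt hxy (fun hl => h0 (if_pos hl))
            rw [map_add posWeight (Finsupp.single z 1), map_add posWeight (Finsupp.single z 1)]
            omega
        intro s hs
        rcases Finset.mem_union.mp (support_sub _ _ _ hs) with hs | hs
        · have := e2 _ _ _ h2 s hs
          refine ⟨this.1, ?_⟩
          have h3 := this.2
          simp only [map_add] at h3 ⊢
          omega
        · have := e2 _ _ _ h1 s hs
          refine ⟨this.1, ?_⟩
          have h3 := this.2
          simp only [map_add] at h3 ⊢
          omega)
      simp only [A] at hA ⊢
      rw [hBq c' d' _ (hR a' b')]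
      rw [hBq b' d' _ (hR a' c')] at hA
      have e3 : X c' * (X d' * rule ε a' b') =
          X d' * (X c' * rule ε a' b' - X b' * rule ε a' c') +
            X b' * (X d' * rule ε a' c') := by ring
      rw [e3, map_add, hA, hcub, ← map_add, ← map_add, sub_add_cancel]
    -- Two rules on complementary pairs of factors: their Koszul syzygy lies in B by `hK`, and its
    -- remaining terms are heavier.
    have step3 : ∀ a' b' c' d', posWeight (mon4 a' b' c' d') = posWeight (mon4 a b c d) →
        ¬Aligned a' b' → ¬Aligned c' d' → A c' d' a' b' → A a' b' c' d' := by
      intro a' b' c' d' hwt h1 h2 hA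
      have aux : ∀ x y z w, posWeight (mon4 x y z w) = posWeight (mon4 a b c d) →
          ¬Aligned x y → ¬Aligned z w →
          ruleCoeff ε z w • B.mkQ (tensorX (z.1, w.2) (X (w.1, z.2) * rule ε x y)) =
          ruleCoeff ε z w • rl (X (z.1, w.2) * (X (w.1, z.2) * rule ε x y)) := by
        intro x y z w hwt' hxy hzw
        by_cases hl : SameLine z w
        · rw [ruleCoeff, if_pos hl, zero_smul, zero_smul]
        · congr 1
          symm
          refine ih' x y _ _ hxy ?_
          have hlt := posWeight_lt hzw hl
          rw [← hwt']
          simp only [mon4, map_add] at hlt ⊢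
          omega
      have hKq : B.mkQ (ruleSyzygy ε a' b' c' d') = 0 := by
        rw [Submodule.mkQ_apply, Submodule.Quotient.mk_eq_zero]
        exact hK a' b' c' d' h1 h2
      rw [ruleSyzygy] at hKq
      simp only [map_sub, map_smul] at hKq
      rw [aux a' b' c' d' hwt h1 h2, aux c' d' a' b' (by
        rw [← hwt]; simp only [mon4, map_add]; omega) h2 h1] at hKq
      simp only [A] at hA ⊢
      rw [← hA] at hKq
      have e3 : X c' * (X d' * rule ε a' b') =
          ruleCoeff ε c' d' • (X (c'.1, d'.2) * (X (d'.1, c'.2) * rule ε a' b')) +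
          (X a' * (X b' * rule ε c' d')) -
          ruleCoeff ε a' b' • (X (a'.1, b'.2) * (X (b'.1, a'.2) * rule ε c' d')) := by
        simp only [smul_eq_C_mul]
        rw [rule, rule]
        ring
      rw [e3, map_sub, map_add, map_smul, map_smul]
      rw [sub_eq_zero, sub_eq_iff_eq_add] at hKq
      rw [hKq]
      abel
    obtain ⟨a0, b0, c0, d0, hab0, hT, hA⟩ := hA0 (mon4 a b c d) (hdeg4 a b c d) (by
      intro hstd
      refine hab (hstd a b ?_)
      simp only [mon4, add_assoc]
      rw [← add_assoc]
      exact le_self_add)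
    have hba : ∀ {x y : Fin n × Fin n}, ¬Aligned x y → ¬Aligned y x := fun hxy hyx =>
      hxy hyx.symm
    have wt : ∀ a' b' c' d', mon4 a' b' c' d' = mon4 a b c d →
        posWeight (mon4 a' b' c' d') = posWeight (mon4 a b c d) := fun _ _ _ _ he => by rw [he]
    have hperm : ∀ x y z w : Fin n × Fin n, Finsupp.single x 1 + Finsupp.single y 1 =
        (Finsupp.single z 1 + Finsupp.single w 1 : Fin n × Fin n →₀ ℕ) →
        ∀ u v, A u v z w → A u v x y := by
      intro x y z w hxy u v hA'
      rcases single_two_eq hxy with ⟨rfl, rfl⟩ | ⟨rfl, rfl⟩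
      · exact hA'
      · exact A_right hA'
    simp only [mon4] at hT
    rw [add_assoc (Finsupp.single a0 1 + Finsupp.single b0 1), add_assoc (Finsupp.single a0 1)]
      at hT
    -- The chosen pair occupies two of the four factors, in twelve ordered ways: it is the given
    -- pair, shares one factor with it (`step2`), or is complementary to it (`step3`).
    rcases single_four_eq hT with ⟨rfl, h3⟩ | ⟨rfl, h3⟩ | ⟨rfl, h3⟩ | ⟨rfl, h3⟩ <;>
      rcases single_three_eq h3 with ⟨rfl, h2⟩ | ⟨rfl, h2⟩ | ⟨rfl, h2⟩ <;>
      have hA' := hperm _ _ _ _ h2 _ _ hA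
    · exact hA'
    · exact step2 _ _ _ _ rfl hab hab0 hA'
    · exact A_right (step2 _ _ _ _ (wt _ _ _ _ (by simp only [mon4]; abel)) hab hab0 hA')
    · exact A_left hA'
    · exact A_left (step2 _ _ _ _ (wt _ _ _ _ (by simp only [mon4]; abel)) (hba hab) hab0 hA')
    · exact A_left (A_right (step2 _ _ _ _ (wt _ _ _ _ (by simp only [mon4]; abel)) (hba hab)
        hab0 hA'))
    · exact step2 _ _ _ _ rfl hab (hba hab0) (A_left hA')
    · exact A_left (step2 _ _ _ _ (wt _ _ _ _ (by simp only [mon4]; abel)) (hba hab) (hba hab0)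
        (A_left hA'))
    · exact step3 _ _ _ _ rfl hab hab0 hA'
    · exact A_right (step2 _ _ _ _ (wt _ _ _ _ (by simp only [mon4]; abel)) hab (hba hab0)
        (A_left hA'))
    · exact A_left (A_right (step2 _ _ _ _ (wt _ _ _ _ (by simp only [mon4]; abel)) (hba hab)
        (hba hab0) (A_left hA')))
    · exact A_right (step3 _ _ _ _ (wt _ _ _ _ (by simp only [mon4]; abel)) hab hab0 hA')
  have hfin : ∀ a, rl (X a * g a) = B.mkQ (tensorX a (g a)) := fun a =>
    cubic a 0 (fun x y z hxy _ => main _ x y a z hxy rfl) (g a) (hg a).1 fun s hs =>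
      ⟨degree_of_mem_support (hg a).2 hs, Nat.zero_le _⟩
  have hgsum : g = ∑ a, tensorX a (g a) := by
    simp only [tensorX, LinearMap.coe_single]
    exact (Finset.univ_sum_single g).symm
  rw [← Submodule.Quotient.mk_eq_zero, ← Submodule.mkQ_apply, hgsum, map_sum]
  rw [← map_zero rl, ← hsum, map_sum]
  exact Finset.sum_congr rfl fun a _ => (hfin a).symm

end LinearSyzygies

/-! ### Koszul syzygies between quadrics modulo Koszul relations -/

section KoszulFamily

variable {k S Q : Type*} [Field k] [CommRing S] [Algebra k S] [AddCommGroup Q] [Module k Q]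
  {n : ℕ}

/-- The quadric attached to two positions, for a matrix `v`. -/
def quadric (ε : k) (v : Fin n × Fin n → S) (a b : Fin n × Fin n) : S :=
  v a * v b - ruleCoeff ε a b • (v (a.1, b.2) * v (b.1, a.2))

/-- A family of linear maps `e a : S → Q` satisfying the Koszul relations with coefficients in a
space `P` containing the quadrics of the matrix `v`. -/
structure IsKoszulFamily (ε : k) (P : Submodule k S) (v : Fin n × Fin n → S)
    (e : Fin n × Fin n → S →ₗ[k] Q) : Prop where
  sq_eq_one : ε * ε = 1
  comm : ∀ a b, ∀ q ∈ P, e a (v b * q) = e b (v a * q)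
  quadric_mem : ∀ a b, quadric ε v a b ∈ P

/-- The product of a quadric and an element `q`, as an element of `Q`. -/
def quadricMul (ε : k) (v : Fin n × Fin n → S) (e : Fin n × Fin n → S →ₗ[k] Q)
    (c d : Fin n × Fin n) (q : S) : Q :=
  e c (v d * q) - ruleCoeff ε c d • e (c.1, d.2) (v (d.1, c.2) * q)

/-- The Koszul syzygy between two quadrics. -/
def quadricSyzygy (ε : k) (v : Fin n × Fin n → S) (e : Fin n × Fin n → S →ₗ[k] Q)
    (a b c d : Fin n × Fin n) : Q :=
  quadricMul ε v e c d (quadric ε v a b) - quadricMul ε v e a b (quadric ε v c d)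

theorem ruleCoeff_of_sameLine {a b : Fin n × Fin n} (h : SameLine a b) (ε : k) :
    ruleCoeff ε a b = 0 := by
  classical
  exact if_pos h

theorem ruleCoeff_of_not_sameLine {a b : Fin n × Fin n} (h : ¬SameLine a b) (ε : k) :
    ruleCoeff ε a b = ε := by
  classical
  exact if_neg h

theorem sameLine_swap {a b : Fin n × Fin n} : SameLine a.swap b.swap ↔ SameLine a b := or_comm

theorem ruleCoeff_swap (ε : k) (a b : Fin n × Fin n) :
    ruleCoeff ε a.swap b.swap = ruleCoeff ε a b := by
  classical
  exact if_congr sameLine_swap rfl rfl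

theorem quadric_comm (ε : k) (v : Fin n × Fin n → S) (a b : Fin n × Fin n) :
    quadric ε v a b = quadric ε v b a := by
  rw [quadric, quadric, ruleCoeff_comm, mul_comm (v a), mul_comm (v (a.1, b.2))]

theorem quadric_swap (ε : k) (v : Fin n × Fin n → S) (a b : Fin n × Fin n) :
    quadric ε (v ∘ Prod.swap) a b = quadric ε v a.swap b.swap := by
  rw [quadric, quadric, ruleCoeff_swap]
  simp [mul_comm]

theorem quadricSyzygy_antisymm (ε : k) (v : Fin n × Fin n → S) (e : Fin n × Fin n → S →ₗ[k] Q)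
    (a b c d : Fin n × Fin n) : quadricSyzygy ε v e a b c d = -quadricSyzygy ε v e c d a b := by
  rw [quadricSyzygy, quadricSyzygy, neg_sub]

namespace IsKoszulFamily

variable {ε : k} {P : Submodule k S} {v : Fin n × Fin n → S} {e : Fin n × Fin n → S →ₗ[k] Q}

/-- This is why matrix and maps are kept abstract: statements about columns become statements about
rows of the transposed family. -/
theorem transpose (h : IsKoszulFamily ε P v e) :
    IsKoszulFamily ε P (v ∘ Prod.swap) (e ∘ Prod.swap) where
  sq_eq_one := h.sq_eq_one
  comm a b q hq := h.comm _ _ q hq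
  quadric_mem a b := by
    rw [quadric_swap]
    exact h.quadric_mem _ _

theorem mul_mem (h : IsKoszulFamily ε P v e) {a b : Fin n × Fin n} (hab : SameLine a b) :
    v a * v b ∈ P := by
  have := h.quadric_mem a b
  rwa [quadric, ruleCoeff_of_sameLine hab, zero_smul, sub_zero] at this

theorem quadricMul_comm (h : IsKoszulFamily ε P v e) (c d : Fin n × Fin n) {q : S} (hq : q ∈ P) :
    quadricMul ε v e c d q = quadricMul ε v e d c q := by
  rw [quadricMul, quadricMul, h.comm c d q hq, ruleCoeff_comm, h.comm (c.1, d.2) (d.1, c.2) q hq]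

theorem syzygy_comm_left (h : IsKoszulFamily ε P v e) (a b c d : Fin n × Fin n) :
    quadricSyzygy ε v e a b c d = quadricSyzygy ε v e b a c d := by
  rw [quadricSyzygy, quadricSyzygy, quadric_comm, h.quadricMul_comm a b (h.quadric_mem c d)]

theorem syzygy_comm_right (h : IsKoszulFamily ε P v e) (a b c d : Fin n × Fin n) :
    quadricSyzygy ε v e a b c d = quadricSyzygy ε v e a b d c := by
  rw [quadricSyzygy, quadricSyzygy, quadric_comm ε v c d, h.quadricMul_comm c d (h.quadric_mem a b)]

theorem syzygy_transpose (h : IsKoszulFamily ε P v e) (a b c d : Fin n × Fin n) :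
    quadricSyzygy ε (v ∘ Prod.swap) (e ∘ Prod.swap) a b c d =
      quadricSyzygy ε v e a.swap b.swap c.swap d.swap := by
  have key : ∀ a b : Fin n × Fin n, ∀ q ∈ P, quadricMul ε (v ∘ Prod.swap) (e ∘ Prod.swap) a b q =
      quadricMul ε v e a.swap b.swap q := by
    intro a b q hq
    rw [quadricMul, quadricMul, ruleCoeff_swap]
    simp only [Function.comp_apply, Prod.swap_prod_mk, Prod.fst_swap, Prod.snd_swap]
    rw [h.comm (b.2, a.1) (a.2, b.1) q hq]
  rw [quadricSyzygy, quadricSyzygy, quadric_swap, quadric_swap, key _ _ _ (h.quadric_mem _ _),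
    key _ _ _ (h.quadric_mem _ _)]

/-- Products of four entries with two adjacent pairs sharing an entry. -/
theorem connected_last (h : IsKoszulFamily ε P v e) (a b c d : Fin n × Fin n)
    (hbd : SameLine b d) : e c (v d * (v a * v b)) = e a (v b * (v c * v d)) := by
  rw [show v d * (v a * v b) = v a * (v b * v d) by ring, h.comm c a _ (h.mul_mem hbd)]
  congr 1
  ring

theorem connected_middle (h : IsKoszulFamily ε P v e) (a b c d : Fin n × Fin n)
    (hab : SameLine a b) (hbc : SameLine b c) :
    e c (v d * (v a * v b)) = e a (v b * (v c * v d)) := by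
  rw [h.comm c d _ (h.mul_mem hab), show v c * (v a * v b) = v a * (v b * v c) by ring,
    h.comm d a _ (h.mul_mem hbc)]
  congr 1
  ring

/-- The `2 × 2` minor, or permanent, on given rows and columns. -/
def bin (ε : k) (v : Fin n × Fin n → S) (i p x y : Fin n) : S :=
  v (i, x) * v (p, y) - ε • (v (i, y) * v (p, x))

theorem quadric_eq_bin {i p x y : Fin n} (hi : i ≠ p) (hx : x ≠ y) :
    quadric ε v (i, x) (p, y) = bin ε v i p x y := by
  rw [quadric, ruleCoeff_of_not_sameLine (by simp [SameLine, hi, hx]), bin]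

theorem bin_mem (h : IsKoszulFamily ε P v e) {i p x y : Fin n} (hi : i ≠ p) (hx : x ≠ y) :
    bin ε v i p x y ∈ P := by
  rw [← quadric_eq_bin hi hx]
  exact h.quadric_mem _ _

theorem bin_rows_comm (i p x y : Fin n) : bin ε v i p x y = bin ε v p i y x := by
  rw [bin, bin, mul_comm (v (i, x)), mul_comm (v (i, y))]

theorem bin_cols_comm (h : IsKoszulFamily ε P v e) (i p x y : Fin n) :
    bin ε v i p y x = -(ε • bin ε v i p x y) := by
  rw [bin, bin, smul_sub, smul_smul, h.sq_eq_one, one_smul]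
  abel

/-- The linear relation between `2 × 2` minors coming from the braid relation in `S₃`. -/
theorem braid (h : IsKoszulFamily ε P v e) (i l p x y z : Fin n) :
    v (l, y) * bin ε v i p x z = v (p, z) * bin ε v i l x y + ε • (v (i, y) * bin ε v l p x z) +
      v (p, x) * bin ε v i l y z := by
  -- The identity telescopes along (i,x)(l,y)(p,z), (i,y)(l,x)(p,z), (i,y)(l,z)(p,x),
  -- (i,z)(l,y)(p,x), where each step exchanges two columns; only ε² = 1 is needed.
  have hE : algebraMap k S ε * algebraMap k S ε = 1 := by
    rw [← map_mul, h.sq_eq_one, map_one]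
  simp only [bin, Algebra.smul_def]
  linear_combination (v (i, y) * v (l, z) * v (p, x)) * hE

theorem map_braid (h : IsKoszulFamily ε P v e) (f : Fin n × Fin n) (i l p x y z : Fin n) :
    e f (v (l, y) * bin ε v i p x z) = e f (v (p, z) * bin ε v i l x y) +
      ε • e f (v (i, y) * bin ε v l p x z) + e f (v (p, x) * bin ε v i l y z) := by
  rw [h.braid, map_add, map_add, map_smul]

theorem map_mul_bin (c d : Fin n × Fin n) (i p x y : Fin n) :
    e c (v d * bin ε v i p x y) =
      e c (v d * (v (i, x) * v (p, y))) - ε • e c (v d * (v (i, y) * v (p, x))) := by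
  rw [bin, mul_sub, mul_smul_comm, map_sub, map_smul]

theorem syzygy_eq_of_sameLine {a b c d : Fin n × Fin n} (hab : SameLine a b) (hcd : SameLine c d) :
    quadricSyzygy ε v e a b c d = e c (v d * (v a * v b)) - e a (v b * (v c * v d)) := by
  simp only [quadricSyzygy, quadricMul, quadric, ruleCoeff_of_sameLine hab,
    ruleCoeff_of_sameLine hcd, zero_smul, sub_zero]

/-- A factor of one product and a factor of the other on a common line form a further element of P,
and one Koszul relation with this coefficient moves the tensor factor from c to a. -/
theorem syzygy_connected (h : IsKoszulFamily ε P v e) {a b c d : Fin n × Fin n}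
    (hab : SameLine a b) (hcd : SameLine c d)
    (hconn : SameLine a c ∨ SameLine a d ∨ SameLine b c ∨ SameLine b d) :
    quadricSyzygy ε v e a b c d = 0 := by
  have key : ∀ a b c d : Fin n × Fin n, SameLine a b → SameLine c d → SameLine b d →
      quadricSyzygy ε v e a b c d = 0 := by
    intro a b c d hab hcd hbd
    rw [syzygy_eq_of_sameLine hab hcd, h.connected_last a b c d hbd, sub_self]
  rcases hconn with hc | hc | hc | hc
  · rw [h.syzygy_comm_left, h.syzygy_comm_right]
    exact key _ _ _ _ (sameLine_comm.mp hab) (sameLine_comm.mp hcd) hc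
  · rw [h.syzygy_comm_left]
    exact key _ _ _ _ (sameLine_comm.mp hab) hcd hc
  · rw [h.syzygy_comm_right]
    exact key _ _ _ _ hab (sameLine_comm.mp hcd) hc
  · exact key _ _ _ _ hab hcd hc

/-- The Koszul syzygies between products of entries in two rows change by a sign when a column is
exchanged. -/
theorem syzygy_rows_exchange (h : IsKoszulFamily ε P v e) {i p j l q s : Fin n} (hi : i ≠ p)
    (hl : l ≠ q) : quadricSyzygy ε v e (i, j) (i, l) (p, q) (p, s) =
      ε • quadricSyzygy ε v e (i, j) (i, q) (p, l) (p, s) := by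
  have hline : ∀ (r x y : Fin n), SameLine (r, x) (r, y) := fun _ _ _ => Or.inl rfl
  rw [syzygy_eq_of_sameLine (hline i j l) (hline p q s),
    syzygy_eq_of_sameLine (hline i j q) (hline p l s)]
  -- The Koszul relation whose coefficient is the quadric on the columns l and q: its two terms
  -- yield the two syzygies to be compared.
  have hb := h.comm (p, s) (i, j) _ (h.bin_mem hi hl)
  rw [map_mul_bin, map_mul_bin] at hb
  have h1 := h.comm (p, q) (p, s) _ (h.mul_mem (a := (i, j)) (b := (i, l)) (Or.inl rfl))
  have h2 := h.comm (p, l) (p, s) _ (h.mul_mem (a := (i, j)) (b := (i, q)) (Or.inl rfl))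
  rw [h1, h2, show v (p, q) * (v (i, j) * v (i, l)) = v (i, j) * (v (i, l) * v (p, q)) by ring,
    show v (p, l) * (v (i, j) * v (i, q)) = v (i, j) * (v (i, q) * v (p, l)) by ring,
    show v (i, l) * (v (p, q) * v (p, s)) = v (p, s) * (v (i, l) * v (p, q)) by ring,
    show v (i, q) * (v (p, l) * v (p, s)) = v (p, s) * (v (i, q) * v (p, l)) by ring]
  rw [← sub_eq_zero] at hb ⊢
  refine Eq.trans ?_ hb
  module

/-- Only four distinct columns are exceptional. A column common to the two rows makes the products
connected, and a column repeated within one row becomes common after one exchange. -/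
theorem syzygy_row_row (h : IsKoszulFamily ε P v e)
    (hrow : ∀ i p (f : Fin 4 ↪ Fin n), i ≠ p →
      quadricSyzygy ε v e (i, f 0) (i, f 1) (p, f 2) (p, f 3) = 0) (i p j l q s : Fin n) :
    quadricSyzygy ε v e (i, j) (i, l) (p, q) (p, s) = 0 := by
  by_cases hi : i = p
  · exact h.syzygy_connected (Or.inl rfl) (Or.inl rfl) (Or.inl (Or.inl hi))
  by_cases h1 : j = q
  · exact h.syzygy_connected (Or.inl rfl) (Or.inl rfl) (Or.inl (Or.inr h1))
  by_cases h2 : j = s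
  · exact h.syzygy_connected (Or.inl rfl) (Or.inl rfl) (Or.inr (Or.inl (Or.inr h2)))
  by_cases h3 : l = q
  · exact h.syzygy_connected (Or.inl rfl) (Or.inl rfl) (Or.inr (Or.inr (Or.inl (Or.inr h3))))
  by_cases h4 : l = s
  · exact h.syzygy_connected (Or.inl rfl) (Or.inl rfl) (Or.inr (Or.inr (Or.inr (Or.inr h4))))
  by_cases h5 : j = l
  · subst h5
    rw [h.syzygy_rows_exchange hi h3]
    exact smul_eq_zero_of_right _ (h.syzygy_connected (Or.inl rfl) (Or.inl rfl)
      (Or.inl (Or.inr rfl)))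
  by_cases h6 : q = s
  · subst h6
    rw [h.syzygy_rows_exchange hi h3]
    exact smul_eq_zero_of_right _ (h.syzygy_connected (Or.inl rfl) (Or.inl rfl)
      (Or.inr (Or.inr (Or.inr (Or.inr rfl)))))
  have hinj : Function.Injective ![j, l, q, s] := by
    intro a b hab
    fin_cases a <;> fin_cases b <;> simp_all
  exact hrow i p ⟨_, hinj⟩ hi

/-- The quadric on rows i, p and columns l, m trades (i,l)(p,m) for (i,m)(p,l). The new entry (i,m)
shares a row with (i,j) and a column with (q,m), so Koszul relations settle the traded term. -/
theorem syzygy_row_col (h : IsKoszulFamily ε P v e) (i j l p q m : Fin n) :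
    quadricSyzygy ε v e (i, j) (i, l) (p, m) (q, m) = 0 := by
  by_cases h1 : i = p
  · exact h.syzygy_connected (Or.inl rfl) (Or.inr rfl) (Or.inl (Or.inl h1))
  by_cases h2 : l = m
  · exact h.syzygy_connected (Or.inl rfl) (Or.inr rfl) (Or.inr (Or.inr (Or.inl (Or.inr h2))))
  rw [syzygy_eq_of_sameLine (show SameLine (i, j) (i, l) from Or.inl rfl)
    (show SameLine (p, m) (q, m) from Or.inr rfl)]
  have hb := h.comm (q, m) (i, j) _ (h.bin_mem h1 h2)
  rw [map_mul_bin, map_mul_bin] at hb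
  have h3 := h.comm (p, m) (q, m) _ (h.mul_mem (a := (i, j)) (b := (i, l)) (Or.inl rfl))
  have h4 := h.comm (i, j) (p, l) _ (h.mul_mem (a := (i, m)) (b := (q, m)) (Or.inr rfl))
  have h5 := h.comm (q, m) (p, l) _ (h.mul_mem (a := (i, j)) (b := (i, m)) (Or.inl rfl))
  rw [show v (i, j) * (v (i, m) * v (p, l)) = v (p, l) * (v (i, j) * v (i, m)) by ring,
    show v (q, m) * (v (i, m) * v (p, l)) = v (p, l) * (v (i, m) * v (q, m)) by ring, h4, h5,
    show v (q, m) * (v (i, j) * v (i, m)) = v (i, j) * (v (i, m) * v (q, m)) by ring] at hb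
  rw [h3, show v (p, m) * (v (i, j) * v (i, l)) = v (i, j) * (v (i, l) * v (p, m)) by ring,
    show v (i, l) * (v (p, m) * v (q, m)) = v (q, m) * (v (i, l) * v (p, m)) by ring]
  rw [← sub_eq_zero] at hb ⊢
  refine Eq.trans ?_ hb
  module

/-- If (i,r) shares a line with an entry of the minor, the connected case applies termwise.
Otherwise the braid relation rewrites v (i, r) times the minor using minors that involve row i;
expanding these produces products of two entries of row i, which lie in P. -/
theorem syzygy_row_bin (h : IsKoszulFamily ε P v e) (i m r : Fin n) {p q s t : Fin n}
    (hp : p ≠ s) (hq : q ≠ t) : quadricSyzygy ε v e (i, m) (i, r) (p, q) (s, t) = 0 := by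
  have hline : SameLine (i, m) (i, r) := Or.inl rfl
  have hne : ¬SameLine (p, q) (s, t) := by simp [SameLine, hp, hq]
  have hval : quadricSyzygy ε v e (i, m) (i, r) (p, q) (s, t) =
      e (p, q) (v (s, t) * (v (i, m) * v (i, r))) -
        ε • e (p, t) (v (s, q) * (v (i, m) * v (i, r))) -
      e (i, m) (v (i, r) * bin ε v p s q t) := by
    rw [quadricSyzygy, quadric_eq_bin hp hq]
    simp only [quadricMul, quadric, ruleCoeff_of_sameLine hline, ruleCoeff_of_not_sameLine hne,
      zero_smul, sub_zero]
  rw [hval]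
  by_cases hconn : i = p ∨ i = s ∨ r = q ∨ r = t
  · rw [map_mul_bin]
    rcases hconn with rfl | rfl | rfl | rfl
    · rw [h.connected_middle (i, m) (i, r) (i, q) (s, t) hline (Or.inl rfl),
        h.connected_middle (i, m) (i, r) (i, t) (s, q) hline (Or.inl rfl), sub_self]
    · rw [h.connected_last (i, m) (i, r) (p, q) (i, t) (Or.inl rfl),
        h.connected_last (i, m) (i, r) (p, t) (i, q) (Or.inl rfl), sub_self]
    · rw [h.connected_middle (i, m) (i, r) (p, r) (s, t) hline (Or.inr rfl),
        h.connected_last (i, m) (i, r) (p, t) (s, r) (Or.inr rfl), sub_self]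
    · rw [h.connected_last (i, m) (i, r) (p, q) (s, r) (Or.inr rfl),
        h.connected_middle (i, m) (i, r) (p, r) (s, q) hline (Or.inr rfl), sub_self]
  · push Not at hconn
    obtain ⟨h1, h2, h3, h4⟩ := hconn
    have hbr := h.map_braid (i, m) p i s q r t
    rw [h.comm (i, m) (s, t) _ (h.bin_mem h1.symm h3.symm),
      h.comm (i, m) (p, r) _ (h.bin_mem h2 hq),
      h.comm (i, m) (s, q) _ (h.bin_mem h1.symm h4),
      map_mul_bin (s, t), map_mul_bin (p, r), map_mul_bin (s, q)] at hbr
    have row : ∀ x y, v (i, x) * v (i, y) ∈ P := fun x y => h.mul_mem (Or.inl rfl)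
    have e1 := h.comm (s, t) (p, r) _ (row m q)
    have e2 := h.comm (p, r) (s, q) _ (row m t)
    have e3 := h.comm (s, t) (p, q) _ (row m r)
    have e4 := h.comm (s, q) (p, t) _ (row m r)
    rw [show v (i, m) * (v (p, q) * v (i, r)) = v (p, q) * (v (i, m) * v (i, r)) by ring,
      show v (i, m) * (v (p, r) * v (i, q)) = v (p, r) * (v (i, m) * v (i, q)) by ring,
      show v (i, m) * (v (i, q) * v (s, t)) = v (s, t) * (v (i, m) * v (i, q)) by ring,
      show v (i, m) * (v (i, t) * v (s, q)) = v (s, q) * (v (i, m) * v (i, t)) by ring,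
      show v (i, m) * (v (p, r) * v (i, t)) = v (p, r) * (v (i, m) * v (i, t)) by ring,
      show v (i, m) * (v (p, t) * v (i, r)) = v (p, t) * (v (i, m) * v (i, r)) by ring,
      e1, e2, e3, e4, smul_sub, smul_smul, h.sq_eq_one, one_smul] at hbr
    rw [hbr]
    abel

theorem syzygy_bin_bin_eq {i p x y i' p' x' y' : Fin n} (hi : i ≠ p) (hx : x ≠ y) (hi' : i' ≠ p')
    (hx' : x' ≠ y') : quadricSyzygy ε v e (i, x) (p, y) (i', x') (p', y') =
      (e (i', x') (v (p', y') * bin ε v i p x y) -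
        ε • e (i', y') (v (p', x') * bin ε v i p x y)) -
      (e (i, x) (v (p, y) * bin ε v i' p' x' y') -
        ε • e (i, y) (v (p, x) * bin ε v i' p' x' y')) := by
  rw [quadricSyzygy, quadric_eq_bin hi hx, quadric_eq_bin hi' hx', quadricMul, quadricMul,
    ruleCoeff_of_not_sameLine (by simp [SameLine, hi', hx']),
    ruleCoeff_of_not_sameLine (by simp [SameLine, hi, hx])]

/-- After expansion every term contains two entries of the common row i. Their product lies in P, so
the two remaining factors can be interchanged. -/
theorem syzygy_bin_bin_row (h : IsKoszulFamily ε P v e) {i l s x y q t : Fin n} (hl : i ≠ l)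
    (hx : x ≠ y) (hs : i ≠ s) (hq : q ≠ t) :
    quadricSyzygy ε v e (i, x) (l, y) (i, q) (s, t) = 0 := by
  rw [syzygy_bin_bin_eq hl hx hs hq]
  have m1 := h.bin_mem hl hx
  have m2 := h.bin_mem hs hq
  rw [h.comm (i, q) (s, t) _ m1, h.comm (i, t) (s, q) _ m1, h.comm (i, x) (l, y) _ m2,
    h.comm (i, y) (l, x) _ m2]
  simp only [map_mul_bin]
  have row : ∀ x y, v (i, x) * v (i, y) ∈ P := fun x y => h.mul_mem (Or.inl rfl)
  have key : ∀ x' y' q' t', e (s, t') (v (i, q') * (v (i, x') * v (l, y'))) =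
      e (l, y') (v (i, x') * (v (i, q') * v (s, t'))) := by
    intro x' y' q' t'
    rw [show v (i, q') * (v (i, x') * v (l, y')) = v (l, y') * (v (i, x') * v (i, q')) by ring,
      show v (i, x') * (v (i, q') * v (s, t')) = v (s, t') * (v (i, x') * v (i, q')) by ring,
      h.comm _ _ _ (row _ _)]
  rw [key, key, key, key]
  simp only [smul_sub]
  abel

/-- Koszul syzygies between minors on disjoint rows and columns: transpositions with disjoint
supports commute, as a consequence of the braid relations. -/
theorem syzygy_bin_bin_distinct (h : IsKoszulFamily ε P v e) {r₁ r₂ r₃ r₄ x w y z : Fin n}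
    (h12 : r₁ ≠ r₂) (h13 : r₁ ≠ r₃) (h14 : r₁ ≠ r₄) (h23 : r₂ ≠ r₃) (h24 : r₂ ≠ r₄) (h34 : r₃ ≠ r₄)
    (hxw : x ≠ w) (hxy : x ≠ y) (hxz : x ≠ z) (hwy : w ≠ y) (hwz : w ≠ z) (hyz : y ≠ z) :
    quadricSyzygy ε v e (r₁, x) (r₂, w) (r₃, y) (r₄, z) = 0 := by
  rw [syzygy_bin_bin_eq h12 hxw h34 hyz]
  have b1 := h.map_braid (r₃, z) r₄ r₂ r₁ w y x
  have b2 := h.map_braid (r₁, x) r₄ r₃ r₂ w z y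
  have b3 := h.map_braid (r₁, w) r₄ r₃ r₂ y z x
  have b4 := h.map_braid (r₂, y) r₄ r₃ r₁ w z x
  have b5 := h.map_braid (r₄, z) r₃ r₂ r₁ w y x
  have c1 := h.comm (r₃, z) (r₂, y) _ (h.bin_mem h14.symm hxw.symm)
  have c2 := h.comm (r₃, z) (r₁, x) _ (h.bin_mem h24.symm hwy)
  have c3 := h.comm (r₃, z) (r₁, w) _ (h.bin_mem h24.symm hxy.symm)
  have c4 := h.comm (r₂, y) (r₄, z) _ (h.bin_mem h13.symm hxw.symm)
  have c5 := h.comm (r₁, x) (r₂, y) _ (h.bin_mem h34.symm hwz)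
  have c6 := h.comm (r₁, x) (r₄, z) _ (h.bin_mem h23.symm hwy)
  have c7 := h.comm (r₁, w) (r₄, z) _ (h.bin_mem h23.symm hxy.symm)
  have c8 := h.comm (r₁, w) (r₂, y) _ (h.bin_mem h34.symm hxz.symm)
  have c9 := h.comm (r₄, z) (r₃, y) _ (h.bin_mem h12.symm hxw.symm)
  have s1 : bin ε v r₂ r₁ w x = bin ε v r₁ r₂ x w := bin_rows_comm _ _ _ _
  have s2 : bin ε v r₄ r₃ z y = bin ε v r₃ r₄ y z := bin_rows_comm _ _ _ _
  have s3 : bin ε v r₄ r₃ y z = -(ε • bin ε v r₃ r₄ y z) := by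
    rw [bin_rows_comm, h.bin_cols_comm]
  rw [s1] at c9 b1 b5
  rw [s2] at b2
  rw [s3, mul_neg, mul_smul_comm, map_neg, map_smul] at b3
  rw [c1, c2, c3, b2, b3, b4, c4, b5, c5, c6, c7, c8, c9] at b1
  simp only [smul_add, smul_smul, h.sq_eq_one, one_smul] at b1
  rw [← sub_eq_zero] at b1 ⊢
  refine Eq.trans ?_ b1
  module

/-- All Koszul syzygies between quadrics vanish if those between products of two entries of a row
and two entries of another row, in four different columns, do, and similarly for columns. -/
theorem syzygy_eq_zero (h : IsKoszulFamily ε P v e)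
    (hrow : ∀ i p (f : Fin 4 ↪ Fin n), i ≠ p →
      quadricSyzygy ε v e (i, f 0) (i, f 1) (p, f 2) (p, f 3) = 0)
    (hcol : ∀ i p (f : Fin 4 ↪ Fin n), i ≠ p →
      quadricSyzygy ε v e (f 0, i) (f 1, i) (f 2, p) (f 3, p) = 0) (a b c d : Fin n × Fin n) :
    quadricSyzygy ε v e a b c d = 0 := by
  have hrow' : ∀ i p (f : Fin 4 ↪ Fin n), i ≠ p →
      quadricSyzygy ε (v ∘ Prod.swap) (e ∘ Prod.swap) (i, f 0) (i, f 1) (p, f 2) (p, f 3) = 0 := by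
    intro i p f hip
    rw [h.syzygy_transpose]
    exact hcol i p f hip
  have line : ∀ a b c d : Fin n × Fin n, SameLine a b → quadricSyzygy ε v e a b c d = 0 := by
    rintro ⟨i, j⟩ ⟨i', j'⟩ ⟨p, q⟩ ⟨s, t⟩ hab
    rcases hab with rfl | rfl
    · by_cases hp : p = s
      · subst hp
        exact h.syzygy_row_row hrow _ _ _ _ _ _
      by_cases hq : q = t
      · subst hq
        exact h.syzygy_row_col _ _ _ _ _ _
      exact h.syzygy_row_bin _ _ _ hp hq
    · have ht := h.syzygy_transpose (j, i) (j, i') (q, p) (t, s)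
      simp only [Prod.swap_prod_mk] at ht
      rw [← ht]
      by_cases hq : q = t
      · subst hq
        exact h.transpose.syzygy_row_row hrow' _ _ _ _ _ _
      by_cases hp : p = s
      · subst hp
        exact h.transpose.syzygy_row_col _ _ _ _ _ _
      exact h.transpose.syzygy_row_bin _ _ _ hq hp
  by_cases hab : SameLine a b
  · exact line a b c d hab
  by_cases hcd : SameLine c d
  · rw [quadricSyzygy_antisymm, line c d a b hcd, neg_zero]
  -- Quantified over all families, so that a common column is handled by the transpose.
  have share : ∀ {v : Fin n × Fin n → S} {e : Fin n × Fin n → S →ₗ[k] Q},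
      IsKoszulFamily ε P v e → ∀ a b c d : Fin n × Fin n, ¬SameLine a b → ¬SameLine c d →
      (a.1 = c.1 ∨ a.1 = d.1 ∨ b.1 = c.1 ∨ b.1 = d.1) → quadricSyzygy ε v e a b c d = 0 := by
    intro v e h a b c d hab hcd hs
    have key : ∀ a b c d : Fin n × Fin n, ¬SameLine a b → ¬SameLine c d → a.1 = c.1 →
        quadricSyzygy ε v e a b c d = 0 := by
      rintro ⟨i, j⟩ ⟨i', j'⟩ ⟨p, q⟩ ⟨s, t⟩ hab hcd hac
      simp only [SameLine, not_or] at hab hcd hac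
      subst hac
      exact h.syzygy_bin_bin_row hab.1 hab.2 hcd.1 hcd.2
    rcases hs with hs | hs | hs | hs
    · exact key _ _ _ _ hab hcd hs
    · rw [h.syzygy_comm_right]
      exact key _ _ _ _ hab (fun h' => hcd (sameLine_comm.mp h')) hs
    · rw [h.syzygy_comm_left]
      exact key _ _ _ _ (fun h' => hab (sameLine_comm.mp h')) hcd hs
    · rw [h.syzygy_comm_left, h.syzygy_comm_right]
      exact key _ _ _ _ (fun h' => hab (sameLine_comm.mp h'))
        (fun h' => hcd (sameLine_comm.mp h')) hs
  by_cases hr : a.1 = c.1 ∨ a.1 = d.1 ∨ b.1 = c.1 ∨ b.1 = d.1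
  · exact share h a b c d hab hcd hr
  by_cases hc : a.2 = c.2 ∨ a.2 = d.2 ∨ b.2 = c.2 ∨ b.2 = d.2
  · have ht := h.syzygy_transpose a.swap b.swap c.swap d.swap
    simp only [Prod.swap_swap] at ht
    rw [← ht]
    exact share h.transpose _ _ _ _ (fun h' => hab (sameLine_swap.mp h'))
      (fun h' => hcd (sameLine_swap.mp h')) hc
  simp only [SameLine, not_or] at hab hcd hr hc
  exact h.syzygy_bin_bin_distinct hab.1 hr.1 hr.2.1 hr.2.2.1 hr.2.2.2 hcd.1 hab.2 hc.1 hc.2.1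
    hc.2.2.1 hc.2.2.2 hcd.2

/-- The exceptional syzygies are invariant, up to sign, under cyclic permutation of three columns,
hence vanish if `ε ≠ 1`. -/
theorem syzygy_rows_eq_zero_of_ne_one (h : IsKoszulFamily ε P v e) (hε : ε ≠ 1) (i p : Fin n)
    (f : Fin 4 ↪ Fin n) (hip : i ≠ p) :
    quadricSyzygy ε v e (i, f 0) (i, f 1) (p, f 2) (p, f 3) = 0 := by
  have hf : ∀ {a b : Fin 4}, a ≠ b → f a ≠ f b := fun hab => f.injective.ne hab
  have h1 : quadricSyzygy ε v e (i, f 0) (i, f 1) (p, f 2) (p, f 3) =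
      ε • quadricSyzygy ε v e (i, f 0) (i, f 1) (p, f 2) (p, f 3) := by
    -- Three exchanges, separated by swaps within the first row, restore the original column order
    -- and contribute ε³ = ε.
    conv_lhs =>
      rw [h.syzygy_rows_exchange hip (hf (by decide : (1 : Fin 4) ≠ 2)), h.syzygy_comm_left,
        h.syzygy_rows_exchange hip (hf (by decide : (0 : Fin 4) ≠ 1)), h.syzygy_comm_left,
        h.syzygy_rows_exchange hip (hf (by decide : (2 : Fin 4) ≠ 0)), h.syzygy_comm_left,
        smul_smul, smul_smul, h.sq_eq_one, one_mul]
  have h2 : (1 - ε) • quadricSyzygy ε v e (i, f 0) (i, f 1) (p, f 2) (p, f 3) = 0 := by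
    rw [sub_smul, one_smul, ← h1, sub_self]
  exact (smul_eq_zero.mp h2).resolve_left (sub_ne_zero.mpr hε.symm)

/-- For `ε = 1` the exceptional syzygies do not depend on the order of the columns. -/
theorem syzygy_rows_perm (h : IsKoszulFamily 1 P v e) (i p : Fin n) (f : Fin 4 ↪ Fin n)
    (hip : i ≠ p) (σ : Equiv.Perm (Fin 4)) :
    quadricSyzygy 1 v e (i, f (σ 0)) (i, f (σ 1)) (p, f (σ 2)) (p, f (σ 3)) =
      quadricSyzygy 1 v e (i, f 0) (i, f 1) (p, f 2) (p, f 3) := by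
  have h12 : ∀ g : Fin 4 ↪ Fin n, quadricSyzygy 1 v e (i, g 0) (i, g 1) (p, g 2) (p, g 3) =
      quadricSyzygy 1 v e (i, g 0) (i, g 2) (p, g 1) (p, g 3) := fun g => by
    rw [h.syzygy_rows_exchange hip (g.injective.ne (by decide : (1 : Fin 4) ≠ 2)), one_smul]
  -- Adjacent transpositions generate S₄: the outer two are commutativity of a product within a row,
  -- the middle one is the column exchange.
  have hgen : ∀ m : Fin 3, ∀ g : Fin 4 ↪ Fin n, ∀ s : Equiv.Perm (Fin 4),
      s = Equiv.swap m.castSucc m.succ →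
      quadricSyzygy 1 v e (i, g (s 0)) (i, g (s 1)) (p, g (s 2)) (p, g (s 3)) =
      quadricSyzygy 1 v e (i, g 0) (i, g 1) (p, g 2) (p, g 3) := by
    intro m g s hs
    fin_cases m
    · have e0 : s 0 = 1 := by rw [hs]; decide
      have e1 : s 1 = 0 := by rw [hs]; decide
      have e2 : s 2 = 2 := by rw [hs]; decide
      have e3 : s 3 = 3 := by rw [hs]; decide
      rw [e0, e1, e2, e3, h.syzygy_comm_left]
    · have e0 : s 0 = 0 := by rw [hs]; decide
      have e1 : s 1 = 2 := by rw [hs]; decide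
      have e2 : s 2 = 1 := by rw [hs]; decide
      have e3 : s 3 = 3 := by rw [hs]; decide
      rw [e0, e1, e2, e3, h12 g]
    · have e0 : s 0 = 0 := by rw [hs]; decide
      have e1 : s 1 = 1 := by rw [hs]; decide
      have e2 : s 2 = 3 := by rw [hs]; decide
      have e3 : s 3 = 2 := by rw [hs]; decide
      rw [e0, e1, e2, e3, h.syzygy_comm_right]
  have hmem : σ ∈ Submonoid.closure (Set.range fun m : Fin 3 =>
      Equiv.swap m.castSucc m.succ) := by
    rw [Equiv.Perm.mclosure_swap_castSucc_succ]
    trivial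
  induction hmem using Submonoid.closure_induction_left generalizing f with
  | one => rfl
  | mul_left s hs τ _ ih =>
    obtain ⟨m, rfl⟩ := hs
    have h1 := ih ((Equiv.swap m.castSucc m.succ).toEmbedding.trans f)
    exact h1.trans (hgen m f _ rfl)

end IsKoszulFamily

end KoszulFamily

/-! ### Syzygies in V ⊗ I₃ modulo Koszul relations -/

section CubicSyzygies

variable {ι k : Type*} [Field k]

/-- The linear syzygies of the degree three part of an ideal. -/
def cubicSyzygies [Fintype ι] (I : Ideal (MvPolynomial ι k)) :
    Submodule k (ι → MvPolynomial ι k) where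
  carrier := {g | (∀ a, g a ∈ idealPart I 3) ∧ ∑ a, X a * g a = 0}
  add_mem' := by
    rintro g h ⟨g1, g2⟩ ⟨h1, h2⟩
    exact ⟨fun a => add_mem (g1 a) (h1 a), by simp [mul_add, Finset.sum_add_distrib, g2, h2]⟩
  zero_mem' := by simp
  smul_mem' := by
    rintro c g ⟨g1, g2⟩
    exact ⟨fun a => Submodule.smul_mem _ _ (g1 a), by simp [← Finset.smul_sum, g2]⟩

/-- The span of the Koszul syzygies of the degree three part of an ideal. -/
def koszulRelations [DecidableEq ι] (I : Ideal (MvPolynomial ι k)) :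
    Submodule k (ι → MvPolynomial ι k) :=
  Submodule.span k {g | ∃ x y, ∃ q ∈ idealPart I 2,
    g = tensorX x (X y * q) - tensorX y (X x * q)}

variable [DecidableEq ι]

theorem isKoszulClosed_of_le {I : Ideal (MvPolynomial ι k)}
    {B : Submodule k (ι → MvPolynomial ι k)} (h : koszulRelations I ≤ B) : IsKoszulClosed I B :=
  fun x y q hq => h (Submodule.subset_span ⟨x, y, q, hq, rfl⟩)

theorem sum_X_mul_tensorX [Fintype ι] (c : ι) (p : MvPolynomial ι k) :
    ∑ a, X a * tensorX c p a = X c * p := by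
  rw [Finset.sum_eq_single c]
  · simp [tensorX]
  · intro b _ hb
    simp [tensorX, hb]
  · simp

theorem tensorX_apply_mem {I : Ideal (MvPolynomial ι k)} {d : ℕ} (c a : ι)
    {p : MvPolynomial ι k} (hp : p ∈ idealPart I d) : tensorX c p a ∈ idealPart I d := by
  by_cases h : a = c
  · subst h
    simpa [tensorX] using hp
  · simp [tensorX, h]

theorem koszulRelations_le_cubicSyzygies [Fintype ι] (I : Ideal (MvPolynomial ι k)) :
    koszulRelations I ≤ cubicSyzygies I := by
  refine Submodule.span_le.mpr ?_
  rintro _ ⟨x, y, q, hq, rfl⟩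
  refine ⟨fun a => sub_mem (tensorX_apply_mem _ _ (X_mul_mem_idealPart _ hq))
    (tensorX_apply_mem _ _ (X_mul_mem_idealPart _ hq)), ?_⟩
  simp only [Pi.sub_apply, mul_sub, Finset.sum_sub_distrib, sum_X_mul_tensorX]
  ring

instance finite_cubicSyzygies [Fintype ι] (I : Ideal (MvPolynomial ι k)) :
    Module.Finite k (cubicSyzygies I) := by
  let f : cubicSyzygies I →ₗ[k] (ι → idealPart I 3) :=
    { toFun := fun g a => ⟨g.1 a, g.2.1 a⟩
      map_add' := fun _ _ => rfl
      map_smul' := fun _ _ => rfl }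
  refine Module.Finite.of_injective f fun g h hgh => Subtype.ext (funext fun a => ?_)
  exact congrArg Subtype.val (congrFun hgh a)

end CubicSyzygies

section Rules

variable {k : Type*} [Field k] {n : ℕ} {ε : k} {I : Ideal (MvPolynomial (Fin n × Fin n) k)}
  {B : Submodule k (Fin n × Fin n → MvPolynomial (Fin n × Fin n) k)}

theorem quadric_X (a b : Fin n × Fin n) :
    quadric ε (X : Fin n × Fin n → MvPolynomial (Fin n × Fin n) k) a b = rule ε a b := by
  rw [quadric, rule, smul_eq_C_mul]

theorem HasStandardRules.isKoszulFamily (h : HasStandardRules ε I) (hB : IsKoszulClosed I B) :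
    IsKoszulFamily ε (idealPart I 2) X (fun a => B.mkQ ∘ₗ tensorX a) where
  sq_eq_one := h.sq_eq_one
  comm a b q hq := by
    have := (Submodule.Quotient.mk_eq_zero B).mpr (hB a b q hq)
    rw [Submodule.Quotient.mk_sub, sub_eq_zero] at this
    exact this
  quadric_mem a b := by
    rw [quadric_X]
    exact h.rule_mem_idealPart a b

theorem mkQ_ruleSyzygy (a b c d : Fin n × Fin n) : B.mkQ (ruleSyzygy ε a b c d) =
    quadricSyzygy ε X (fun a => B.mkQ ∘ₗ tensorX a) a b c d := by
  simp only [ruleSyzygy, quadricSyzygy, quadricMul, quadric_X, map_sub, map_smul,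
    LinearMap.comp_apply]

theorem quadricSyzygy_eq_zero_iff (a b c d : Fin n × Fin n) :
    quadricSyzygy ε X (fun a => B.mkQ ∘ₗ tensorX a) a b c d = 0 ↔ ruleSyzygy ε a b c d ∈ B := by
  rw [← mkQ_ruleSyzygy, Submodule.mkQ_apply, Submodule.Quotient.mk_eq_zero]

/-- In the quotient by B the classes of x_a ⊗ p form a Koszul family, so membership of the
exceptional syzygies in B forces that of all Koszul syzygies between rules, and these suffice by
`mem_of_syzygy`. -/
theorem HasStandardRules.cubicSyzygies_le (h : HasStandardRules ε I) (hB : IsKoszulClosed I B)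
    (hrow : ∀ i p (f : Fin 4 ↪ Fin n), i ≠ p →
      ruleSyzygy ε (i, f 0) (i, f 1) (p, f 2) (p, f 3) ∈ B)
    (hcol : ∀ i p (f : Fin 4 ↪ Fin n), i ≠ p →
      ruleSyzygy ε (f 0, i) (f 1, i) (f 2, p) (f 3, p) ∈ B) : cubicSyzygies I ≤ B := by
  intro g hg
  refine h.mem_of_syzygy hB (fun a b c d _ _ => ?_) hg.1 hg.2
  rw [← quadricSyzygy_eq_zero_iff]
  exact (h.isKoszulFamily hB).syzygy_eq_zero
    (fun i p f hip => (quadricSyzygy_eq_zero_iff _ _ _ _).mpr (hrow i p f hip))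
    (fun i p f hip => (quadricSyzygy_eq_zero_iff _ _ _ _).mpr (hcol i p f hip)) a b c d

theorem HasStandardRules.cubicSyzygies_eq_koszulRelations (h : HasStandardRules ε I)
    (hε : ε ≠ 1) : cubicSyzygies I = koszulRelations I := by
  refine le_antisymm ?_ (koszulRelations_le_cubicSyzygies I)
  have hB := isKoszulClosed_of_le (le_refl (koszulRelations I))
  have hF := h.isKoszulFamily hB
  refine h.cubicSyzygies_le hB (fun i p f hip => ?_) (fun i p f hip => ?_)
  · rw [← quadricSyzygy_eq_zero_iff]
    exact hF.syzygy_rows_eq_zero_of_ne_one hε i p f hip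
  · rw [← quadricSyzygy_eq_zero_iff]
    have := hF.transpose.syzygy_rows_eq_zero_of_ne_one hε i p f hip
    rwa [hF.syzygy_transpose] at this

theorem HasStandardRules.ruleSyzygy_mem (h : HasStandardRules ε I) (a b c d : Fin n × Fin n) :
    ruleSyzygy ε a b c d ∈ cubicSyzygies I := by
  have hm : ∀ x y z a b : Fin n × Fin n, tensorX x (X y * rule ε a b) z ∈ idealPart I 3 :=
    fun x y z a b => tensorX_apply_mem _ _ (X_mul_mem_idealPart _ (h.rule_mem_idealPart a b))
  refine ⟨fun z => ?_, ?_⟩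
  · exact sub_mem (sub_mem (hm _ _ _ _ _) (Submodule.smul_mem _ _ (hm _ _ _ _ _)))
      (sub_mem (hm _ _ _ _ _) (Submodule.smul_mem _ _ (hm _ _ _ _ _)))
  · simp only [ruleSyzygy, Pi.sub_apply, Pi.smul_apply, mul_sub, mul_smul_comm,
      Finset.sum_sub_distrib, ← Finset.smul_sum, sum_X_mul_tensorX]
    simp only [rule, smul_eq_C_mul]
    ring

end Rules

/-! ### The exceptional syzygies of the permanent and their independence -/

section Exceptional

variable {k : Type*} [Field k] {n : ℕ}

/-- The transposition of positions if `b` is true. -/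
def flipPosition (b : Bool) (a : Fin n × Fin n) : Fin n × Fin n := bif b then a.swap else a

/-- The index set of the exceptional syzygies: two rows and four columns, or transposed. -/
abbrev ExceptionalIndex (n : ℕ) : Type :=
  Bool × (Fin 2 ↪o Fin n) × (Fin 4 ↪o Fin n)

/-- The syzygies of the ideal of the permanent that are not generated by Koszul relations. -/
def exceptionalSyzygy (k : Type*) [Field k] {n : ℕ} (t : ExceptionalIndex n) :
    Fin n × Fin n → MvPolynomial (Fin n × Fin n) k :=
  ruleSyzygy 1 (flipPosition t.1 (t.2.1 0, t.2.2 0)) (flipPosition t.1 (t.2.1 0, t.2.2 1))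
    (flipPosition t.1 (t.2.1 1, t.2.2 2)) (flipPosition t.1 (t.2.1 1, t.2.2 3))

theorem card_orderEmbedding (m n : ℕ) : Nat.card (Fin m ↪o Fin n) = n.choose m := by
  have hcard : Fintype.card ((Finset.univ : Finset (Fin n)).powersetCard m) = n.choose m := by
    simp
  rw [← hcard, ← Nat.card_eq_fintype_card]
  refine Nat.card_eq_of_bijective (fun f => ⟨Finset.univ.map f.toEmbedding, by simp⟩) ⟨?_, ?_⟩
  · intro f g hfg
    have h := congrArg (fun s : Finset (Fin n) => (s : Set (Fin n))) (congrArg Subtype.val hfg)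
    simp only [Finset.coe_map, Finset.coe_univ, Set.image_univ] at h
    exact OrderEmbedding.range_inj.mp h
  · rintro ⟨s, hs⟩
    have hc := (Finset.mem_powersetCard.mp hs).2
    refine ⟨s.orderEmbOfFin hc, Subtype.ext (Finset.coe_injective ?_)⟩
    simp only [Finset.coe_map, Finset.coe_univ, Set.image_univ]
    exact Finset.range_orderEmbOfFin s hc

theorem card_exceptionalIndex (n : ℕ) :
    Nat.card (ExceptionalIndex n) = 2 * n.choose 2 * n.choose 4 := by
  rw [Nat.card_prod, Nat.card_prod, card_orderEmbedding, card_orderEmbedding,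
    Nat.card_eq_fintype_card, Fintype.card_bool, mul_assoc]

theorem exists_orderEmbedding_comp {m : ℕ} (f : Fin m ↪ Fin n) :
    ∃ (g : Fin m ↪o Fin n) (σ : Equiv.Perm (Fin m)), ∀ i, f i = g (σ i) := by
  have hc : (Finset.univ.map f).card = m := by simp
  have hm : ∀ i, f i ∈ Finset.univ.map f := fun i => by simp
  let u := (Finset.univ.map f).orderIsoOfFin hc
  have hinj : Function.Injective fun i => u.symm ⟨f i, hm i⟩ := fun i j hij =>
    f.injective (congrArg Subtype.val (u.symm.injective hij))
  refine ⟨(Finset.univ.map f).orderEmbOfFin hc,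
    Equiv.ofBijective _ (Finite.injective_iff_bijective.mp hinj), fun i => ?_⟩
  rw [Equiv.ofBijective_apply, ← Finset.coe_orderIsoOfFin_apply]
  exact (congrArg Subtype.val (u.apply_symm_apply ⟨f i, hm i⟩)).symm

variable {I : Ideal (MvPolynomial (Fin n × Fin n) k)}

/-- For ε = 1 the order of the columns is irrelevant modulo Koszul relations and the order of the
rows affects only the sign, so increasing rows and columns suffice. -/
theorem HasStandardRules.cubicSyzygies_eq_sup (h : HasStandardRules (1 : k) I) :
    cubicSyzygies I = koszulRelations I ⊔ Submodule.span k (Set.range (exceptionalSyzygy k)) := by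
  set B := koszulRelations I ⊔ Submodule.span k (Set.range (exceptionalSyzygy k (n := n)))
  have hB : IsKoszulClosed I B := isKoszulClosed_of_le le_sup_left
  have hF := h.isKoszulFamily hB
  have rows : ∀ {v : Fin n × Fin n → MvPolynomial (Fin n × Fin n) k}
      {e : Fin n × Fin n → MvPolynomial (Fin n × Fin n) k →ₗ[k] _ ⧸ B},
      IsKoszulFamily 1 (idealPart I 2) v e →
      (∀ (r : Fin 2 ↪o Fin n) (c : Fin 4 ↪o Fin n),
        quadricSyzygy 1 v e (r 0, c 0) (r 0, c 1) (r 1, c 2) (r 1, c 3) = 0) →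
      ∀ i p (f : Fin 4 ↪ Fin n), i ≠ p →
        quadricSyzygy 1 v e (i, f 0) (i, f 1) (p, f 2) (p, f 3) = 0 := by
    intro v e hF hz
    have lt : ∀ i p (f : Fin 4 ↪ Fin n), i < p →
        quadricSyzygy 1 v e (i, f 0) (i, f 1) (p, f 2) (p, f 3) = 0 := by
      intro i p f hip
      obtain ⟨g, σ, hg⟩ := exists_orderEmbedding_comp f
      simp only [hg]
      refine (hF.syzygy_rows_perm i p g.toEmbedding hip.ne σ).trans ?_
      have hr : StrictMono ![i, p] := by
        intro a b hab
        fin_cases a <;> fin_cases b <;> simp_all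
      exact hz (OrderEmbedding.ofStrictMono _ hr) g
    intro i p f hip
    rcases hip.lt_or_gt with hip | hip
    · exact lt i p f hip
    · rw [quadricSyzygy_antisymm]
      -- Adding 2 in `Fin 4` interchanges the first two columns with the last two.
      have hf := lt p i ((Equiv.addLeft (2 : Fin 4)).toEmbedding.trans f) hip
      have : quadricSyzygy 1 v e (p, f 2) (p, f 3) (i, f 0) (i, f 1) = 0 := hf
      rw [this, neg_zero]
  have hmem : ∀ t : ExceptionalIndex n, exceptionalSyzygy k t ∈ B := fun t =>
    Submodule.mem_sup_right (Submodule.subset_span ⟨t, rfl⟩)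
  refine le_antisymm (h.cubicSyzygies_le hB (fun i p f hip => ?_) (fun i p f hip => ?_)) ?_
  · rw [← quadricSyzygy_eq_zero_iff]
    refine rows hF (fun r c => ?_) i p f hip
    rw [quadricSyzygy_eq_zero_iff]
    exact hmem (false, r, c)
  · rw [← quadricSyzygy_eq_zero_iff]
    have := rows hF.transpose (fun r c => ?_) i p f hip
    · rwa [hF.syzygy_transpose] at this
    · rw [hF.syzygy_transpose, quadricSyzygy_eq_zero_iff]
      exact hmem (true, r, c)
  · refine sup_le (koszulRelations_le_cubicSyzygies I) (Submodule.span_le.mpr ?_)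
    rintro _ ⟨t, rfl⟩
    exact h.ruleSyzygy_mem _ _ _ _

/-- The grading of the monomials by rows and columns. -/
def rowColDegree (n : ℕ) : (Fin n × Fin n →₀ ℕ) →+ (Fin n ⊕ Fin n →₀ ℕ) :=
  Finsupp.mapDomain.addMonoidHom (fun a => Sum.inl a.1) +
    Finsupp.mapDomain.addMonoidHom (fun a => Sum.inr a.2)

theorem rowColDegree_single (a : Fin n × Fin n) : rowColDegree n (Finsupp.single a 1) =
    Finsupp.single (Sum.inl a.1) 1 + Finsupp.single (Sum.inr a.2) 1 := by
  simp [rowColDegree]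

/-- The sum of the coefficients of the monomials of given rows and columns. -/
def fiberSum (k : Type*) [Field k] {n : ℕ} (w : Fin n ⊕ Fin n →₀ ℕ) :
    MvPolynomial (Fin n × Fin n) k →ₗ[k] k :=
  letI := Classical.decEq (Fin n ⊕ Fin n →₀ ℕ)
  (basisMonomials _ k).constr k fun s => if rowColDegree n s = w then 1 else 0

open Classical in
theorem fiberSum_monomial (w : Fin n ⊕ Fin n →₀ ℕ) (s : Fin n × Fin n →₀ ℕ) (c : k) :
    fiberSum k w (monomial s c) = if rowColDegree n s = w then c else 0 := by
  have h : (monomial s c : MvPolynomial (Fin n × Fin n) k) = c • basisMonomials _ k s := by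
    rw [coe_basisMonomials, smul_monomial, smul_eq_mul, mul_one]
  rw [h, map_smul, fiberSum, Module.Basis.constr_basis]
  split_ifs <;> simp

/-- The functional summing the coefficients of given multidegree, over the components in a line. -/
def lineFunctional (k : Type*) [Field k] {n : ℕ} (l : Fin n ⊕ Fin n) (w : Fin n ⊕ Fin n →₀ ℕ) :
    (Fin n × Fin n → MvPolynomial (Fin n × Fin n) k) →ₗ[k] k :=
  ∑ a, (rowColDegree n (Finsupp.single a 1) l : k) •
    (fiberSum k w ∘ₗ LinearMap.mulLeft k (X a) ∘ₗ LinearMap.proj a)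

theorem lineFunctional_tensorX (l : Fin n ⊕ Fin n) (w : Fin n ⊕ Fin n →₀ ℕ)
    (c : Fin n × Fin n) (p : MvPolynomial (Fin n × Fin n) k) :
    lineFunctional k l w (tensorX c p) =
      rowColDegree n (Finsupp.single c 1) l * fiberSum k w (X c * p) := by
  rw [lineFunctional, LinearMap.sum_apply, Finset.sum_eq_single c]
  · simp
  · intro b _ hb
    simp [hb]
  · simp

open Classical in
-- For ε = 1 the two terms of a minor have opposite coefficients and the same row and column
-- degrees, so they cancel; only products of two entries on a line survive.
theorem fiberSum_quadratic (w : Fin n ⊕ Fin n →₀ ℕ) (x y a b : Fin n × Fin n) :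
    fiberSum k w (X x * (X y * rule 1 a b)) = if SameLine a b ∧
      rowColDegree n (Finsupp.single x 1) + (rowColDegree n (Finsupp.single y 1) +
        (rowColDegree n (Finsupp.single a 1) + rowColDegree n (Finsupp.single b 1))) = w
      then 1 else 0 := by
  have hm : ∀ a b : Fin n × Fin n, (X x * (X y * (X a * X b)) : MvPolynomial (Fin n × Fin n) k) =
      monomial (Finsupp.single x 1 + (Finsupp.single y 1 + (Finsupp.single a 1 +
        Finsupp.single b 1))) 1 := fun a b => by simp only [X, monomial_mul, mul_one]
  rw [rule, mul_sub, mul_sub, map_sub, ← smul_eq_C_mul, mul_smul_comm, mul_smul_comm,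
    map_smul, hm, hm, fiberSum_monomial, fiberSum_monomial]
  simp only [map_add]
  by_cases h : SameLine a b
  · simp [h, ruleCoeff_of_sameLine h]
  · rw [ruleCoeff_of_not_sameLine h, rowColDegree_single (a.1, b.2), rowColDegree_single (b.1, a.2),
      add_add_add_comm, add_comm (Finsupp.single (Sum.inr b.2) 1), ← add_add_add_comm,
      ← rowColDegree_single a, ← rowColDegree_single b]
    simp [h]

/-- The rows, or the columns if `b` is true. -/
def side (b : Bool) (i : Fin n) : Fin n ⊕ Fin n := bif b then Sum.inr i else Sum.inl i

theorem side_injective (b : Bool) : Function.Injective (side b : Fin n → _) := by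
  cases b
  · exact Sum.inl_injective
  · exact Sum.inr_injective

theorem side_ne (b : Bool) (i j : Fin n) : side b i ≠ side (!b) j := by
  cases b <;> simp [side]

theorem rowColDegree_flip (b : Bool) (i j : Fin n) :
    rowColDegree n (Finsupp.single (flipPosition b (i, j)) 1) =
      Finsupp.single (side b i) 1 + Finsupp.single (side (!b) j) 1 := by
  rw [rowColDegree_single]
  cases b
  · rfl
  · exact add_comm _ _

theorem exists_eq_flipPosition (b : Bool) (a : Fin n × Fin n) :
    ∃ i j, a = flipPosition b (i, j) := by
  cases b
  · exact ⟨a.1, a.2, rfl⟩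
  · exact ⟨a.2, a.1, rfl⟩

theorem sameLine_flipPosition (b : Bool) (i j p q : Fin n) :
    SameLine (flipPosition b (i, j)) (flipPosition b (p, q)) ↔ i = p ∨ j = q := by
  cases b
  · rfl
  · exact or_comm

/-- The multidegree of an exceptional syzygy. -/
def exceptionalDegree (t : ExceptionalIndex n) : Fin n ⊕ Fin n →₀ ℕ :=
  ∑ m, Finsupp.single (side t.1 (t.2.1 m)) 2 + ∑ m, Finsupp.single (side (!t.1) (t.2.2 m)) 1

open Classical in
theorem sum_single_apply {α β : Type*} [Fintype α] {g : α → β} (hg : Function.Injective g)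
    (e : ℕ) (x : β) : (∑ m, Finsupp.single (g m) e) x = if x ∈ Set.range g then e else 0 := by
  rw [Finsupp.finsetSum_apply]
  split_ifs with hx
  · obtain ⟨m, rfl⟩ := hx
    rw [Finset.sum_eq_single m]
    · simp
    · intro b _ hb
      exact Finsupp.single_eq_of_ne fun h => hb (hg h).symm
    · simp
  · exact Finset.sum_eq_zero fun m _ => Finsupp.single_eq_of_ne fun h => hx ⟨m, h.symm⟩

open Classical in
theorem exceptionalDegree_side (t : ExceptionalIndex n) (i : Fin n) :
    exceptionalDegree t (side t.1 i) = if i ∈ Set.range t.2.1 then 2 else 0 := by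
  rw [exceptionalDegree, Finsupp.add_apply,
    sum_single_apply (g := fun m => side t.1 (t.2.1 m))
      ((side_injective t.1).comp t.2.1.injective),
    sum_single_apply (g := fun m => side (!t.1) (t.2.2 m))
      ((side_injective (!t.1)).comp t.2.2.injective)]
  have h1 : side t.1 i ∉ Set.range fun m => side (!t.1) (t.2.2 m) := by
    rintro ⟨m, hm⟩
    exact side_ne _ _ _ hm.symm
  have h2 : side t.1 i ∈ (Set.range fun m => side t.1 (t.2.1 m)) ↔ i ∈ Set.range t.2.1 := by
    simp only [Set.mem_range, (side_injective t.1).eq_iff]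
  simp only [h1, h2, if_false, add_zero]

open Classical in
theorem exceptionalDegree_side_not (t : ExceptionalIndex n) (j : Fin n) :
    exceptionalDegree t (side (!t.1) j) = if j ∈ Set.range t.2.2 then 1 else 0 := by
  rw [exceptionalDegree, Finsupp.add_apply,
    sum_single_apply (g := fun m => side t.1 (t.2.1 m))
      ((side_injective t.1).comp t.2.1.injective),
    sum_single_apply (g := fun m => side (!t.1) (t.2.2 m))
      ((side_injective (!t.1)).comp t.2.2.injective)]
  have h1 : side (!t.1) j ∉ Set.range fun m => side t.1 (t.2.1 m) := by
    rintro ⟨m, hm⟩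
    exact side_ne _ _ _ hm
  have h2 : side (!t.1) j ∈ (Set.range fun m => side (!t.1) (t.2.2 m)) ↔
      j ∈ Set.range t.2.2 := by
    simp only [Set.mem_range, (side_injective (!t.1)).eq_iff]
  simp only [h1, h2, if_false, zero_add]

theorem orderEmbedding_eq_of_mem_range_iff {m : ℕ} {f g : Fin m ↪o Fin n}
    (h : ∀ i, i ∈ Set.range f ↔ i ∈ Set.range g) : f = g :=
  OrderEmbedding.range_inj.mp (Set.ext h)

/-- The side carrying the value 2 reveals whether the syzygy is transposed, and the supports on the
two sides recover its lines. -/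
theorem exceptionalDegree_injective :
    Function.Injective (exceptionalDegree : ExceptionalIndex n → _) := by
  classical
  intro s t hst
  obtain ⟨b, r, c⟩ := s
  obtain ⟨b', r', c'⟩ := t
  have hb : b = b' := by
    by_contra hb
    have h1 := exceptionalDegree_side (b, r, c) (r 0)
    have h2 := exceptionalDegree_side_not (b', r', c') (r 0)
    have e : (!b') = b := by cases b <;> cases b' <;> simp_all
    simp only [e] at h2
    rw [← hst, h1] at h2
    simp only [Set.mem_range_self, if_true] at h2
    split_ifs at h2
    omega
  subst hb
  have hr : r = r' := orderEmbedding_eq_of_mem_range_iff fun i => by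
    have h1 := exceptionalDegree_side (b, r, c) i
    have h2 := exceptionalDegree_side (b, r', c') i
    rw [hst, h2] at h1
    dsimp only at h1
    split_ifs at h1 <;> simp_all
  have hc : c = c' := orderEmbedding_eq_of_mem_range_iff fun i => by
    have h1 := exceptionalDegree_side_not (b, r, c) i
    have h2 := exceptionalDegree_side_not (b, r', c') i
    rw [hst, h2] at h1
    dsimp only at h1
    split_ifs at h1 <;> simp_all
  rw [hr, hc]

/-- The functional dual to an exceptional syzygy. -/
def exceptionalDual (k : Type*) [Field k] {n : ℕ} (t : ExceptionalIndex n) :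
    (Fin n × Fin n → MvPolynomial (Fin n × Fin n) k) →ₗ[k] k :=
  lineFunctional k (side t.1 (t.2.1 1)) (exceptionalDegree t)

/-- On a Koszul relation in x, y with coefficient a rule on a, b, the functional is the difference
of the degrees of x and y along the chosen row, times a fiber sum. If the sum is nonzero, a and b
share a line. It is not a column, as column degrees are at most 1; and a row has degree 2 there or
0, so a and b fill theirs, and x and y both lie on the chosen row or both off it. The transposed
case is the same. -/
theorem HasStandardRules.exceptionalDual_eq_zero (h : HasStandardRules (1 : k) I)
    (t : ExceptionalIndex n) {g : Fin n × Fin n → MvPolynomial (Fin n × Fin n) k}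
    (hg : g ∈ koszulRelations I) : exceptionalDual k t g = 0 := by
  classical
  suffices koszulRelations I ≤ LinearMap.ker (exceptionalDual k t) from this hg
  refine Submodule.span_le.mpr ?_
  rintro _ ⟨x, y, q, hq, rfl⟩
  rw [h.idealPart_two_eq_span] at hq
  rw [SetLike.mem_coe, LinearMap.mem_ker, map_sub, exceptionalDual, lineFunctional_tensorX,
    lineFunctional_tensorX, mul_left_comm (X y), ← sub_mul, mul_eq_zero, or_iff_not_imp_left]
  intro hne
  refine Submodule.span_induction (p := fun q _ => fiberSum k (exceptionalDegree t)
    (X x * (X y * q)) = 0) ?_ (by simp) (fun p q _ _ hp hq => by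
      rw [mul_add, mul_add, map_add, hp, hq, add_zero]) (fun c p _ hp => by
      rw [mul_smul_comm, mul_smul_comm, map_smul, hp, smul_zero]) hq
  rintro _ ⟨⟨a, b⟩, rfl⟩
  rw [fiberSum_quadratic, if_neg]
  rintro ⟨hab, hdeg⟩
  refine hne ?_
  obtain ⟨x₁, x₂, rfl⟩ := exists_eq_flipPosition t.1 x
  obtain ⟨y₁, y₂, rfl⟩ := exists_eq_flipPosition t.1 y
  obtain ⟨a₁, a₂, rfl⟩ := exists_eq_flipPosition t.1 a
  obtain ⟨b₁, b₂, rfl⟩ := exists_eq_flipPosition t.1 b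
  simp only [rowColDegree_flip] at hdeg ⊢
  rcases (sameLine_flipPosition _ _ _ _ _).mp hab with rfl | rfl
  · have h2 := DFunLike.congr_fun hdeg (side t.1 (t.2.1 1))
    rw [exceptionalDegree_side, if_pos ⟨1, rfl⟩] at h2
    simp only [Finsupp.add_apply, Finsupp.single_apply, (side_injective t.1).eq_iff,
      (side_ne t.1 _ _).symm, if_false, add_zero] at h2 ⊢
    split_ifs at h2 ⊢ <;> simp_all
  · have h2 := DFunLike.congr_fun hdeg (side (!t.1) a₂)
    rw [exceptionalDegree_side_not] at h2
    simp only [Finsupp.add_apply, Finsupp.single_apply, if_true] at h2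
    split_ifs at h2 <;> omega

/-- Different indices have different multidegrees. For equal ones, the functional counts only tensor
factors on the second chosen line, and exactly one of the two terms has its factor there. -/
theorem exceptionalDual_exceptionalSyzygy (s t : ExceptionalIndex n) :
    exceptionalDual k t (exceptionalSyzygy k s) = if s = t then 1 else 0 := by
  classical
  obtain ⟨b, r, c⟩ := s
  have hline : ∀ i x y : Fin n, SameLine (flipPosition b (i, x)) (flipPosition b (i, y)) :=
    fun i x y => (sameLine_flipPosition _ _ _ _ _).mpr (Or.inl rfl)
  have two : ∀ x : Fin n ⊕ Fin n, Finsupp.single x 2 = Finsupp.single x 1 + Finsupp.single x 1 :=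
    fun x => by rw [← Finsupp.single_add]
  have hdeg : Finsupp.single (side b (r 1)) 1 + Finsupp.single (side (!b) (c 2)) 1 +
      (Finsupp.single (side b (r 1)) 1 + Finsupp.single (side (!b) (c 3)) 1 +
      (Finsupp.single (side b (r 0)) 1 + Finsupp.single (side (!b) (c 0)) 1 +
      (Finsupp.single (side b (r 0)) 1 + Finsupp.single (side (!b) (c 1)) 1))) =
      exceptionalDegree (b, r, c) := by
    simp only [exceptionalDegree, Fin.sum_univ_two, Fin.sum_univ_four, two]
    abel
  have hdeg' : Finsupp.single (side b (r 0)) 1 + Finsupp.single (side (!b) (c 0)) 1 +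
      (Finsupp.single (side b (r 0)) 1 + Finsupp.single (side (!b) (c 1)) 1 +
      (Finsupp.single (side b (r 1)) 1 + Finsupp.single (side (!b) (c 2)) 1 +
      (Finsupp.single (side b (r 1)) 1 + Finsupp.single (side (!b) (c 3)) 1))) =
      exceptionalDegree (b, r, c) := by
    simp only [exceptionalDegree, Fin.sum_univ_two, Fin.sum_univ_four, two]
    abel
  rw [exceptionalSyzygy, ruleSyzygy, ruleCoeff_of_sameLine (hline _ _ _),
    ruleCoeff_of_sameLine (hline _ _ _), zero_smul, zero_smul, sub_zero, sub_zero, map_sub,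
    exceptionalDual, lineFunctional_tensorX, lineFunctional_tensorX, fiberSum_quadratic,
    fiberSum_quadratic]
  simp only [hline, true_and, rowColDegree_flip]
  rw [hdeg, hdeg']
  simp only [exceptionalDegree_injective.eq_iff]
  split_ifs with hst
  · subst hst
    simp [(side_injective b).eq_iff, (side_ne b _ _).symm]
  · simp

/-- A criterion for linear independence modulo a subspace. -/
theorem finrank_sup_span_of_dual {M T : Type*} [AddCommGroup M] [Module k M] [Fintype T]
    [DecidableEq T] (B : Submodule k M) (δ : T → M) (L : T → M →ₗ[k] k)
    [Module.Finite k ↥(B ⊔ Submodule.span k (Set.range δ))]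
    (hB : ∀ t, ∀ g ∈ B, L t g = 0) (hδ : ∀ s t, L t (δ s) = if s = t then 1 else 0) :
    Module.finrank k ↥(B ⊔ Submodule.span k (Set.range δ)) =
      Module.finrank k B + Fintype.card T := by
  set Z := B ⊔ Submodule.span k (Set.range δ)
  let f : M →ₗ[k] T → k := LinearMap.pi L
  have hf : ∀ c : T → k, f (∑ s, c s • δ s) = c := by
    intro c
    ext t
    simp [f, hδ]
  have hker : LinearMap.ker (f.domRestrict Z) = B.comap Z.subtype := by
    ext ⟨z, hz⟩
    simp only [LinearMap.mem_ker, LinearMap.domRestrict_apply, Submodule.mem_comap,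
      Submodule.subtype_apply]
    constructor
    · intro h0
      obtain ⟨y, hy, u, hu, rfl⟩ := Submodule.mem_sup.mp hz
      obtain ⟨c, rfl⟩ := (Submodule.mem_span_range_iff_exists_fun k).mp hu
      have hy0 : f y = 0 := funext fun t => hB t y hy
      rw [map_add, hf, hy0, zero_add] at h0
      simpa [h0] using hy
    · exact fun hz => funext fun t => hB t z hz
  have hrange : LinearMap.range (f.domRestrict Z) = ⊤ := by
    refine LinearMap.range_eq_top.mpr fun c => ⟨⟨∑ s, c s • δ s, ?_⟩, hf c⟩
    exact Submodule.mem_sup_right ((Submodule.mem_span_range_iff_exists_fun k).mpr ⟨c, rfl⟩)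
  have := LinearMap.finrank_range_add_finrank_ker (f.domRestrict Z)
  rw [hrange, hker, finrank_top, Module.finrank_fintype_fun_eq_card,
    (Submodule.comapSubtypeEquivOfLe (le_sup_left : B ≤ Z)).finrank_eq] at this
  rw [← this, add_comm]

theorem HasStandardRules.finrank_cubicSyzygies (h : HasStandardRules (1 : k) I) :
    Module.finrank k (cubicSyzygies I) =
      Module.finrank k (koszulRelations I) + 2 * n.choose 2 * n.choose 4 := by
  classical
  have := finite_cubicSyzygies I
  rw [h.cubicSyzygies_eq_sup] at this ⊢
  rw [finrank_sup_span_of_dual _ _ (exceptionalDual k)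
    (fun t g hg => h.exceptionalDual_eq_zero t hg) exceptionalDual_exceptionalSyzygy,
    ← Nat.card_eq_fintype_card, card_exceptionalIndex]

end Exceptional


/-! ### Rank counts in the Koszul strand -/

section Dimensions

variable {ι k : Type*} [Field k] [Fintype ι]

theorem sum_prod_eq_sum_lt {M : Type*} [AddCommMonoid M] {N : ℕ} (e : ι ≃ Fin N) (F : ι × ι → M)
    (hF : ∀ a, F (a, a) = 0) :
    ∑ p, F p = ∑ p : {p : ι × ι // e p.1 < e p.2}, (F p + F p.1.swap) := by
  rw [Finset.sum_add_distrib]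
  have h1 : ∑ p : {p : ι × ι // e p.1 < e p.2}, F p = ∑ p, if e p.1 < e p.2 then F p else 0 := by
    rw [← Finset.sum_filter]
    exact (Finset.sum_subtype _ (by simp) _).symm
  have h2 : ∑ p : {p : ι × ι // e p.1 < e p.2}, F p.1.swap =
      ∑ p, if e p.2 < e p.1 then F p else 0 := by
    rw [← (Equiv.prodComm ι ι).sum_comp, ← Finset.sum_filter]
    exact (Finset.sum_subtype (Finset.univ.filter fun p : ι × ι => e p.1 < e p.2) (by simp)
      (fun p => F p.swap)).symm
  rw [h1, h2, ← Finset.sum_add_distrib]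
  refine Finset.sum_congr rfl fun p _ => ?_
  rcases lt_trichotomy (e p.1) (e p.2) with h | h | h
  · simp [h, h.not_gt]
  · have : p = (p.1, p.1) := Prod.ext rfl (e.injective h).symm
    rw [this, hF]
    simp
  · simp [h, h.not_gt]

variable [DecidableEq ι]

theorem two_mul_card_lt {N : ℕ} (e : ι ≃ Fin N) :
    2 * Fintype.card {p : ι × ι // e p.1 < e p.2} + N = N * N := by
  have h := sum_prod_eq_sum_lt e (fun p => if p.1 = p.2 then 0 else 1) (by simp)
  have h1 : ∑ p : {p : ι × ι // e p.1 < e p.2}, ((if p.1.1 = p.1.2 then 0 else 1) +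
      if p.1.swap.1 = p.1.swap.2 then 0 else 1) =
      Fintype.card {p : ι × ι // e p.1 < e p.2} * 2 := by
    rw [Finset.sum_congr rfl (g := fun _ => 2), Finset.sum_const, Finset.card_univ, smul_eq_mul]
    rintro ⟨p, hp⟩ _
    have hne : p.1 ≠ p.2 := fun h => by simp [h] at hp
    simp [hne, hne.symm]
  have h2 : (∑ p : ι × ι, if p.1 = p.2 then 0 else 1) + N = N * N := by
    have hc : Fintype.card ι = N := by rw [Fintype.card_congr e, Fintype.card_fin]
    have h3 : (∑ p : ι × ι, if p.1 = p.2 then 1 else 0) = N := by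
      rw [Fintype.sum_prod_type]
      simp [hc]
    refine Eq.trans (congrArg _ h3.symm) ?_
    rw [← Finset.sum_add_distrib, Finset.sum_congr rfl (g := fun _ => 1)]
    · simp [hc]
    · intro p _
      split_ifs <;> rfl
  rw [h, h1] at h2
  omega

/-- Koszul relations are parametrized by pairs of variables and a quadric. -/
def koszulMap {N : ℕ} (e : ι ≃ Fin N) (I : Ideal (MvPolynomial ι k)) :
    ({p : ι × ι // e p.1 < e p.2} → idealPart I 2) →ₗ[k] (ι → MvPolynomial ι k) :=
  ∑ p, (tensorX p.1.1 ∘ₗ LinearMap.mulLeft k (X p.1.2) -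
    tensorX p.1.2 ∘ₗ LinearMap.mulLeft k (X p.1.1)) ∘ₗ (idealPart I 2).subtype ∘ₗ LinearMap.proj p

theorem koszulMap_apply {N : ℕ} (e : ι ≃ Fin N) (I : Ideal (MvPolynomial ι k))
    (u : {p : ι × ι // e p.1 < e p.2} → idealPart I 2) : koszulMap e I u =
      ∑ p, (tensorX p.1.1 (X p.1.2 * (u p : MvPolynomial ι k)) -
        tensorX p.1.2 (X p.1.1 * (u p : MvPolynomial ι k))) := by
  simp only [koszulMap, LinearMap.sum_apply, LinearMap.comp_apply, LinearMap.sub_apply,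
    LinearMap.mulLeft_apply, LinearMap.proj_apply, Submodule.subtype_apply]

theorem range_koszulMap {N : ℕ} (e : ι ≃ Fin N) (I : Ideal (MvPolynomial ι k)) :
    LinearMap.range (koszulMap e I) = koszulRelations I := by
  refine le_antisymm ?_ (Submodule.span_le.mpr ?_)
  · rintro _ ⟨u, rfl⟩
    rw [koszulMap_apply]
    exact Submodule.sum_mem _ fun p _ => Submodule.subset_span ⟨_, _, _, (u p).2, rfl⟩
  · have key : ∀ x y, e x < e y → ∀ q ∈ idealPart I 2,
        tensorX x (X y * q) - tensorX y (X x * q) ∈ LinearMap.range (koszulMap e I) := by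
      intro x y hxy q hq
      refine ⟨Pi.single ⟨(x, y), hxy⟩ ⟨q, hq⟩, ?_⟩
      rw [koszulMap_apply, Finset.sum_eq_single ⟨(x, y), hxy⟩]
      · simp only [Pi.single_eq_same]
      · intro p _ hp
        simp [Pi.single_eq_of_ne hp]
      · simp
    rintro _ ⟨x, y, q, hq, rfl⟩
    rcases lt_trichotomy (e x) (e y) with h | h | h
    · exact key x y h q hq
    · rw [e.injective h, sub_self]
      exact Submodule.zero_mem _
    · rw [← neg_sub]
      exact Submodule.neg_mem _ (key y x h q hq)

theorem koszulMap_of_alternating {N : ℕ} (e : ι ≃ Fin N) (I : Ideal (MvPolynomial ι k))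
    (u : {p : ι × ι // e p.1 < e p.2} → idealPart I 2) (h : ι → ι → MvPolynomial ι k)
    (h0 : ∀ a, h a a = 0) (hneg : ∀ a b, h a b = -h b a) (hu : ∀ p, u p = h p.1.1 p.1.2) (a : ι) :
    koszulMap e I u a = ∑ b, X b * h a b := by
  have hs := sum_prod_eq_sum_lt e (fun p : ι × ι => tensorX p.1 (X p.2 * h p.1 p.2))
    (fun a => by rw [h0, mul_zero, map_zero])
  have h1 : koszulMap e I u = ∑ p : ι × ι, tensorX p.1 (X p.2 * h p.1 p.2) := by
    rw [koszulMap_apply, hs]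
    refine Finset.sum_congr rfl fun p _ => ?_
    rw [hu, sub_eq_add_neg, ← map_neg]
    simp only [Prod.fst_swap, Prod.snd_swap]
    rw [hneg p.1.2 p.1.1, mul_neg]
  rw [h1, Fintype.sum_prod_type, Finset.sum_apply, Finset.sum_eq_single a]
  · rw [Finset.sum_apply]
    simp [tensorX]
  · intro b _ hb
    rw [Finset.sum_apply]
    exact Finset.sum_eq_zero fun c _ => by simp [tensorX, hb.symm]
  · simp

/-- Rank–nullity for `koszulMap`: its source has dimension C(N,2) dim I₂ for N variables, its image
is `koszulRelations`, and its kernel is that of the alternating families, restricted to ordered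
pairs. The doubled, additive form avoids division and subtraction in ℕ. -/
theorem finrank_alternatingSyzygies (I : Ideal (MvPolynomial ι k)) :
    2 * (Module.finrank k (alternatingSyzygies I) + Module.finrank k (koszulRelations I)) +
      Fintype.card ι * Module.finrank k (idealPart I 2) =
      Fintype.card ι * Fintype.card ι * Module.finrank k (idealPart I 2) := by
  let e := Fintype.equivFin ι
  let f : alternatingSyzygies I →ₗ[k] ({p : ι × ι // e p.1 < e p.2} → idealPart I 2) :=
    { toFun := fun h p => ⟨h.1 p.1.1 p.1.2, h.2.1 _ _⟩
      map_add' := fun _ _ => rfl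
      map_smul' := fun _ _ => rfl }
  have hinj : Function.Injective f := by
    intro g h hgh
    have key : ∀ a b, e a < e b → g.1 a b = h.1 a b := fun a b hab =>
      congrArg Subtype.val (congrFun hgh ⟨(a, b), hab⟩)
    refine Subtype.ext (funext fun a => funext fun b => ?_)
    rcases lt_trichotomy (e a) (e b) with hab | hab | hab
    · exact key a b hab
    · rw [e.injective hab, g.2.2.1, h.2.2.1]
    · rw [g.2.2.2.1, h.2.2.2.1, key b a hab]
  have hrange : LinearMap.range f = LinearMap.ker (koszulMap e I) := by
    ext u
    rw [LinearMap.mem_ker]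
    constructor
    · rintro ⟨h, rfl⟩
      funext a
      rw [koszulMap_of_alternating e I _ h.1 h.2.2.1 h.2.2.2.1 fun p => rfl, h.2.2.2.2]
      rfl
    · intro hu
      let h : ι → ι → MvPolynomial ι k := fun a b =>
        if hab : e a < e b then u ⟨(a, b), hab⟩ else
          if hba : e b < e a then -(u ⟨(b, a), hba⟩ : MvPolynomial ι k) else 0
      have h0 : ∀ a, h a a = 0 := fun a => by simp [h]
      have hneg : ∀ a b, h a b = -h b a := by
        intro a b
        rcases lt_trichotomy (e a) (e b) with hab | hab | hab
        · simp [h, hab, hab.not_gt]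
        · simp [h, hab]
        · simp [h, hab, hab.not_gt]
      have hmem : ∀ a b, h a b ∈ idealPart I 2 := by
        intro a b
        simp only [h]
        split_ifs
        · exact (u _).2
        · exact neg_mem (u _).2
        · exact zero_mem _
      have hup : ∀ p, u p = h p.1.1 p.1.2 := by
        rintro ⟨⟨a, b⟩, hab⟩
        simp [h, hab]
      refine ⟨⟨h, hmem, h0, hneg, fun a => ?_⟩, funext fun p => Subtype.ext (hup p).symm⟩
      rw [← koszulMap_of_alternating e I u h h0 hneg hup, hu]
      rfl
  have hrank := LinearMap.finrank_range_add_finrank_ker (koszulMap e I)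
  rw [range_koszulMap, ← hrange, LinearMap.finrank_range_of_inj hinj,
    Module.finrank_pi_fintype, Finset.sum_const, Finset.card_univ, smul_eq_mul] at hrank
  rw [add_comm (Module.finrank k (alternatingSyzygies I)), hrank, ← two_mul_card_lt e]
  ring

/-- Rank–nullity for the multiplication V ⊗ I₃ → I₄, which `h4` makes surjective. -/
theorem finrank_cubicSyzygies_add (I : Ideal (MvPolynomial ι k))
    (h4 : idealPart I 4 ≤ Submodule.span k {p | ∃ a, ∃ q ∈ idealPart I 3, p = X a * q}) :
    Module.finrank k (cubicSyzygies I) + Module.finrank k (idealPart I 4) =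
      Fintype.card ι * Module.finrank k (idealPart I 3) := by
  let f : cubicSyzygies I →ₗ[k] (ι → idealPart I 3) :=
    { toFun := fun g a => ⟨g.1 a, g.2.1 a⟩
      map_add' := fun _ _ => rfl
      map_smul' := fun _ _ => rfl }
  have hinj : Function.Injective f := fun g h hgh => Subtype.ext (funext fun a =>
    congrArg Subtype.val (congrFun hgh a))
  let m : (ι → idealPart I 3) →ₗ[k] MvPolynomial ι k :=
    ∑ a, LinearMap.mulLeft k (X a) ∘ₗ (idealPart I 3).subtype ∘ₗ LinearMap.proj a
  have hm : ∀ g, m g = ∑ a, X a * (g a : MvPolynomial ι k) := fun g => by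
    simp [m]
  have hker : LinearMap.range f = LinearMap.ker m := by
    ext g
    rw [LinearMap.mem_ker, hm]
    constructor
    · rintro ⟨g, rfl⟩
      exact g.2.2
    · exact fun hg => ⟨⟨fun a => g a, fun a => (g a).2, hg⟩, rfl⟩
  have hrange : LinearMap.range m = idealPart I 4 := by
    refine le_antisymm ?_ (h4.trans (Submodule.span_le.mpr ?_))
    · rintro _ ⟨g, rfl⟩
      rw [hm]
      exact Submodule.sum_mem _ fun a _ => X_mul_mem_idealPart a (g a).2
    · rintro _ ⟨a, q, hq, rfl⟩
      refine ⟨Pi.single a ⟨q, hq⟩, ?_⟩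
      rw [hm, Finset.sum_eq_single a]
      · simp
      · intro b _ hb
        simp [Pi.single_eq_of_ne hb]
      · simp
  have hrank := LinearMap.finrank_range_add_finrank_ker m
  rw [hrange, ← hker, LinearMap.finrank_range_of_inj hinj, Module.finrank_pi_fintype,
    Finset.sum_const, Finset.card_univ, smul_eq_mul] at hrank
  rw [← hrank, add_comm]

end Dimensions

/-! ### The Betti number -/

section Main

variable {k : Type*} [Field k] {n : ℕ} {ε : k} {I : Ideal (MvPolynomial (Fin n × Fin n) k)}

/-- Monomials of degree at most 1 are vacuously standard. -/
theorem HasStandardRules.eq_zero_of_isHomogeneous (h : HasStandardRules ε I) {d : ℕ} (hd : d ≤ 1)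
    {p : MvPolynomial (Fin n × Fin n) k} (hp : p ∈ I) (hp' : p.IsHomogeneous d) : p = 0 := by
  refine h.eq_zero p hp fun s hs => ?_
  have hdeg := degree_of_mem_support hp' hs
  intro a b hab
  have hle := Finsupp.degree_mono hab
  rw [map_add, Finsupp.degree_single, Finsupp.degree_single] at hle
  omega

theorem HasStandardRules.constantCoeff_eq_zero (h : HasStandardRules ε I) :
    ∀ p ∈ I, constantCoeff p = 0 := by
  intro p hp
  have h0 := h.eq_zero_of_isHomogeneous zero_le_one (h.graded p hp 0)
    (homogeneousComponent_isHomogeneous 0 p)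
  rw [homogeneousComponent_zero, C_eq_zero] at h0
  exact h0

theorem HasStandardRules.nonempty_resolution (h : HasStandardRules ε I) :
    Nonempty (MinimalGradedFreeResolution I) :=
  exists_minimalGradedFreeResolution I h.graded h.constantCoeff_eq_zero

theorem HasStandardRules.idealPart_one (h : HasStandardRules ε I) :
    ∀ p ∈ idealPart I 1, p = 0 :=
  fun _ hp => h.eq_zero_of_isHomogeneous le_rfl hp.1 hp.2

theorem HasStandardRules.finrank_linearSecondSyzygies (h : HasStandardRules ε I)
    (F : MinimalGradedFreeResolution I) :
    Module.finrank k F.linearSecondSyzygies = F.betti 3 4 :=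
  F.finrank_linearSecondSyzygies_eq_betti
    (F.three_le_deg_two h.constantCoeff_eq_zero h.idealPart_one).2

theorem cast_choose_two (m : ℕ) : (m.choose 2 : ℚ) = m * (m - 1) / 2 := by
  induction m with
  | zero => simp
  | succ m ih =>
    rw [Nat.choose_succ_succ', Nat.cast_add, ih, Nat.choose_one_right]
    push_cast
    ring

theorem cast_choose_three (m : ℕ) : (m.choose 3 : ℚ) = m * (m - 1) * (m - 2) / 6 := by
  induction m with
  | zero => simp
  | succ m ih =>
    rw [Nat.choose_succ_succ', Nat.cast_add, ih, cast_choose_two]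
    push_cast
    ring

theorem cast_choose_four (m : ℕ) : (m.choose 4 : ℚ) = m * (m - 1) * (m - 2) * (m - 3) / 24 := by
  induction m with
  | zero => simp
  | succ m ih =>
    rw [Nat.choose_succ_succ', Nat.cast_add, ih, cast_choose_three]
    push_cast
    ring

/-- The polynomial is C(N,2) dim I₂ − N dim I₃ + dim I₄ with N = n² and dim I_d = C(N+d−1, d) −
C(n,d)²; τ measures the failure of exactness at V ⊗ I₃. -/
theorem HasStandardRules.betti_eq (h : HasStandardRules ε I) (F : MinimalGradedFreeResolution I)
    {τ : ℕ} (hτ : Module.finrank k (cubicSyzygies I) = Module.finrank k (koszulRelations I) + τ) :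
    (F.betti 3 4 : ℚ) = 1 / 192 * ((n : ℚ) - 1) * (n : ℚ) ^ 2 * ((n : ℚ) + 1) ^ 2 *
      ((n : ℚ) + 2) * (5 * (n : ℚ) ^ 2 + 5 * (n : ℚ) - 18) + τ := by
  have h1 := F.finrank_linearSecondSyzygies h.constantCoeff_eq_zero h.idealPart_one
  rw [h.finrank_linearSecondSyzygies] at h1
  have hA := finrank_alternatingSyzygies I
  have hZ := finrank_cubicSyzygies_add I h.idealPart_four_le
  rw [← h1] at hA
  rw [hτ] at hZ
  have i2 := h.finrank_idealPart 2
  have i3 := h.finrank_idealPart 3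
  have i4 := h.finrank_idealPart 4
  simp only [Fintype.card_prod, Fintype.card_fin] at hA hZ
  have e2 : n * n + 2 - 1 = n * n + 1 := rfl
  have e3 : n * n + 3 - 1 = n * n + 2 := rfl
  have e4 : n * n + 4 - 1 = n * n + 3 := rfl
  rw [e2] at i2
  rw [e3] at i3
  rw [e4] at i4
  have hA' := congrArg (Nat.cast : ℕ → ℚ) hA
  have hZ' := congrArg (Nat.cast : ℕ → ℚ) hZ
  have i2' := congrArg (Nat.cast : ℕ → ℚ) i2
  have i3' := congrArg (Nat.cast : ℕ → ℚ) i3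
  have i4' := congrArg (Nat.cast : ℕ → ℚ) i4
  push_cast [cast_choose_two, cast_choose_three, cast_choose_four] at hA' hZ' i2' i3' i4'
  linear_combination (1 / 2) * hA' - hZ' + ((n : ℚ) ^ 4 - (n : ℚ) ^ 2) / 2 * i2' -
    (n : ℚ) ^ 2 * i3' + i4'

end Main

theorem mainTheorem8 (k : Type*) [Field k] (n : ℕ) (hn : 1 ≤ n) :
    (ringChar k ≠ 2 →
      Nonempty (MinimalGradedFreeResolution (apolarIdeal (detPoly k n))) ∧
      ∀ F : MinimalGradedFreeResolution (apolarIdeal (detPoly k n)),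
        Module.finrank k F.linearSecondSyzygies = F.betti 3 4 ∧
        (F.betti 3 4 : ℚ) = 1 / 192 * ((n : ℚ) - 1) * (n : ℚ) ^ 2 * ((n : ℚ) + 1) ^ 2 *
          ((n : ℚ) + 2) * (5 * (n : ℚ) ^ 2 + 5 * (n : ℚ) - 18) ∧
        F.betti 3 4 = 6 * (n + 1).choose 4 * (n + 3).choose 4 + 9 * (n + 2).choose 4 ^ 2) ∧
    (Nonempty (MinimalGradedFreeResolution (apolarIdeal (permPoly k n))) ∧
      ∀ F : MinimalGradedFreeResolution (apolarIdeal (permPoly k n)),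
        Module.finrank k F.linearSecondSyzygies = F.betti 3 4 ∧
        (F.betti 3 4 : ℚ) = 1 / 192 * ((n : ℚ) - 1) * (n : ℚ) ^ 2 *
          (5 * (n : ℚ) ^ 5 + 25 * (n : ℚ) ^ 4 + 35 * (n : ℚ) ^ 3 - 85 * (n : ℚ) ^ 2
            + 8 * (n : ℚ) - 84) ∧
        F.betti 3 4 = 6 * (n + 1).choose 4 * (n + 3).choose 4 + 9 * (n + 2).choose 4 ^ 2
          + 2 * n.choose 2 * n.choose 4) := by
  refine ⟨fun hchar => ?_, ?_⟩
  · have h := hasStandardRules_detPoly k n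
    -- The characteristic enters only here: in characteristic 2 determinant and permanent coincide.
    have hε : (-1 : k) ≠ 1 := Ring.neg_one_ne_one_of_char_ne_two hchar
    refine ⟨h.nonempty_resolution, fun F => ⟨h.finrank_linearSecondSyzygies F, ?_⟩⟩
    have hb := h.betti_eq F (τ := 0) (by rw [h.cubicSyzygies_eq_koszulRelations hε, add_zero])
    rw [Nat.cast_zero, add_zero] at hb
    refine ⟨hb, ?_⟩
    have : (F.betti 3 4 : ℚ) = ((6 * (n + 1).choose 4 * (n + 3).choose 4 +
        9 * (n + 2).choose 4 ^ 2 : ℕ) : ℚ) := by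
      rw [hb]
      push_cast [cast_choose_four]
      ring
    exact_mod_cast this
  · have h := hasStandardRules_permPoly k n
    refine ⟨h.nonempty_resolution, fun F => ⟨h.finrank_linearSecondSyzygies F, ?_⟩⟩
    have hb := h.betti_eq F h.finrank_cubicSyzygies
    push_cast [cast_choose_two, cast_choose_four] at hb
    constructor
    · rw [hb]
      ring
    · have : (F.betti 3 4 : ℚ) = ((6 * (n + 1).choose 4 * (n + 3).choose 4 +
          9 * (n + 2).choose 4 ^ 2 + 2 * n.choose 2 * n.choose 4 : ℕ) : ℚ) := by
        rw [hb]
        push_cast [cast_choose_two, cast_choose_four]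
        ring
      exact_mod_cast this

end
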